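/- **Notation.** For $a=(a_0,a_1,a_2;a_3,a_4)\in\mathbb C^5$ put $s(a)=a_3+a_4-a_0-a_1-a_2$ and $$f(a)=\sum_{k\ge 0}\frac{\Gamma(a_0+k)\Gamma(a_1+k)\Gamma(a_2+k)}{\Gamma(1+k)\Gamma(a_3+k)\Gamma(a_4+k)} ,$$ which converges absolutely if $\operatorname{Re}s(a)>0$ and no $a_i$ is an integer. Let $\sigma_0^{(0)}=\mathrm{id}$ and let $$\begin{aligned} \sigma_1^{(0)}(a)&=(a_0+1-a_3,\,a_1+1-a_3,\,a_2+1-a_3;\,2-a_3,\,a_4+1-a_3),\\ \sigma_2^{(0)}(a)&=(a_0+1-a_4,\,a_1+1-a_4,\,a_2+1-a_4;\,a_3+1-a_4,\,2-a_4),\\ \sigma_0^{(\infty)}(a)&=(a_0,\,a_0+1-a_3,\,a_0+1-a_4;\,a_0+1-a_1,\,a_0+1-a_2),\\ \sigma_1^{(\infty)}(a)&=(a_1+1-a_3,\,a_1,\,a_1+1-a_4;\,a_1+1-a_0,\,a_1+1-a_2),\\ \sigma_2^{(\infty)}(a)&=(a_2+1-a_4,\,a_2+1-a_3,\,a_2;\,a_2+1-a_1,\,a_2+1-a_0).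 \end{aligned}$$ These are involutions preserving $s$. The six companion functions are $y_i^{(0)}(a)=f(\sigma_i^{(0)}(a))$ and $y_i^{(\infty)}(a)=e^{\mathrm i\pi s(a)}f(\sigma_i^{(\infty)}(a))$, $i=0,1,2$. They are considered at generic $a$ (no $a_i$ and no $a_i-a_j$ with $i\ne j$ is an integer) with $\operatorname{Re}s(a)>0$; correspondingly, an identity between $h(a)$, $h(a+p)$, $h(a+q)$ with $p,q\in\mathbb Z^5$ is understood at all generic $a$ at which the functions occurring in it are given by convergent series (that is, $\operatorname{Re}s>0$ at the respective arguments) and at which its rational coefficients have no pole. *Contiguous matrices.* Put $\varphi_1=a_0+a_1+a_2$, $\varphi_2=a_0a_1+a_1a_2+a_2a_0$, $\varphi_3=a_0a_1a_2$, $s=s(a)$, let $e_i$ be the unit vectors of $\mathbb Z^5$, and define, for $\{i,j,k\}=\{0,1,2\}$, $$A_i^+(a)=\begin{pmatrix}a_i&1\\ \frac{\varphi_3}{s-2}&\frac{a_ja_k-(a_i-a_3+1)(a_i-a_4+1)}{s-2}\end{pmatrix},\quad A_i^-(a)=\begin{pmatrix}\frac{(a_i-a_3)(a_i-a_4)-a_ja_k}{(a_i-1)(a_i-a_3)(a_i-a_4)}&\frac{s-1}{(a_i-1)(a_i-a_3)(a_i-a_4)}\\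 \frac{a_ja_k}{(a_i-a_3)(a_i-a_4)}&-\frac{s-1}{(a_i-a_3)(a_i-a_4)}\end{pmatrix},$$ and, for $i=3,4$, with $d_i=(a_i-a_0)(a_i-a_1)(a_i-a_2)$, $$A_i^+(a)=\frac1{d_i}\begin{pmatrix}a_i^2-\varphi_1a_i+\varphi_2&-(s-1)\\-\varphi_3&a_i(s-1)\end{pmatrix},\quad A_i^-(a)=\begin{pmatrix}a_i-1&1\\ \frac{\varphi_3}{s-2}&\frac{(a_i-1)^2-\varphi_1(a_i-1)+\varphi_2}{s-2}\end{pmatrix}.$$ Along a lattice path $0=p_0,p_1,\dots,p_m$ with steps $p_k-p_{k-1}=\varepsilon_ke_{i_k}$, $\varepsilon_k=\pm1$, form the product $A_{i_m}^{\varepsilon_m}(a+p_{m-1})\cdots A_{i_1}^{\varepsilon_1}(a)$ over $\mathbb Q(a)$. Also put $(x,n)=\Gamma(x+n)/\Gamma(x)$ for $n\in\mathbb Z$ and $$\delta(a;p)=\frac{(-1)^{p_0+p_1+p_2}\,(s(a)-1,s(p))\prod_{i=0}^2(a_i,p_i)}{\prod_{i=0}^2\prod_{j=3}^4(a_j-a_i,p_j-p_i)}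 .$$ **Theorem 1.1.** Let $p,q\in\mathbb Z^5$, $p\neq q$. 1. For each of the six companion functions $h$, the functions $h(a+p)$ and $h(a+q)$ are linearly independent over $\mathbb C(a)$. 2. For each of the six companion functions $h$ there are unique $u,v\in\mathbb Q(a)$ with $$h(a)=u(a)\,h(a+p)+v(a)\,h(a+q).\qquad(*)$$ 3. These $u,v$ are the same for all six functions $h$. 4. They are given by the following finite recipe. Every $r\in\mathbb Z^5$ is the end point of a lattice path from $0$ of length $\sum_j|r_j|$. Take any lattice path from $0$ to $p$ and any one from $0$ to $q$, and let $(r_1(a;p),r(a;p))$ and $(r_1(a;q),r(a;q))$ be the top rows of the corresponding products of contiguous matrices. Then $\Delta=r_1(a;p)r(a;q)-r(a;p)r_1(a;q)\ne0$ in $\mathbb Q(a)$, and $u=r(a;q)/\Delta$, $v=-r(a;p)/\Delta$. Alternatively, $u=r(a;q)/\big(\delta(a;p)\,r(a+p;q-p)\big)$ and $v=-r(a;p)/\big(\delta(a;p)\,r(a+p;q-p)\big)$, with non-zero denominators, where $r(a+p;q-p)$ is the upper right entry of the product along any lattice path from $0$ to $q-p$, with $a$ replaced by $a+p$. 5. Let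 $G$ be the group of affine transformations of $\mathbb C^5$ generated by the involutions $\sigma_i^{(\nu)}$, and write $\bar\sigma$ for the linear part of $\sigma\in G$. Then $|G|=72$, and there is an isomorphism $\Phi:G\to S_2\ltimes(S_3\times S_3)$, where $S_2$ permutes the two factors $S_3$, independent of $p,q$, which sends $\sigma_0^{(\infty)}$ to the generator of $S_2$ and $\sigma_1^{(0)}$, $\sigma_2^{(0)}$ to the transpositions $(0\,1)$, $(0\,2)$ of the second factor $S_3$. Let $\chi(\sigma)=\pm1$ be the sign of the $S_2$-component of $\Phi(\sigma)$. For every $\sigma\in G$ the vectors $\bar\sigma(p),\bar\sigma(q)$ lie in $\mathbb Z^5$, and for each of the six functions $h$, with $u,v$ as in $(*)$, $$h(a)=\chi(\sigma)^{s(p)}\,u(\sigma^{-1}(a))\,h(a+\bar\sigma(p))+\chi(\sigma)^{s(q)}\,v(\sigma^{-1}(a))\,h(a+\bar\sigma(q)).$$ -/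

import Mathlib

open scoped BigOperators

noncomputable section

namespace ThreeTerm

/-! ### Parameters

A parameter vector `(a₀, a₁, a₂; b₁, b₂) = (a₀, a₁, a₂; a₃, a₄)` is a function `Fin 5 → R`. -/

/-- The Saalschütz index `s(a) = a₃ + a₄ - a₀ - a₁ - a₂`. -/
def saal {R : Type*} [CommRing R] (a : Fin 5 → R) : R := a 3 + a 4 - a 0 - a 1 - a 2

/-- An integer vector, viewed as a vector with entries in `R`. -/
def intVec (R : Type*) [CommRing R] (p : Fin 5 → ℤ) : Fin 5 → R := fun j => (p j : R)

/-- Genericness: no `aᵢ` and no difference `aᵢ - aⱼ` (`i ≠ j`) is an integer. -/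
def Generic (a : Fin 5 → ℂ) : Prop :=
  (∀ i, ∀ n : ℤ, a i ≠ n) ∧ ∀ i j, i ≠ j → ∀ n : ℤ, a i - a j ≠ n

/-- The two singular points `0` and `∞` to which the companion functions are attached. -/
inductive SingPt
  | zero
  | infty

/-- The six parameter involutions `σᵢ^{(0)}`, `σᵢ^{(∞)}`, `i = 0, 1, 2`
(`σ₀^{(0)}` is the identity). -/
def paramMap {R : Type*} [CommRing R] : SingPt → Fin 3 → (Fin 5 → R) → (Fin 5 → R)
  | .zero, 0, a => a
  | .zero, 1, a => ![a 0 + 1 - a 3, a 1 + 1 - a 3, a 2 + 1 - a 3, 2 - a 3, a 4 + 1 - a 3]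
  | .zero, 2, a => ![a 0 + 1 - a 4, a 1 + 1 - a 4, a 2 + 1 - a 4, a 3 + 1 - a 4, 2 - a 4]
  | .infty, 0, a => ![a 0, a 0 + 1 - a 3, a 0 + 1 - a 4, a 0 + 1 - a 1, a 0 + 1 - a 2]
  | .infty, 1, a => ![a 1 + 1 - a 3, a 1, a 1 + 1 - a 4, a 1 + 1 - a 0, a 1 + 1 - a 2]
  | .infty, 2, a => ![a 2 + 1 - a 4, a 2 + 1 - a 3, a 2, a 2 + 1 - a 1, a 2 + 1 - a 0]

/-! ### The hypergeometric functions -/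

/-- The renormalized series
`f(a; z) = ∑ₖ Γ(a₀+k) Γ(a₁+k) Γ(a₂+k) / (Γ(1+k) Γ(a₃+k) Γ(a₄+k)) zᵏ`. -/
def hgf (a : Fin 5 → ℂ) (z : ℂ) : ℂ :=
  ∑' k : ℕ, Complex.Gamma (a 0 + k) * Complex.Gamma (a 1 + k) * Complex.Gamma (a 2 + k) /
    (Complex.Gamma (1 + k) * Complex.Gamma (a 3 + k) * Complex.Gamma (a 4 + k)) * z ^ k

/-- The lower parameters `b₀ = 1, b₁ = a₃, b₂ = a₄`. -/
def lowerParam (a : Fin 5 → ℂ) : Fin 3 → ℂ := ![1, a 3, a 4]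

/-- The upper parameters `a₀, a₁, a₂`. -/
def upperParam (a : Fin 5 → ℂ) : Fin 3 → ℂ := ![a 0, a 1, a 2]

/-- `yᵢ^{(0)}(a; z) = z^{1 - bᵢ} f(σᵢ^{(0)}(a); z)` and
`yᵢ^{(∞)}(a; z) = e^{iπ s(a)} z^{-aᵢ} f(σᵢ^{(∞)}(a); 1/z)`. -/
def solution : SingPt → Fin 3 → (Fin 5 → ℂ) → ℂ → ℂ
  | .zero, i, a, z => z ^ (1 - lowerParam a i) * hgf (paramMap .zero i a) z
  | .infty, i, a, z => Complex.exp (Complex.I * Real.pi * saal a) * z ^ (-(upperParam a i)) *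
      hgf (paramMap .infty i a) (1 / z)

/-- The six companion functions `yᵢ^{(ν)}(a) = yᵢ^{(ν)}(a; 1)`. -/
def companion (ν : SingPt) (i : Fin 3) (a : Fin 5 → ℂ) : ℂ := solution ν i a 1

/-- The domain on which all six functions `h(a + p)` are defined by convergent series:
`a` is generic and `Re s(a + p) > 0`. -/
def domain (p : Fin 5 → ℤ) : Set (Fin 5 → ℂ) :=
  {a | Generic a ∧ 0 < (saal (a + intVec ℂ p)).re}

/-! ### Rational functions of `a₀, …, a₄` and their values -/

/-- The rational function field `K(a) = K(a₀, …, a₄)`. -/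
abbrev RatFun (K : Type*) [Field K] := FractionRing (MvPolynomial (Fin 5) K)

/-- The reduced denominator of `u` does not vanish at the point `a`. -/
def RegularAt {K : Type*} [Field K] [Algebra K ℂ] (u : RatFun K) (a : Fin 5 → ℂ) : Prop :=
  MvPolynomial.aeval a
    (IsFractionRing.den (MvPolynomial (Fin 5) K) u : MvPolynomial (Fin 5) K) ≠ 0

/-- The value of the rational function `u` at a point `a` at which it is regular. -/
def evalAt {K : Type*} [Field K] [Algebra K ℂ] (u : RatFun K) (a : Fin 5 → ℂ) : ℂ :=
  MvPolynomial.aeval a (IsFractionRing.num (MvPolynomial (Fin 5) K) u) /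
    MvPolynomial.aeval a
      (IsFractionRing.den (MvPolynomial (Fin 5) K) u : MvPolynomial (Fin 5) K)

/-- Two functions `F`, `G` on `D` are linearly independent over the field `ℂ(a)`. -/
def LinIndepOverRat (D : Set (Fin 5 → ℂ)) (F G : (Fin 5 → ℂ) → ℂ) : Prop :=
  ∀ U V : RatFun ℂ,
    (∀ a ∈ D, RegularAt U a → RegularAt V a → evalAt U a * F a + evalAt V a * G a = 0) →
      U = 0 ∧ V = 0

/-- The three-term relation `h(a) = u(a) h(a + p) + v(a) h(a + q)`, at all points at which the
three functions are defined and `u`, `v` have no pole. -/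
def Relation (h : (Fin 5 → ℂ) → ℂ) (p q : Fin 5 → ℤ) (u v : RatFun ℚ) : Prop :=
  ∀ a ∈ domain 0 ∩ domain p ∩ domain q, RegularAt u a → RegularAt v a →
    h a = evalAt u a * h (a + intVec ℂ p) + evalAt v a * h (a + intVec ℂ q)

/-! ### Contiguous matrices and connection matrices -/

section Matrices

variable {K : Type*} [Field K]

/-- First elementary symmetric polynomial in `a₀, a₁, a₂`. -/
def phi1 (a : Fin 5 → K) : K := a 0 + a 1 + a 2

/-- Second elementary symmetric polynomial in `a₀, a₁, a₂`. -/
def phi2 (a : Fin 5 → K) : K := a 0 * a 1 + a 1 * a 2 + a 2 * a 0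

/-- Third elementary symmetric polynomial in `a₀, a₁, a₂`. -/
def phi3 (a : Fin 5 → K) : K := a 0 * a 1 * a 2

/-- `Aᵢ⁺(a)` for `{i, j, k} = {0, 1, 2}`. -/
def upperPlus (a : Fin 5 → K) (i j k : Fin 5) : Matrix (Fin 2) (Fin 2) K :=
  !![a i, 1;
     phi3 a / (saal a - 2),
       (a j * a k - (a i - a 3 + 1) * (a i - a 4 + 1)) / (saal a - 2)]

/-- `Aᵢ⁻(a)` for `{i, j, k} = {0, 1, 2}`. -/
def upperMinus (a : Fin 5 → K) (i j k : Fin 5) : Matrix (Fin 2) (Fin 2) K :=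
  !![((a i - a 3) * (a i - a 4) - a j * a k) / ((a i - 1) * (a i - a 3) * (a i - a 4)),
       (saal a - 1) / ((a i - 1) * (a i - a 3) * (a i - a 4));
     a j * a k / ((a i - a 3) * (a i - a 4)),
       -((saal a - 1) / ((a i - a 3) * (a i - a 4)))]

/-- `Aᵢ⁺(a)` for `i = 3, 4`. -/
def lowerPlus (a : Fin 5 → K) (i : Fin 5) : Matrix (Fin 2) (Fin 2) K :=
  !![(a i ^ 2 - phi1 a * a i + phi2 a) / ((a i - a 0) * (a i - a 1) * (a i - a 2)),
       -((saal a - 1) / ((a i - a 0) * (a i - a 1) * (a i - a 2)));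
     -(phi3 a / ((a i - a 0) * (a i - a 1) * (a i - a 2))),
       a i * (saal a - 1) / ((a i - a 0) * (a i - a 1) * (a i - a 2))]

/-- `Aᵢ⁻(a)` for `i = 3, 4`. -/
def lowerMinus (a : Fin 5 → K) (i : Fin 5) : Matrix (Fin 2) (Fin 2) K :=
  !![a i - 1, 1;
     phi3 a / (saal a - 2),
       ((a i - 1) ^ 2 - phi1 a * (a i - 1) + phi2 a) / (saal a - 2)]

/-- The contiguous matrix `Aᵢ^ε(a)`; the sign `ε = +` is `true`, `ε = -` is `false`. -/
def contigMatrix (a : Fin 5 → K) : Fin 5 → Bool → Matrix (Fin 2) (Fin 2) K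
  | 0, true => upperPlus a 0 1 2
  | 1, true => upperPlus a 1 0 2
  | 2, true => upperPlus a 2 0 1
  | 3, true => lowerPlus a 3
  | 4, true => lowerPlus a 4
  | 0, false => upperMinus a 0 1 2
  | 1, false => upperMinus a 1 0 2
  | 2, false => upperMinus a 2 0 1
  | 3, false => lowerMinus a 3
  | 4, false => lowerMinus a 4

/-- The lattice step `ε eᵢ`. -/
def step (d : Fin 5 × Bool) : Fin 5 → ℤ := Pi.single d.1 (if d.2 then 1 else -1)

/-- The end point `ε₁ e_{i₁} + ⋯ + ε_m e_{i_m}` of the lattice path from the origin with the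
given successive steps. -/
def endpoint (l : List (Fin 5 × Bool)) : Fin 5 → ℤ := (l.map step).sum

/-- The product of contiguous matrices
`A_{i_m}^{ε_m}(a + p_{m-1}) ⋯ A_{i_2}^{ε_2}(a + p_1) A_{i_1}^{ε_1}(a)`
along the lattice path with the given successive steps `ε_k e_{i_k} = p_k - p_{k-1}`. -/
def pathMatrix (a : Fin 5 → K) : List (Fin 5 × Bool) → Matrix (Fin 2) (Fin 2) K
  | [] => 1
  | d :: l => pathMatrix (a + intVec K (step d)) l * contigMatrix a d.1 d.2

/-- `(x, n) = Γ(x + n) / Γ(x)` for an integer `n`, as a rational function of `x`. -/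
def poch (x : K) : ℤ → K
  | Int.ofNat n => ∏ k ∈ Finset.range n, (x + k)
  | Int.negSucc m => (∏ k ∈ Finset.range (m + 1), (x - (k + 1)))⁻¹

/-- The closed form `δ(a; p)` of the determinant of the connection matrix. -/
def connDet (a : Fin 5 → K) (p : Fin 5 → ℤ) : K :=
  (-1) ^ (p 0 + p 1 + p 2) * poch (saal a - 1) (saal p) *
      (poch (a 0) (p 0) * poch (a 1) (p 1) * poch (a 2) (p 2)) /
    ((poch (a 3 - a 0) (p 3 - p 0) * poch (a 4 - a 0) (p 4 - p 0)) *
      (poch (a 3 - a 1) (p 3 - p 1) * poch (a 4 - a 1) (p 4 - p 1)) *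
      (poch (a 3 - a 2) (p 3 - p 2) * poch (a 4 - a 2) (p 4 - p 2)))

end Matrices

/-- The variables `a₀, …, a₄` as elements of `ℚ(a)`. -/
def vars : Fin 5 → RatFun ℚ := fun j =>
  algebraMap (MvPolynomial (Fin 5) ℚ) (RatFun ℚ) (MvPolynomial.X j)

/-- The pair `u`, `v` is produced by the recipe from the shift vectors `p`, `q`:

* any lattice path from the origin to `p` and any one to `q` give matrices `M`, `N` with top rows
  `(r₁(a;p), r(a;p))`, `(r₁(a;q), r(a;q))` such that `Δ = r₁(a;p) r(a;q) - r(a;p) r₁(a;q) ≠ 0`,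
  `u = r(a;q) / Δ` and `v = - r(a;p) / Δ`;
* alternatively, `Δ` is computed as `δ(a;p) r(a+p; q-p)`, with `r(a+p; q-p)` read off from the
  product along any lattice path from `p` to `q`. -/
def GivenByRecipe (p q : Fin 5 → ℤ) (u v : RatFun ℚ) : Prop :=
  ∀ lp lq : List (Fin 5 × Bool), endpoint lp = p → endpoint lq = q →
    (let M := pathMatrix vars lp
     let N := pathMatrix vars lq
     (M 0 0 * N 0 1 - M 0 1 * N 0 0 ≠ 0 ∧
      u = N 0 1 / (M 0 0 * N 0 1 - M 0 1 * N 0 0) ∧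
      v = -(M 0 1 / (M 0 0 * N 0 1 - M 0 1 * N 0 0))) ∧
     ∀ l : List (Fin 5 × Bool), endpoint l = q - p →
      let L := pathMatrix (vars + intVec (RatFun ℚ) p) l
      connDet vars p * L 0 1 ≠ 0 ∧
      u = N 0 1 / (connDet vars p * L 0 1) ∧
      v = -(M 0 1 / (connDet vars p * L 0 1)))

/-! ### The group of affine symmetries -/

theorem paramMap_add (ν : SingPt) (i : Fin 3) (x y : Fin 5 → ℂ) :
    paramMap ν i (x + y) = (paramMap ν i x - paramMap ν i 0) + paramMap ν i y := by
  cases ν <;> fin_cases i <;> ext j <;> fin_cases j <;> simp [paramMap] <;> ring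

theorem paramMap_smul (ν : SingPt) (i : Fin 3) (c : ℂ) (x : Fin 5 → ℂ) :
    paramMap ν i (c • x) - paramMap ν i 0 = c • (paramMap ν i x - paramMap ν i 0) := by
  cases ν <;> fin_cases i <;> ext j <;> fin_cases j <;> simp [paramMap] <;> ring

theorem paramMap_involutive (ν : SingPt) (i : Fin 3) :
    Function.Involutive (paramMap ν i : (Fin 5 → ℂ) → (Fin 5 → ℂ)) := by
  intro x
  cases ν <;> fin_cases i <;> ext j <;> fin_cases j <;> simp [paramMap] <;> ring

/-- The linear part `a ↦ σ(a) - σ(0)` of a parameter involution `σ`. -/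
def paramLin (ν : SingPt) (i : Fin 3) : (Fin 5 → ℂ) →ₗ[ℂ] (Fin 5 → ℂ) where
  toFun x := paramMap ν i x - paramMap ν i 0
  map_add' x y := by rw [paramMap_add]; abel
  map_smul' c x := paramMap_smul ν i c x

theorem paramLin_involutive (ν : SingPt) (i : Fin 3) :
    Function.Involutive (paramLin ν i) := by
  intro x
  change paramMap ν i (paramMap ν i x - paramMap ν i 0) - paramMap ν i 0 = x
  cases ν <;> fin_cases i <;> ext j <;> fin_cases j <;> simp [paramMap] <;> ring

/-- The parameter involutions as affine transformations of `ℂ⁵`. -/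
def paramAffine (ν : SingPt) (i : Fin 3) : (Fin 5 → ℂ) ≃ᵃ[ℂ] (Fin 5 → ℂ) where
  toEquiv := (paramMap_involutive ν i).toPerm
  linear := LinearEquiv.ofInvolutive (paramLin ν i) (paramLin_involutive ν i)
  map_vadd' a p := paramMap_add ν i p a

/-- The group `G` of affine transformations of `ℂ⁵` generated by the parameter involutions. -/
def symGroup : Subgroup ((Fin 5 → ℂ) ≃ᵃ[ℂ] (Fin 5 → ℂ)) :=
  Subgroup.closure {σ | ∃ ν i, σ = paramAffine ν i}

/-- The generators as elements of `G`. -/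
def gen (ν : SingPt) (i : Fin 3) : symGroup :=
  ⟨paramAffine ν i, Subgroup.subset_closure ⟨ν, i, rfl⟩⟩

/-- The group `S₂ ⋉ (S₃ × S₃)`, in which `S₂` permutes the two factors `S₃`. -/
abbrev S2S3S3 :=
  (Fin 2 → Equiv.Perm (Fin 3)) ⋊[mulAutArrow (G := Equiv.Perm (Fin 2)) (A := Fin 2)
    (M := Equiv.Perm (Fin 3))] Equiv.Perm (Fin 2)

/-- The symmetry `h(a) = χ^{s(p)} u(σ⁻¹ a) h(a + σ̄ p) + χ^{s(q)} v(σ⁻¹ a) h(a + σ̄ q)` of a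
three-term relation, where `σ̄` is the linear part of `σ` and `χ = ±1`. It includes that `σ̄ p`
and `σ̄ q` are integer vectors again. -/
def SymRelation (h : (Fin 5 → ℂ) → ℂ) (σ : (Fin 5 → ℂ) ≃ᵃ[ℂ] (Fin 5 → ℂ)) (χ : ℤˣ)
    (p q : Fin 5 → ℤ) (u v : RatFun ℚ) : Prop :=
  ∃ p' q' : Fin 5 → ℤ,
    σ.linear (intVec ℂ p) = intVec ℂ p' ∧ σ.linear (intVec ℂ q) = intVec ℂ q' ∧
    ∀ a ∈ domain 0 ∩ domain p' ∩ domain q',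
      RegularAt u (σ.symm a) → RegularAt v (σ.symm a) →
      h a = (((χ ^ saal p : ℤˣ) : ℤ) : ℂ) * evalAt u (σ.symm a) * h (a + intVec ℂ p') +
        (((χ ^ saal q : ℤˣ) : ℤ) : ℂ) * evalAt v (σ.symm a) * h (a + intVec ℂ q')

end ThreeTerm

end

open scoped BigOperators

noncomputable section

namespace ThreeTerm

open Filter Topology

/-! ### The regularized series -/

/-! Everything except linear independence follows from five relations. If `t k` is the general term
of `f(a)` and `1 = (1,1,1;1,1)`, then `f(a+1) = ∑ k t k`, `f(a+eᵢ) = ∑ (aᵢ+k) t k` for `i ≤ 2` and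
`f(a-eⱼ) = ∑ (aⱼ-1+k) t k` for `j = 3, 4`. Hence each of the five neighbours `a + nb i` satisfies
`h(a + nb i) = wt a i * h(a) + h(a+1)`, which is the property `Contig`. Computing `h(a+e₀+e₁+e₂)` in
two ways turns these relations into a second order recurrence in the direction `1`. Together they
yield the contiguous matrices, which act on the pair `(h(a), h(a+1))`. Eliminating `h(a+1)` between
the top rows for `p` and `q` gives the three-term relation, with coefficients that depend only on
`Contig`.

Symmetry: give the neighbour `a+1` the weight `0`. Then `Contig` says that differences of values at
neighbours are differences of weights times `h(a)`. The six weights are the entries of the triples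
`(a₀,a₁,a₂)`, `(1,a₃,a₄)`, the second one lowered by `1`. The group `S₂ ⋉ (S₃ × S₃)` permutes these
entries up to a common translation and, for the swap, a sign. Every neighbour lowers `s` by `1`, so
the factor `e^{iπ s}` supplies the compensating sign. Thus `Contig` passes from `f` to its twisted
transforms (`Contig.comp_act`), in particular to all six companion functions.

Independence (`indep_of_ne`) uses the values of `f` as well. Dividing by `Γ(a₀)Γ(a₁)Γ(a₂)` makes the
series continuous across `a₀ = 0`, where it collapses to `1/(Γ(a₃)Γ(a₄))`. For `p₀ ≥ 1` a relation
between `f(a)` and `f(a+p)` then has both coefficients divisible by `a₀`, and so by every power of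
`a₀`. The group reduces any other `p ≠ 0` to this case. Independence gives uniqueness, `Δ ≠ 0`, and
the path independence of the top rows.

Identities are first proved for generic `a` with `Re s` large (`farGeneric`). Holomorphy in `a₃`
extends them to all generic points where the series occurring converge (`relation_of_eventually`),
and continuity covers the points where a cleared denominator vanishes but the reduced coefficient is
regular (`IsCoeff.hgf_eq`). -/

/-- The general term of the regularized series. -/
def regTerm (a : Fin 5 → ℂ) (k : ℕ) : ℂ :=
  ((∏ j ∈ Finset.range k, (a 0 + j)) * (∏ j ∈ Finset.range k, (a 1 + j)) *
    (∏ j ∈ Finset.range k, (a 2 + j))) *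
    ((Complex.Gamma (1 + k))⁻¹ * (Complex.Gamma (a 3 + k))⁻¹ * (Complex.Gamma (a 4 + k))⁻¹)

/-- The regularized series `∑ₖ (a₀)ₖ (a₁)ₖ (a₂)ₖ / (k! Γ(a₃+k) Γ(a₄+k))`. -/
def regSum (a : Fin 5 → ℂ) : ℂ := ∑' k, regTerm a k

/-- The identity `1/Γ(x) = x/Γ(x+1)` holds at every `x`, poles of `Γ` included, so no condition on
`a` is needed. -/
theorem regTerm_succ (a : Fin 5 → ℂ) (k : ℕ) :
    (k + 1) * ((a 3 + k) * (a 4 + k)) * regTerm a (k + 1) =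
      (a 0 + k) * (a 1 + k) * (a 2 + k) * regTerm a k := by
  have h1 := Complex.one_div_Gamma_eq_self_mul_one_div_Gamma_add_one (1 + k)
  have h3 := Complex.one_div_Gamma_eq_self_mul_one_div_Gamma_add_one (a 3 + k)
  have h4 := Complex.one_div_Gamma_eq_self_mul_one_div_Gamma_add_one (a 4 + k)
  simp only [regTerm, Finset.prod_range_succ, Nat.cast_add, Nat.cast_one, h1, h3, h4, ← add_assoc]
  ring

/-! ### Locally uniform convergence for `Re s > 0` -/

theorem norm_sub_le_of_norm_le {n : ℝ} {w : ℂ} (hn : 0 < n) (hw : ‖w‖ ≤ n) :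
    ‖(n : ℂ) - w‖ ≤ n - w.re + ‖w‖ ^ 2 / (2 * n) := by
  have h1 : w.re ≤ ‖w‖ := Complex.re_le_norm w
  have h2 : 0 ≤ ‖w‖ ^ 2 / (2 * n) := by positivity
  refine abs_le_of_sq_le_sq' ?_ (by linarith) |>.2
  have h3 : ‖(n : ℂ) - w‖ ^ 2 = n ^ 2 - 2 * n * w.re + ‖w‖ ^ 2 := by
    rw [Complex.sq_norm, Complex.sq_norm, Complex.normSq_apply, Complex.normSq_apply]
    simp
    ring
  have h4 : 2 * n * (‖w‖ ^ 2 / (2 * n)) = ‖w‖ ^ 2 := by field_simp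
  nlinarith [sq_nonneg (-w.re + ‖w‖ ^ 2 / (2 * n))]

/-- Consecutive terms have ratio `1 - (1+s)/(k+1) + O(1/k²)`, with an error uniform for bounded `a`.
Of the available `2ε ≤ Re s`, one `ε` absorbs that error. -/
theorem ratio_bound {B ε : ℝ} (hB : 1 ≤ B) (hε : 0 < ε) :
    ∃ K : ℕ, 1 ≤ K ∧ ∀ k : ℕ, K ≤ k → ∀ a : Fin 5 → ℂ, (∀ i, ‖a i‖ ≤ B) → 2 * ε ≤ (saal a).re →
      ‖(a 0 + k) * (a 1 + k) * (a 2 + k)‖ ≤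
        (1 - (1 + ε) / (k + 1)) * ‖((k : ℂ) + 1) * ((a 3 + k) * (a 4 + k))‖ ∧
      0 < ‖((k : ℂ) + 1) * ((a 3 + k) * (a 4 + k))‖ := by
  set b := 2 * B with hb
  set C := 14 * b ^ 2 + 6 * b ^ 3 with hC
  -- Here `b` bounds `‖aᵢ - 1‖` and `C` bounds `‖E‖/n` below. The first bound gives `‖w‖ ≤ n` and
  -- `‖n + xᵢ‖ ≥ n/2`; the second makes the two error terms together at most `ε`.
  obtain ⟨K, hK⟩ := exists_nat_ge (max (10 * b) ((25 * b ^ 2 / 2 + 4 * C) / ε))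
  refine ⟨max K 1, le_max_right _ _, fun k hk a ha hs => ?_⟩
  have hk' : (K : ℝ) ≤ k := by exact_mod_cast (le_max_left _ _).trans hk
  obtain ⟨n, hn⟩ : ∃ n : ℝ, n = k + 1 := ⟨_, rfl⟩
  have hnb : 10 * b ≤ n := by linarith [le_max_left (10 * b) ((25 * b ^ 2 / 2 + 4 * C) / ε)]
  have hnC : (25 * b ^ 2 / 2 + 4 * C) / ε ≤ n := by
    linarith [le_max_right (10 * b) ((25 * b ^ 2 / 2 + 4 * C) / ε)]
  have hb2 : 2 ≤ b := by linarith
  have hn0 : 0 < n := by linarith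
  have hnk : (n : ℂ) = k + 1 := by rw [hn]; push_cast; rfl
  obtain ⟨x, hx⟩ : ∃ x : Fin 5 → ℂ, x = fun i => a i - 1 := ⟨_, rfl⟩
  have hxb : ∀ i, ‖x i‖ ≤ b := fun i => by
    have h1 := norm_sub_le (a i) 1
    have h2 := ha i
    rw [norm_one] at h1
    simp only [hx]
    linarith
  have hax : ∀ i, a i + k = n + x i := fun i => by rw [hnk, hx]; ring
  set w : ℂ := 1 + saal a with hw
  have hwx : w = x 3 + x 4 - x 0 - x 1 - x 2 := by rw [hw, hx, saal]; ring
  have hwb : ‖w‖ ≤ 5 * b := by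
    rw [hwx]
    linarith [norm_sub_le (x 3 + x 4 - x 0 - x 1) (x 2), norm_sub_le (x 3 + x 4 - x 0) (x 1),
      norm_sub_le (x 3 + x 4) (x 0), norm_add_le (x 3) (x 4), hxb 0, hxb 1, hxb 2, hxb 3, hxb 4]
  have hwre : 1 + 2 * ε ≤ w.re := by rw [hw]; simpa using hs
  set D : ℂ := (n + x 3) * (n + x 4) with hD
  set E : ℂ := n * (x 0 * x 1 + x 1 * x 2 + x 2 * x 0 - x 3 * x 4 + w * (x 3 + x 4)) +
    (x 0 * x 1 * x 2 + w * (x 3 * x 4)) with hE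
  -- Division of the cubic in `n` by the quadratic `D`, with remainder `E` of degree one in `n`.
  have hnum : (a 0 + k) * (a 1 + k) * (a 2 + k) = (n - w) * D + E := by
    rw [hax, hax, hax, hE, hD, hwx]; ring
  have hmul : ∀ i j, ‖x i * x j‖ ≤ b ^ 2 := fun i j => by
    rw [norm_mul, sq]
    exact mul_le_mul (hxb i) (hxb j) (norm_nonneg _) (by linarith)
  have hmul3 : ‖x 0 * x 1 * x 2‖ ≤ b ^ 3 := by
    rw [norm_mul, pow_succ]
    exact mul_le_mul (hmul 0 1) (hxb 2) (norm_nonneg _) (by positivity)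
  have hw1 : ‖w * (x 3 + x 4)‖ ≤ 10 * b ^ 2 := by
    rw [norm_mul]
    have : ‖x 3 + x 4‖ ≤ 2 * b := by linarith [norm_add_le (x 3) (x 4), hxb 3, hxb 4]
    calc _ ≤ (5 * b) * (2 * b) := mul_le_mul hwb this (norm_nonneg _) (by linarith)
      _ = _ := by ring
  have hw2 : ‖w * (x 3 * x 4)‖ ≤ 5 * b ^ 3 := by
    rw [norm_mul]
    calc _ ≤ (5 * b) * (b ^ 2) := mul_le_mul hwb (hmul 3 4) (norm_nonneg _) (by linarith)
      _ = _ := by ring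
  have hEb : ‖E‖ ≤ C * n := by
    have h1 : ‖x 0 * x 1 + x 1 * x 2 + x 2 * x 0 - x 3 * x 4 + w * (x 3 + x 4)‖ ≤ 14 * b ^ 2 := by
      linarith [norm_add_le (x 0 * x 1 + x 1 * x 2 + x 2 * x 0 - x 3 * x 4) (w * (x 3 + x 4)),
        norm_sub_le (x 0 * x 1 + x 1 * x 2 + x 2 * x 0) (x 3 * x 4),
        norm_add_le (x 0 * x 1 + x 1 * x 2) (x 2 * x 0), norm_add_le (x 0 * x 1) (x 1 * x 2),
        hmul 0 1, hmul 1 2, hmul 2 0, hmul 3 4]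
    have h2 : ‖x 0 * x 1 * x 2 + w * (x 3 * x 4)‖ ≤ 6 * b ^ 3 := by
      linarith [norm_add_le (x 0 * x 1 * x 2) (w * (x 3 * x 4))]
    have h3 : ‖E‖ ≤ n * (14 * b ^ 2) + 6 * b ^ 3 := by
      refine (norm_add_le _ _).trans (add_le_add ?_ h2)
      rw [norm_mul, Complex.norm_real, Real.norm_of_nonneg hn0.le]
      exact mul_le_mul_of_nonneg_left h1 hn0.le
    have h4 : 6 * b ^ 3 ≤ 6 * b ^ 3 * n := by
      have : 0 ≤ 6 * b ^ 3 := by positivity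
      nlinarith
    rw [hC]
    nlinarith
  have hlow : ∀ i, n / 2 ≤ ‖(n : ℂ) + x i‖ := fun i => by
    have h1 := norm_sub_norm_le (n : ℂ) (-x i)
    rw [sub_neg_eq_add, norm_neg, Complex.norm_real, Real.norm_of_nonneg hn0.le] at h1
    linarith [hxb i]
  have hDlow : n ^ 2 / 4 ≤ ‖D‖ := by
    rw [hD, norm_mul]
    calc n ^ 2 / 4 = (n / 2) * (n / 2) := by ring
      _ ≤ _ := mul_le_mul (hlow 3) (hlow 4) (by positivity) (norm_nonneg _)
  have hDpos : 0 < ‖D‖ := lt_of_lt_of_le (by positivity) hDlow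
  have hCpos : 0 ≤ C := by positivity
  have hEb' : ‖E‖ ≤ (4 * C / n) * ‖D‖ := by
    refine hEb.trans ?_
    calc C * n = (4 * C / n) * (n ^ 2 / 4) := by field_simp
      _ ≤ _ := mul_le_mul_of_nonneg_left hDlow (by positivity)
  have hnw := norm_sub_le_of_norm_le hn0 (hwb.trans (by linarith))
  have hw2n : ‖w‖ ^ 2 / (2 * n) ≤ (25 * b ^ 2 / 2) / n := by
    rw [div_le_div_iff₀ (by positivity) hn0]
    have : ‖w‖ ^ 2 ≤ (5 * b) ^ 2 := pow_le_pow_left₀ (norm_nonneg _) hwb 2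
    nlinarith
  have hε' : (25 * b ^ 2 / 2 + 4 * C) / n ≤ ε := by
    rw [div_le_iff₀ hε] at hnC
    rw [div_le_iff₀ hn0]
    linarith
  rw [hnum, ← hnk, hax, hax, ← hD, norm_mul (n : ℂ), Complex.norm_real, Real.norm_of_nonneg hn0.le,
    ← hn]
  refine ⟨?_, by positivity⟩
  have h5 : (1 - (1 + ε) / n) * (n * ‖D‖) = (n - (1 + ε)) * ‖D‖ := by field_simp
  rw [h5]
  refine (norm_add_le _ _).trans ?_
  rw [norm_mul]
  calc ‖(n : ℂ) - w‖ * ‖D‖ + ‖E‖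
      ≤ (n - w.re + (25 * b ^ 2 / 2) / n) * ‖D‖ + (4 * C / n) * ‖D‖ := by
        refine add_le_add (mul_le_mul_of_nonneg_right (by linarith) hDpos.le) hEb'
    _ = (n - w.re + (25 * b ^ 2 / 2 + 4 * C) / n) * ‖D‖ := by ring
    _ ≤ _ := mul_le_mul_of_nonneg_right (by linarith) hDpos.le

/-- By the ratio bound, `‖regTerm a k‖ * k ^ (1+ε)` is nonincreasing from `K` on, since `1 -
(1+ε)/(k+1) ≤ (k/(k+1))^(1+ε)`. -/
theorem regTerm_decay {B ε : ℝ} (hB : 1 ≤ B) (hε : 0 < ε) :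
    ∃ K : ℕ, 1 ≤ K ∧ ∀ a : Fin 5 → ℂ, (∀ i, ‖a i‖ ≤ B) → 2 * ε ≤ (saal a).re →
      ∀ k : ℕ, K ≤ k → ‖regTerm a k‖ * (k : ℝ) ^ (1 + ε) ≤ ‖regTerm a K‖ * (K : ℝ) ^ (1 + ε) := by
  obtain ⟨K, hK1, hK⟩ := ratio_bound hB hε
  refine ⟨K, hK1, fun a ha hs k hk => ?_⟩
  induction k, hk using Nat.le_induction with
  | base => rfl
  | succ k hk ih =>
    refine le_trans ?_ ih
    obtain ⟨h1, h2⟩ := hK k hk a ha hs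
    have h3 := congrArg norm (regTerm_succ a k)
    rw [norm_mul, norm_mul _ (regTerm a k)] at h3
    set d := ‖((k : ℂ) + 1) * ((a 3 + k) * (a 4 + k))‖
    have hk0 : (0 : ℝ) < k := by exact_mod_cast hK1.trans hk
    have h4 : ‖regTerm a (k + 1)‖ ≤ (1 - (1 + ε) / (k + 1)) * ‖regTerm a k‖ := by
      have : d * ‖regTerm a (k + 1)‖ ≤ d * ((1 - (1 + ε) / (k + 1)) * ‖regTerm a k‖) := by
        rw [h3]
        calc _ ≤ ((1 - (1 + ε) / (k + 1)) * d) * ‖regTerm a k‖ :=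
              mul_le_mul_of_nonneg_right h1 (norm_nonneg _)
          _ = _ := by ring
      exact le_of_mul_le_mul_left this h2
    have h5 : 1 - (1 + ε) / (k + 1) ≤ ((k : ℝ) / (k + 1)) ^ (1 + ε) := by
      -- Bernoulli's inequality with exponent `1 + ε`.
      have h := one_add_mul_self_le_rpow_one_add (s := -(1 / ((k : ℝ) + 1)))
        (by rw [neg_le_neg_iff, div_le_one (by positivity)]; linarith)
        (p := 1 + ε) (by linarith)
      convert h using 1
      · ring
      · congr 1
        field_simp
        ring
    have h6 : ((k : ℝ) / (k + 1)) ^ (1 + ε) * ((k : ℝ) + 1) ^ (1 + ε) = (k : ℝ) ^ (1 + ε) := by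
      rw [← Real.mul_rpow (by positivity) (by positivity), div_mul_cancel₀ _ (by positivity)]
    push_cast
    calc _ ≤ ((1 - (1 + ε) / (k + 1)) * ‖regTerm a k‖) * ((k : ℝ) + 1) ^ (1 + ε) :=
          mul_le_mul_of_nonneg_right h4 (by positivity)
      _ ≤ (((k : ℝ) / (k + 1)) ^ (1 + ε) * ‖regTerm a k‖) * ((k : ℝ) + 1) ^ (1 + ε) := by gcongr
      _ = _ := by rw [← h6]; ring

theorem continuous_regTerm (k : ℕ) : Continuous fun a : Fin 5 → ℂ => regTerm a k := by
  have h : Continuous fun x : ℂ => (Complex.Gamma x)⁻¹ :=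
    Complex.differentiable_one_div_Gamma.continuous
  unfold regTerm
  refine Continuous.mul (by fun_prop) ?_
  refine Continuous.mul (continuous_const.mul ?_) ?_
  · exact h.comp (by fun_prop)
  · exact h.comp (by fun_prop)

/-- Weierstrass majorant: the terms below `K` are bounded by compactness, the later ones by the
decay estimate together with the bound for the term `K`. -/
theorem exists_summable_bound (B : ℝ) {ε : ℝ} (hε : 0 < ε) :
    ∃ u : ℕ → ℝ, Summable u ∧ ∀ (k : ℕ) (a : Fin 5 → ℂ), ‖a‖ ≤ B → ε ≤ (saal a).re →
      ‖regTerm a k‖ ≤ u k := by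
  obtain ⟨K, hK1, hK⟩ := regTerm_decay (le_max_right B 1) (half_pos hε)
  have hc : ∀ k, ∃ C, ∀ a ∈ Metric.closedBall (0 : Fin 5 → ℂ) B, ‖regTerm a k‖ ≤ C := fun k =>
    (isCompact_closedBall 0 B).exists_bound_of_continuousOn (continuous_regTerm k).continuousOn
  choose C hC using hc
  refine ⟨fun k => if k < K then C k else C K * (K : ℝ) ^ (1 + ε / 2) * (1 / (k : ℝ) ^ (1 + ε / 2)),
    ?_, fun k a ha hs => ?_⟩
  · have h := ((Real.summable_one_div_nat_rpow (p := 1 + ε / 2)).2 (by linarith)).mul_left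
      (C K * (K : ℝ) ^ (1 + ε / 2))
    refine (summable_congr_cofinite ?_).2 h
    rw [Nat.cofinite_eq_atTop]
    filter_upwards [eventually_ge_atTop K] with k hk
    rw [if_neg (by omega)]
  · have ha' : a ∈ Metric.closedBall (0 : Fin 5 → ℂ) B := by simpa using ha
    dsimp only
    split_ifs with hk
    · exact hC k a ha'
    · push Not at hk
      have hk0 : (0 : ℝ) < k := by exact_mod_cast hK1.trans hk
      have h := hK a (fun i => (norm_le_pi_norm a i).trans (ha.trans (le_max_left _ _)))
        (by linarith) k hk
      rw [mul_one_div, le_div_iff₀ (by positivity)]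
      exact h.trans (mul_le_mul_of_nonneg_right (hC K a ha') (by positivity))

theorem summable_norm_regTerm {a : Fin 5 → ℂ} (ha : 0 < (saal a).re) :
    Summable fun k => ‖regTerm a k‖ := by
  obtain ⟨u, hu, h⟩ := exists_summable_bound ‖a‖ ha
  exact hu.of_nonneg_of_le (fun _ => norm_nonneg _) fun k => h k a le_rfl le_rfl

theorem summable_regTerm {a : Fin 5 → ℂ} (ha : 0 < (saal a).re) : Summable (regTerm a) :=
  (summable_norm_regTerm ha).of_norm

theorem continuous_saal_re : Continuous fun a : Fin 5 → ℂ => (saal a).re := by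
  unfold saal
  fun_prop

theorem isOpen_ball_inter (B ε : ℝ) : IsOpen {a : Fin 5 → ℂ | ‖a‖ < B ∧ ε < (saal a).re} :=
  (isOpen_lt continuous_norm continuous_const).inter (isOpen_lt continuous_const continuous_saal_re)

theorem continuousAt_regSum {a : Fin 5 → ℂ} (ha : 0 < (saal a).re) : ContinuousAt regSum a := by
  obtain ⟨u, hu, h⟩ := exists_summable_bound (‖a‖ + 1) (half_pos ha)
  have hc : ContinuousOn regSum {x | ‖x‖ < ‖a‖ + 1 ∧ (saal a).re / 2 < (saal x).re} :=
    continuousOn_tsum (fun k => (continuous_regTerm k).continuousOn) hu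
      fun k x hx => h k x hx.1.le hx.2.le
  exact hc.continuousAt ((isOpen_ball_inter _ _).mem_nhds ⟨by linarith, by linarith⟩)

/-! ### Holomorphy in the parameter `a₃` -/

/-- The shift of the parameter `a₃` by a complex number. -/
def shiftThree (a : Fin 5 → ℂ) (t : ℂ) : Fin 5 → ℂ := fun j => a j + if j = 3 then t else 0

theorem saal_shiftThree (a : Fin 5 → ℂ) (t : ℂ) : saal (shiftThree a t) = saal a + t := by
  simp [saal, shiftThree]
  ring

theorem continuous_shiftThree (a : Fin 5 → ℂ) : Continuous (shiftThree a) := by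
  refine continuous_pi fun j => ?_
  unfold shiftThree
  by_cases hj : j = 3 <;> simp only [hj, if_true, if_false] <;> fun_prop

theorem differentiable_regTerm_shiftThree (a : Fin 5 → ℂ) (k : ℕ) :
    Differentiable ℂ fun t => regTerm (shiftThree a t) k := by
  have h : Differentiable ℂ fun t => (Complex.Gamma (a 3 + t + k))⁻¹ :=
    Complex.differentiable_one_div_Gamma.comp (g := fun x : ℂ => (Complex.Gamma x)⁻¹)
      (f := fun t => a 3 + t + k) (by fun_prop)
  have he : (fun t => regTerm (shiftThree a t) k) = fun t =>
      ((∏ j ∈ Finset.range k, (a 0 + j)) * (∏ j ∈ Finset.range k, (a 1 + j)) *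
      (∏ j ∈ Finset.range k, (a 2 + j))) *
      ((Complex.Gamma (1 + k))⁻¹ * (Complex.Gamma (a 3 + t + k))⁻¹ *
        (Complex.Gamma (a 4 + k))⁻¹) := by
    funext t
    simp [regTerm, shiftThree]
  rw [he]
  exact ((h.const_mul _).mul_const _).const_mul _

theorem differentiableOn_regSum_shiftThree (a : Fin 5 → ℂ) :
    DifferentiableOn ℂ (fun t => regSum (shiftThree a t)) {t | 0 < (saal a).re + t.re} := by
  intro t ht
  simp only [Set.mem_ofPred_eq] at ht
  obtain ⟨u, hu, h⟩ := exists_summable_bound (‖shiftThree a t‖ + 1) (half_pos ht)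
  set U := {x : ℂ | ‖shiftThree a x‖ < ‖shiftThree a t‖ + 1 ∧
    ((saal a).re + t.re) / 2 < (saal (shiftThree a x)).re} with hU
  have hUo : IsOpen U := (isOpen_ball_inter _ _).preimage (continuous_shiftThree a)
  have hd : DifferentiableOn ℂ (fun t => regSum (shiftThree a t)) U :=
    Complex.differentiableOn_tsum_of_summable_norm hu
      (fun k => (differentiable_regTerm_shiftThree a k).differentiableOn) hUo
      fun k x hx => h k _ hx.1.le hx.2.le
  refine (hd.differentiableAt (hUo.mem_nhds ⟨by linarith, ?_⟩)).differentiableWithinAt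
  rw [saal_shiftThree, Complex.add_re]
  linarith

/-! ### Comparison of `hgf` with the regularized series -/

theorem Gamma_add_natCast (x : ℂ) (hx : ∀ n : ℤ, x ≠ n) (k : ℕ) :
    Complex.Gamma (x + k) = (∏ j ∈ Finset.range k, (x + j)) * Complex.Gamma x := by
  induction k with
  | zero => simp
  | succ k ih =>
    have h : x + k ≠ 0 := fun h => hx (-k) (by push_cast; linear_combination h)
    rw [Finset.prod_range_succ, Nat.cast_succ, ← add_assoc, Complex.Gamma_add_one _ h, ih]
    ring

theorem hgf_term_eq {a : Fin 5 → ℂ} (h0 : ∀ n : ℤ, a 0 ≠ n) (h1 : ∀ n : ℤ, a 1 ≠ n)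
    (h2 : ∀ n : ℤ, a 2 ≠ n) (k : ℕ) :
    Complex.Gamma (a 0 + k) * Complex.Gamma (a 1 + k) * Complex.Gamma (a 2 + k) /
    (Complex.Gamma (1 + k) * Complex.Gamma (a 3 + k) * Complex.Gamma (a 4 + k)) * 1 ^ k =
      Complex.Gamma (a 0) * Complex.Gamma (a 1) * Complex.Gamma (a 2) * regTerm a k := by
  rw [Gamma_add_natCast _ h0, Gamma_add_natCast _ h1, Gamma_add_natCast _ h2, regTerm,
    div_eq_mul_inv, mul_inv, mul_inv, one_pow]
  ring

theorem hgf_one_eq {a : Fin 5 → ℂ} (h0 : ∀ n : ℤ, a 0 ≠ n) (h1 : ∀ n : ℤ, a 1 ≠ n)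
    (h2 : ∀ n : ℤ, a 2 ≠ n) :
    hgf a 1 = Complex.Gamma (a 0) * Complex.Gamma (a 1) * Complex.Gamma (a 2) * regSum a := by
  rw [hgf, regSum, ← tsum_mul_left]
  exact tsum_congr (hgf_term_eq h0 h1 h2)

theorem continuousAt_hgf_one {a : Fin 5 → ℂ} (ha : Generic a) (hs : 0 < (saal a).re) :
    ContinuousAt (fun x => hgf x 1) a := by
  have hne : ∀ i : Fin 5, ∀ᶠ x : Fin 5 → ℂ in 𝓝 a, ∀ n : ℤ, x i ≠ n := fun i => by
    have ho : IsOpen (Set.range ((↑) : ℤ → ℂ))ᶜ :=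
      Complex.isClosedEmbedding_intCast.isClosed_range.isOpen_compl
    have : ∀ᶠ x : Fin 5 → ℂ in 𝓝 a, x i ∈ (Set.range ((↑) : ℤ → ℂ))ᶜ :=
      (continuous_apply i).continuousAt (ho.mem_nhds (by rintro ⟨n, hn⟩; exact ha.1 i n hn.symm))
    filter_upwards [this] with x hx n hn
    exact hx ⟨n, hn.symm⟩
  have hG : ∀ i : Fin 5, ContinuousAt (fun x : Fin 5 → ℂ => Complex.Gamma (x i)) a := fun i =>
    ContinuousAt.comp (g := Complex.Gamma) (f := fun x : Fin 5 → ℂ => x i)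
      (Complex.differentiableAt_Gamma _ fun m h => ha.1 i (-m) (by push_cast; exact h)).continuousAt
      (continuous_apply i).continuousAt
  have hc := (((hG 0).mul (hG 1)).mul (hG 2)).mul (continuousAt_regSum hs)
  refine hc.congr ?_
  filter_upwards [hne 0, hne 1, hne 2] with x h0 h1 h2
  exact (hgf_one_eq h0 h1 h2).symm

/-! ### Generic points and density -/

theorem dense_eval_ne_zero {P : MvPolynomial (Fin 5) ℂ} (hP : P ≠ 0) :
    Dense {a : Fin 5 → ℂ | MvPolynomial.eval a P ≠ 0} := by
  rw [dense_iff_inter_open]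
  intro U hU hne
  obtain ⟨a, ha⟩ := hne
  by_contra hcon
  obtain ⟨ε, hε, hball⟩ := Metric.isOpen_iff.1 hU a ha
  refine hP (MvPolynomial.funext_set (fun i => Metric.ball (a i) ε) (fun i => ?_) fun x hx => ?_)
  · exact infinite_of_mem_nhds (a i) (Metric.ball_mem_nhds _ hε)
  · rw [map_zero]
    by_contra h
    refine hcon ⟨x, hball ?_, h⟩
    rw [ball_pi _ hε]
    exact hx

theorem isOpen_eval_ne_zero (P : MvPolynomial (Fin 5) ℂ) :
    IsOpen {a : Fin 5 → ℂ | MvPolynomial.eval a P ≠ 0} :=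
  isOpen_ne.preimage (MvPolynomial.continuous_eval P)

/-- Baire's theorem: genericness excludes countably many hyperplanes and `P ≠ 0` one more
hypersurface, each with open dense complement. -/
theorem dense_generic {P : MvPolynomial (Fin 5) ℂ} (hP : P ≠ 0) :
    Dense {a : Fin 5 → ℂ | Generic a ∧ MvPolynomial.eval a P ≠ 0} := by
  let S : Option ((Fin 5 × ℤ) ⊕ ({x : Fin 5 × Fin 5 // x.1 ≠ x.2} × ℤ)) →
      MvPolynomial (Fin 5) ℂ
    | none => P
    | some (.inl x) => MvPolynomial.X x.1 - MvPolynomial.C (x.2 : ℂ)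
    | some (.inr x) => MvPolynomial.X x.1.1.1 - MvPolynomial.X x.1.1.2 - MvPolynomial.C (x.2 : ℂ)
  have hS : ∀ o, S o ≠ 0 := by
    rintro (_ | x | x)
    · exact hP
    · intro h
      have := congrArg (MvPolynomial.eval fun _ => (x.2 : ℂ) + 1) h
      simp [S] at this
    · intro h
      have := congrArg (MvPolynomial.eval fun i => if i = x.1.1.1 then (x.2 : ℂ) + 1 else 0) h
      simp [S, x.1.2.symm] at this
  have hd := dense_iInter_of_isOpen (fun o => isOpen_eval_ne_zero (S o))
    fun o => dense_eval_ne_zero (hS o)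
  refine hd.mono fun a ha => ?_
  rw [Set.mem_iInter] at ha
  refine ⟨⟨fun i n h => ?_, fun i j hij n h => ?_⟩, ha none⟩
  · exact ha (some (.inl (i, n))) (by simp [S, h])
  · exact ha (some (.inr (⟨(i, j), hij⟩, n))) (by simp [S, h])

theorem eq_zero_of_generic_eq_zero {P : MvPolynomial (Fin 5) ℂ} {U : Set (Fin 5 → ℂ)}
    (hU : IsOpen U) (hne : U.Nonempty)
    (h : ∀ a ∈ U, Generic a → MvPolynomial.eval a P = 0) : P = 0 := by
  by_contra hP
  obtain ⟨a, haU, ha⟩ := dense_iff_inter_open.1 (dense_generic hP) U hU hne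
  exact ha.2 (h a haU ha.1)

/-- A function which is continuous at `a` and vanishes at the nearby generic points outside a
hypersurface vanishes at `a`. -/
theorem eq_zero_of_continuousAt {g : (Fin 5 → ℂ) → ℂ} {a : Fin 5 → ℂ} (hg : ContinuousAt g a)
    {P : MvPolynomial (Fin 5) ℂ} (hP : P ≠ 0)
    (h : ∀ᶠ x in 𝓝 a, Generic x → MvPolynomial.eval x P ≠ 0 → g x = 0) : g a = 0 := by
  by_contra hne
  have h1 : ∀ᶠ x in 𝓝 a, g x ≠ 0 := hg.eventually_ne hne
  obtain ⟨x, hx, hx1, hx2⟩ := ((mem_closure_iff_frequently.1 (dense_generic hP a)).and_eventually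
    (h.and h1)).exists
  exact hx2 (hx1 hx.1 hx.2)

theorem saal_intVec (p : Fin 5 → ℤ) : saal (intVec ℂ p) = (saal p : ℤ) := by
  simp [saal, intVec]

theorem saal_add (a b : Fin 5 → ℂ) : saal (a + b) = saal a + saal b := by
  simp [saal]
  ring

theorem Generic.add_intVec {a : Fin 5 → ℂ} (ha : Generic a) (p : Fin 5 → ℤ) :
    Generic (a + intVec ℂ p) := by
  refine ⟨fun i n h => ha.1 i (n - p i) ?_, fun i j hij n h => ha.2 i j hij (n - p i + p j) ?_⟩
  · simp only [Pi.add_apply, intVec] at h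
    push_cast
    linear_combination h
  · simp only [Pi.add_apply, intVec] at h
    push_cast
    linear_combination h

theorem intVec_add (p q : Fin 5 → ℤ) : intVec ℂ (p + q) = intVec ℂ p + intVec ℂ q := by
  ext j; simp [intVec]

theorem intVec_one : intVec ℂ (1 : Fin 5 → ℤ) = 1 := by
  ext j; simp [intVec]

theorem Generic.add_one {a : Fin 5 → ℂ} (ha : Generic a) : Generic (a + 1) := by
  rw [← intVec_one]
  exact ha.add_intVec 1

theorem intVec_injective : Function.Injective (intVec ℂ) := fun p q h => by
  ext j
  have := congrFun h j
  simpa [intVec] using this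

/-- Generic points with real part of `s` tending to infinity. -/
def farGeneric : Filter (Fin 5 → ℂ) := comap (fun a => (saal a).re) atTop ⊓ 𝓟 {a | Generic a}

theorem eventually_farGeneric {P : (Fin 5 → ℂ) → Prop} :
    (∀ᶠ a in farGeneric, P a) ↔ ∃ M : ℝ, ∀ a, Generic a → M < (saal a).re → P a := by
  rw [farGeneric, eventually_inf_principal, (atTop_basis_Ioi.comap _).eventually_iff]
  constructor
  · rintro ⟨M, -, h⟩
    exact ⟨M, fun a ha hs => h hs ha⟩
  · rintro ⟨M, h⟩
    exact ⟨M, trivial, fun a hs ha => h a ha hs⟩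

theorem eventually_generic : ∀ᶠ a in farGeneric, Generic a :=
  eventually_farGeneric.2 ⟨0, fun _ ha _ => ha⟩

theorem eventually_lt_saal (M : ℝ) : ∀ᶠ a in farGeneric, M < (saal a).re :=
  eventually_farGeneric.2 ⟨M, fun _ _ h => h⟩

/-- Integer shifts and the symmetry group both have this form, so relations that hold far away can
be transported along them without tracking half-spaces. -/
theorem tendsto_farGeneric_of {g : (Fin 5 → ℂ) → (Fin 5 → ℂ)} (c : ℝ)
    (hg : ∀ a, Generic a → Generic (g a)) (hs : ∀ a, (saal (g a)).re = (saal a).re + c) :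
    Tendsto g farGeneric farGeneric := by
  intro S hS
  obtain ⟨M, hM⟩ := eventually_farGeneric.1 (show ∀ᶠ a in farGeneric, a ∈ S from hS)
  refine eventually_farGeneric.2 ⟨M - c, fun a ha h => hM _ (hg a ha) ?_⟩
  rw [hs]
  linarith

theorem tendsto_add_intVec (p : Fin 5 → ℤ) :
    Tendsto (fun a => a + intVec ℂ p) farGeneric farGeneric :=
  tendsto_farGeneric_of (saal p : ℤ) (fun _ ha => ha.add_intVec p) fun a => by
    rw [saal_add, saal_intVec]
    simp

theorem isOpen_lt_saal (M : ℝ) : IsOpen {a : Fin 5 → ℂ | M < (saal a).re} :=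
  isOpen_lt continuous_const continuous_saal_re

/-! ### Substitutions -/

/-- Composition of polynomial functions with a polynomial map. -/
theorem eval_bind₁ (Q : Fin 5 → MvPolynomial (Fin 5) ℂ) (P : MvPolynomial (Fin 5) ℂ)
    (a : Fin 5 → ℂ) : MvPolynomial.eval a (MvPolynomial.bind₁ Q P) =
      MvPolynomial.eval (fun j => MvPolynomial.eval a (Q j)) P := by
  simp only [MvPolynomial.eval, MvPolynomial.eval₂Hom_bind₁]

theorem exists_comp_affineEquiv (σ : (Fin 5 → ℂ) ≃ᵃ[ℂ] (Fin 5 → ℂ))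
    (P : MvPolynomial (Fin 5) ℂ) : ∃ P' : MvPolynomial (Fin 5) ℂ,
      (∀ a, MvPolynomial.eval a P' = MvPolynomial.eval (σ a) P) ∧ (P' = 0 → P = 0) := by
  refine ⟨MvPolynomial.bind₁ (fun j => MvPolynomial.C (σ 0 j) +
    ∑ i, MvPolynomial.C (σ.linear (Pi.single i 1) j) * MvPolynomial.X i) P, ?_⟩
  have key : ∀ a, MvPolynomial.eval a (MvPolynomial.bind₁ (fun j => MvPolynomial.C (σ 0 j) +
      ∑ i, MvPolynomial.C (σ.linear (Pi.single i 1) j) * MvPolynomial.X i) P) =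
      MvPolynomial.eval (σ a) P := fun a => by
    rw [eval_bind₁]
    congr 2
    funext j
    have h1 : σ a = σ.linear a + σ 0 := by
      have := σ.map_vadd 0 a
      simpa using this
    have h2 : σ.linear a = ∑ i, a i • σ.linear (Pi.single i 1) := by
      conv_lhs => rw [pi_eq_sum_univ' a]
      simp only [map_sum, map_smul]
    rw [h1, h2]
    simp [add_comm, mul_comm]
  refine ⟨key, fun h => ?_⟩
  apply MvPolynomial.funext
  intro x
  have := key (σ.symm x)
  rw [h, AffineEquiv.apply_symm_apply] at this
  simpa using this.symm

theorem exists_comp_add (p : Fin 5 → ℤ) (P : MvPolynomial (Fin 5) ℂ) :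
    ∃ P' : MvPolynomial (Fin 5) ℂ,
      (∀ a, MvPolynomial.eval a P' = MvPolynomial.eval (a + intVec ℂ p) P) ∧ (P' = 0 → P = 0) := by
  obtain ⟨P', h, h0⟩ := exists_comp_affineEquiv (AffineEquiv.constVAdd ℂ (Fin 5 → ℂ) (intVec ℂ p)) P
  refine ⟨P', fun a => ?_, h0⟩
  rw [h]
  simp [add_comm]

/-- Setting the variable `X 0` to `0` does not change classes modulo `X 0`, and it kills `P`. -/
theorem X_dvd_of_eval_eq_zero {P : MvPolynomial (Fin 5) ℂ}
    (h : ∀ a, a 0 = 0 → MvPolynomial.eval a P = 0) : MvPolynomial.X 0 ∣ P := by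
  let Q : Fin 5 → MvPolynomial (Fin 5) ℂ := fun j => if j = 0 then 0 else MvPolynomial.X j
  have h0 : MvPolynomial.bind₁ Q P = 0 := by
    apply MvPolynomial.funext
    intro x
    rw [eval_bind₁, map_zero]
    exact h _ (by simp [Q])
  let I : Ideal (MvPolynomial (Fin 5) ℂ) := Ideal.span {MvPolynomial.X 0}
  have hI : (Ideal.Quotient.mkₐ ℂ I).comp (MvPolynomial.bind₁ Q) = Ideal.Quotient.mkₐ ℂ I := by
    apply MvPolynomial.algHom_ext
    intro j
    by_cases hj : j = 0
    · subst hj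
      have : (Ideal.Quotient.mk I) (MvPolynomial.X 0) = 0 :=
        Ideal.Quotient.eq_zero_iff_mem.2 (Ideal.mem_span_singleton_self _)
      simp [Q, this]
    · simp [Q, hj]
  have h1 := DFunLike.congr_fun hI P
  rw [AlgHom.comp_apply, h0, map_zero] at h1
  exact Ideal.mem_span_singleton.1 (Ideal.Quotient.eq_zero_iff_mem.1 h1.symm)

/-! ### Contiguity relations -/

/-- The general term of the series `hgf a 1`. -/
def hgfTerm (a : Fin 5 → ℂ) (k : ℕ) : ℂ :=
  Complex.Gamma (a 0 + k) * Complex.Gamma (a 1 + k) * Complex.Gamma (a 2 + k) /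
    (Complex.Gamma (1 + k) * Complex.Gamma (a 3 + k) * Complex.Gamma (a 4 + k))

theorem hasSum_hgfTerm {a : Fin 5 → ℂ} (ha : Generic a) (hs : 0 < (saal a).re) :
    HasSum (hgfTerm a) (hgf a 1) := by
  have h1 : hgfTerm a = fun k => Complex.Gamma (a 0) * Complex.Gamma (a 1) *
      Complex.Gamma (a 2) * regTerm a k := by
    funext k
    rw [← hgf_term_eq (ha.1 0) (ha.1 1) (ha.1 2), one_pow, mul_one, hgfTerm]
  rw [hgf_one_eq (ha.1 0) (ha.1 1) (ha.1 2), h1]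
  exact (summable_regTerm hs).hasSum.mul_left _

/-- All Gamma factors but `Γ(1+k)` merely shift their index; that one leaves the factor `k + 1`.
Hence `f(a+1)` is the sum of `k` times the terms of `f(a)`. -/
theorem hgfTerm_add_one (a : Fin 5 → ℂ) (k : ℕ) :
    hgfTerm (a + 1) k = ((k + 1 : ℕ) : ℂ) * hgfTerm a (k + 1) := by
  have h : Complex.Gamma (1 + (k + 1 : ℕ)) = (k + 1 : ℕ) * Complex.Gamma (1 + k) := by
    have h0 : (1 : ℂ) + k ≠ 0 := by exact_mod_cast (by omega : 1 + k ≠ 0)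
    have := Complex.Gamma_add_one _ h0
    push_cast
    rw [add_comm (k : ℂ) 1, add_comm (1 : ℂ), this]
  have hk : ((k + 1 : ℕ) : ℂ) ≠ 0 := Nat.cast_ne_zero.2 (by omega)
  simp only [hgfTerm, h, Pi.add_apply, Pi.one_apply]
  rw [mul_assoc ((k + 1 : ℕ) : ℂ), mul_assoc ((k + 1 : ℕ) : ℂ), ← mul_div_assoc,
    mul_div_mul_left _ _ hk]
  push_cast
  simp only [add_assoc, add_comm (1 : ℂ)]

theorem hasSum_natCast_mul_hgfTerm {a : Fin 5 → ℂ} (ha : Generic a) (hs : 1 < (saal a).re) :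
    HasSum (fun k : ℕ => (k : ℂ) * hgfTerm a k) (hgf (a + 1) 1) := by
  have hs' : 0 < (saal (a + 1)).re := by
    rw [← intVec_one, saal_add, saal_intVec]
    have : saal (1 : Fin 5 → ℤ) = -1 := by decide
    rw [this]
    simp
    linarith
  have h := hasSum_hgfTerm ha.add_one hs'
  simp only [funext (hgfTerm_add_one a)] at h
  have := (hasSum_nat_add_iff (f := fun k : ℕ => (k : ℂ) * hgfTerm a k) 1).1 h
  simpa using this

/-- The six neighbours of a parameter vector are `a + 1` and `a + nb i`. -/
def nb (i : Fin 5) : Fin 5 → ℤ := step (i, decide (i.val < 3))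

/-- The weight of the neighbour `a + nb i`. -/
def wt {R : Type*} [CommRing R] (a : Fin 5 → R) (i : Fin 5) : R :=
  if i.val < 3 then a i else a i - 1

/-- A function satisfies the contiguity relations (far away). -/
def Contig (h : (Fin 5 → ℂ) → ℂ) : Prop :=
  ∀ᶠ a in farGeneric, ∀ i, h (a + intVec ℂ (nb i)) = wt a i * h a + h (a + 1)

theorem hgfTerm_add_nb {a : Fin 5 → ℂ} (ha : Generic a) (i : Fin 5) (k : ℕ) :
    hgfTerm (a + intVec ℂ (nb i)) k = wt a i * hgfTerm a k + k * hgfTerm a k := by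
  have hup : ∀ i, Complex.Gamma (a i + 1 + k) = (a i + k) * Complex.Gamma (a i + k) := fun i => by
    have h : a i + k ≠ 0 := fun h => ha.1 i (-k) (by push_cast; linear_combination h)
    rw [add_right_comm, Complex.Gamma_add_one _ h]
  have hdn : ∀ i, (Complex.Gamma (a i + -1 + k))⁻¹ =
      (a i - 1 + k) * (Complex.Gamma (a i + k))⁻¹ := fun i => by
    rw [Complex.one_div_Gamma_eq_self_mul_one_div_Gamma_add_one]
    ring_nf
  fin_cases i <;>
    simp [hgfTerm, nb, wt, step, intVec, div_eq_mul_inv, hup, hdn] <;> ring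

theorem contig_hgf : Contig fun a => hgf a 1 := by
  filter_upwards [eventually_generic, eventually_lt_saal 2] with a ha hs i
  have hs' : 0 < (saal (a + intVec ℂ (nb i))).re := by
    rw [saal_add, saal_intVec]
    have : (-1 : ℤ) ≤ saal (nb i) := by revert i; decide
    have : (-1 : ℝ) ≤ (saal (nb i) : ℤ) := by exact_mod_cast this
    simp
    linarith
  have h1 := hasSum_hgfTerm (ha.add_intVec (nb i)) hs'
  have h2 := ((hasSum_hgfTerm ha (by linarith)).mul_left (wt a i)).add
    (hasSum_natCast_mul_hgfTerm ha (by linarith))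
  simp only [← hgfTerm_add_nb ha] at h2
  exact h1.unique h2

theorem wt_add_intVec (a : Fin 5 → ℂ) (p : Fin 5 → ℤ) (i : Fin 5) :
    wt (a + intVec ℂ p) i = a i + (wt p i : ℤ) := by
  unfold wt
  split_ifs <;> simp [intVec]
  ring

/-- The contiguity relation based at `a + p`; the explicit `q`, `r`, `c` leave only decidable side
conditions on integer vectors. -/
theorem Contig.shift {h : (Fin 5 → ℂ) → ℂ} (hh : Contig h) (p : Fin 5 → ℤ) (i : Fin 5)
    {q r : Fin 5 → ℤ} {c : ℤ} (hq : p + nb i = q) (hr : p + 1 = r) (hc : wt p i = c) :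
    ∀ᶠ a in farGeneric, h (a + intVec ℂ q) =
      (a i + c) * h (a + intVec ℂ p) + h (a + intVec ℂ r) := by
  filter_upwards [(tendsto_add_intVec p).eventually hh] with a ha
  have := ha i
  rwa [← intVec_one, add_assoc, ← intVec_add, hq, add_assoc, ← intVec_add, hr, wt_add_intVec,
    hc] at this

/-- The second order relation, a consequence of `a + e₀ + e₁ + e₂ = (a + 1) - e₃ - e₄`. -/
theorem Contig.second_order {h : (Fin 5 → ℂ) → ℂ} (hh : Contig h) :
    ∀ᶠ a in farGeneric, (saal a - 2) * h (a + 1 + 1) = a 0 * a 1 * a 2 * h a +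
      (a 0 * a 1 + a 1 * a 2 + a 2 * a 0 - (a 3 - 1) * (a 4 - 1) - (saal a - 2)) * h (a + 1) := by
  filter_upwards [hh.shift 0 0 (q := nb 0) (r := 1) (c := 0) (by decide) (by decide) (by decide),
    hh.shift 1 0 (q := 1 + nb 0) (r := 2) (c := 1) (by decide) (by decide) (by decide),
    hh.shift 2 0 (q := 2 + nb 0) (r := 3) (c := 2) (by decide) (by decide) (by decide),
    hh.shift (nb 0) 1 (q := nb 0 + nb 1) (r := 1 + nb 0) (c := 0) (by decide) (by decide)
      (by decide),
    hh.shift (1 + nb 0) 1 (q := 1 + nb 0 + nb 1) (r := 2 + nb 0) (c := 1) (by decide) (by decide)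
      (by decide),
    hh.shift (nb 0 + nb 1) 2 (q := nb 0 + nb 1 + nb 2) (r := 1 + nb 0 + nb 1) (c := 0) (by decide)
      (by decide) (by decide),
    hh.shift 1 3 (q := 1 + nb 3) (r := 2) (c := 0) (by decide) (by decide) (by decide),
    hh.shift 2 3 (q := 2 + nb 3) (r := 3) (c := 1) (by decide) (by decide) (by decide),
    hh.shift (1 + nb 3) 4 (q := nb 0 + nb 1 + nb 2) (r := 2 + nb 3) (c := 0) (by decide)
      (by decide) (by decide)] with a e1 e2 e3 e4 e5 e6 e7 e8 e9
  have z : a + intVec ℂ 0 = a := by ext j; simp [intVec]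
  have o : intVec ℂ 2 = 1 + 1 := by ext j; simp [intVec]; norm_num
  rw [z] at e1
  rw [o, ← add_assoc] at e2 e3 e7 e8
  rw [intVec_one] at e1 e2 e7
  push_cast at e1 e2 e3 e4 e5 e6 e7 e8 e9
  rw [saal]
  -- The first bracket expands `h(a+e₀+e₁+e₂)` along `e₀, e₁, e₂`, the second along `1, -e₃, -e₄`.
  -- The values at `a + 3` cancel.
  linear_combination (e6 + a 2 * e4 + a 2 * a 1 * e1 + a 2 * e2 + e5 + (a 1 + 1) * e2 + e3) -
    (e9 + a 4 * e7 + e8)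

/-- The relations between the values at `x = a + r`, `x + nb i` and their translates by `1`. -/
theorem Contig.relations {h : (Fin 5 → ℂ) → ℂ} (hh : Contig h) (r q : Fin 5 → ℤ) (i : Fin 5)
    (hq : r + nb i = q) : ∀ᶠ a in farGeneric,
      h (a + intVec ℂ q) =
        (a i + (wt r i : ℤ)) * h (a + intVec ℂ r) + h (a + intVec ℂ r + 1) ∧
      h (a + intVec ℂ q + 1) =
        (a i + (wt r i : ℤ) + 1) * h (a + intVec ℂ r + 1) + h (a + intVec ℂ r + 1 + 1) ∧
      (saal a + (saal r : ℤ) - 2) * h (a + intVec ℂ r + 1 + 1) =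
        (a 0 + r 0) * (a 1 + r 1) * (a 2 + r 2) * h (a + intVec ℂ r) +
        ((a 0 + r 0) * (a 1 + r 1) + (a 1 + r 1) * (a 2 + r 2) + (a 2 + r 2) * (a 0 + r 0) -
          (a 3 + r 3 - 1) * (a 4 + r 4 - 1) - (saal a + (saal r : ℤ) - 2)) *
            h (a + intVec ℂ r + 1) := by
  have hw : wt (r + 1) i = wt r i + 1 := by
    unfold wt
    split_ifs <;> simp
  filter_upwards [hh.shift r i hq rfl rfl,
    hh.shift (r + 1) i (q := q + 1) (by rw [← hq]; abel) rfl hw,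
    (tendsto_add_intVec r).eventually hh.second_order] with a e1 e2 e3
  simp only [intVec_add, intVec_one, ← add_assoc] at e1 e2
  refine ⟨e1, ?_, ?_⟩
  · rw [e2]
    push_cast
    ring
  · rw [saal_add, saal_intVec] at e3
    exact e3

/-! ### Denominator-free contiguous matrices -/

section Numerators

variable {R : Type*} [CommRing R]

/-- The denominator cleared from a contiguous matrix. -/
def stepDen (a : Fin 5 → R) : Fin 5 × Bool → R
  | (0, true) | (1, true) | (2, true) | (3, false) | (4, false) => saal a - 2
  | (0, false) => (a 0 - 1) * (a 0 - a 3) * (a 0 - a 4)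
  | (1, false) => (a 1 - 1) * (a 1 - a 3) * (a 1 - a 4)
  | (2, false) => (a 2 - 1) * (a 2 - a 3) * (a 2 - a 4)
  | (3, true) => (a 3 - a 0) * (a 3 - a 1) * (a 3 - a 2)
  | (4, true) => (a 4 - a 0) * (a 4 - a 1) * (a 4 - a 2)

/-- The numerator of `Aᵢ⁺(a)`, `{i, j, k} = {0, 1, 2}`. -/
def upperPlusNum (a : Fin 5 → R) (i j k : Fin 5) : Matrix (Fin 2) (Fin 2) R :=
  !![(saal a - 2) * a i, saal a - 2;
     a 0 * a 1 * a 2, a j * a k - (a i - a 3 + 1) * (a i - a 4 + 1)]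

/-- The numerator of `Aᵢ⁻(a)`, `{i, j, k} = {0, 1, 2}`. -/
def upperMinusNum (a : Fin 5 → R) (i j k : Fin 5) : Matrix (Fin 2) (Fin 2) R :=
  !![(a i - a 3) * (a i - a 4) - a j * a k, saal a - 1;
     a j * a k * (a i - 1), -((saal a - 1) * (a i - 1))]

/-- The numerator of `Aᵢ⁺(a)`, `i = 3, 4`. -/
def lowerPlusNum (a : Fin 5 → R) (i : Fin 5) : Matrix (Fin 2) (Fin 2) R :=
  !![a i ^ 2 - (a 0 + a 1 + a 2) * a i + (a 0 * a 1 + a 1 * a 2 + a 2 * a 0), -(saal a - 1);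
     -(a 0 * a 1 * a 2), a i * (saal a - 1)]

/-- The numerator of `Aᵢ⁻(a)`, `i = 3, 4`. -/
def lowerMinusNum (a : Fin 5 → R) (i : Fin 5) : Matrix (Fin 2) (Fin 2) R :=
  !![(saal a - 2) * (a i - 1), saal a - 2;
     a 0 * a 1 * a 2,
       (a i - 1) ^ 2 - (a 0 + a 1 + a 2) * (a i - 1) + (a 0 * a 1 + a 1 * a 2 + a 2 * a 0)]

/-- The numerator of a contiguous matrix. -/
def stepNum (a : Fin 5 → R) : Fin 5 × Bool → Matrix (Fin 2) (Fin 2) R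
  | (0, true) => upperPlusNum a 0 1 2
  | (1, true) => upperPlusNum a 1 0 2
  | (2, true) => upperPlusNum a 2 0 1
  | (3, true) => lowerPlusNum a 3
  | (4, true) => lowerPlusNum a 4
  | (0, false) => upperMinusNum a 0 1 2
  | (1, false) => upperMinusNum a 1 0 2
  | (2, false) => upperMinusNum a 2 0 1
  | (3, false) => lowerMinusNum a 3
  | (4, false) => lowerMinusNum a 4

/-- The denominator cleared from a product of contiguous matrices along a lattice path. -/
def pathDen (a : Fin 5 → R) : List (Fin 5 × Bool) → R
  | [] => 1
  | d :: l => pathDen (a + intVec R (step d)) l * stepDen a d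

/-- The numerator of a product of contiguous matrices along a lattice path. -/
def pathNum (a : Fin 5 → R) : List (Fin 5 × Bool) → Matrix (Fin 2) (Fin 2) R
  | [] => 1
  | d :: l => pathNum (a + intVec R (step d)) l * stepNum a d

variable {S : Type*} [CommRing S] (g : R →+* S)

theorem map_add_intVec (a : Fin 5 → R) (p : Fin 5 → ℤ) :
    (fun j => g ((a + intVec R p) j)) = (fun j => g (a j)) + intVec S p := by
  ext j
  simp [intVec]

theorem map_stepDen (a : Fin 5 → R) (d : Fin 5 × Bool) :
    g (stepDen a d) = stepDen (fun j => g (a j)) d := by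
  obtain ⟨i, b⟩ := d
  fin_cases i <;> cases b <;> simp [stepDen, saal, map_ofNat]

theorem map_stepNum (a : Fin 5 → R) (d : Fin 5 × Bool) (i j : Fin 2) :
    g (stepNum a d i j) = stepNum (fun j => g (a j)) d i j := by
  obtain ⟨m, b⟩ := d
  fin_cases m <;> cases b <;> fin_cases i <;> fin_cases j <;>
    simp [stepNum, upperPlusNum, upperMinusNum, lowerPlusNum, lowerMinusNum, saal, map_ofNat]

theorem map_pathDen (a : Fin 5 → R) (l : List (Fin 5 × Bool)) :
    g (pathDen a l) = pathDen (fun j => g (a j)) l := by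
  induction l generalizing a with
  | nil => simp [pathDen]
  | cons d l ih => rw [pathDen, pathDen, map_mul, ih, map_stepDen, map_add_intVec]

theorem map_pathNum (a : Fin 5 → R) (l : List (Fin 5 × Bool)) (i j : Fin 2) :
    g (pathNum a l i j) = pathNum (fun j => g (a j)) l i j := by
  induction l generalizing a i j with
  | nil => fin_cases i <;> fin_cases j <;> simp [pathNum]
  | cons d l ih =>
    rw [pathNum, pathNum, Matrix.mul_apply, Matrix.mul_apply, map_sum]
    refine Finset.sum_congr rfl fun k _ => ?_
    rw [map_mul, ih, map_stepNum, map_add_intVec]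

end Numerators

theorem endpoint_cons (d : Fin 5 × Bool) (l : List (Fin 5 × Bool)) :
    endpoint (d :: l) = step d + endpoint l := by
  simp [endpoint]

/-- In the directions `e₀, e₁, e₂, -e₃, -e₄` contiguity gives the first row at once; the second row
involves `h(a+1+1)`, which the second order relation eliminates. -/
theorem Contig.step_plus {h : (Fin 5 → ℂ) → ℂ} (hh : Contig h) (i : Fin 5) :
    ∀ᶠ a in farGeneric,
      (stepNum a (i, decide (i.val < 3))).mulVec ![h a, h (a + 1)] =
        stepDen a (i, decide (i.val < 3)) • ![h (a + intVec ℂ (nb i)),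
          h (a + intVec ℂ (nb i) + 1)] := by
  filter_upwards [hh.relations 0 (nb i) i (zero_add _)] with a ⟨e1, e2, e3⟩
  have z : a + intVec ℂ 0 = a := by ext j; simp [intVec]
  have hs : saal (0 : Fin 5 → ℤ) = 0 := by decide
  rw [z] at e1 e2 e3
  rw [hs] at e3
  generalize h (a + intVec ℂ (nb i)) = y0 at e1 ⊢
  generalize h (a + intVec ℂ (nb i) + 1) = y1 at e2 ⊢
  generalize h (a + 1 + 1) = x2 at e2 e3
  generalize h (a + 1) = x1 at e1 e2 e3 ⊢
  generalize h a = x0 at e1 e2 e3 ⊢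
  rw [saal] at e3
  ext j
  fin_cases i <;> fin_cases j <;>
    simp [stepNum, stepDen, upperPlusNum, lowerMinusNum, saal, wt, Matrix.mulVec, dotProduct,
      Fin.sum_univ_two] at e1 e2 e3 ⊢
  any_goals linear_combination (-(a 3 + a 4 - a 0 - a 1 - a 2 - 2)) * e1
  all_goals linear_combination (-(a 3 + a 4 - a 0 - a 1 - a 2 - 2)) * e2 - e3

/-- For the opposite directions `a` is a neighbour of the end point. The relations there express `h
a` and `h (a + 1)` through three values at the end point, and the second order relation at the end
point, where `s` has grown by `1`, removes the third. -/
theorem Contig.step_minus {h : (Fin 5 → ℂ) → ℂ} (hh : Contig h) (i : Fin 5) :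
    ∀ᶠ a in farGeneric,
      (stepNum a (i, !decide (i.val < 3))).mulVec ![h a, h (a + 1)] =
        stepDen a (i, !decide (i.val < 3)) • ![h (a + intVec ℂ (step (i, !decide (i.val < 3)))),
          h (a + intVec ℂ (step (i, !decide (i.val < 3))) + 1)] := by
  filter_upwards [hh.relations (step (i, !decide (i.val < 3))) 0 i (by revert i; decide)] with
    a ⟨e1, e2, e3⟩
  have z : a + intVec ℂ 0 = a := by ext j; simp [intVec]
  have hs : ∀ i : Fin 5, saal (step (i, !decide (i.val < 3))) = 1 := by decide
  rw [z] at e1 e2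
  rw [hs i] at e3
  generalize h (a + intVec ℂ (step (i, !decide (i.val < 3)))) = y0 at e1 e3 ⊢
  generalize h (a + intVec ℂ (step (i, !decide (i.val < 3))) + 1 + 1) = y2 at e2 e3 ⊢
  generalize h (a + intVec ℂ (step (i, !decide (i.val < 3))) + 1) = y1 at e1 e2 e3 ⊢
  generalize h (a + 1) = x1 at e2 ⊢
  generalize h a = x0 at e1 ⊢
  rw [saal] at e3
  ext j
  fin_cases i <;> fin_cases j <;>
    simp [stepNum, stepDen, upperMinusNum, lowerPlusNum, saal, wt, Matrix.mulVec, dotProduct,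
      Fin.sum_univ_two, step] at e1 e2 e3 ⊢ <;> rw [e1, e2]
  · linear_combination e3
  · linear_combination -(a 0 - 1) * e3
  · linear_combination e3
  · linear_combination -(a 1 - 1) * e3
  · linear_combination e3
  · linear_combination -(a 2 - 1) * e3
  · linear_combination -e3
  · linear_combination a 3 * e3
  · linear_combination -e3
  · linear_combination a 4 * e3

theorem Contig.step {h : (Fin 5 → ℂ) → ℂ} (hh : Contig h) (d : Fin 5 × Bool) :
    ∀ᶠ a in farGeneric,
      (stepNum a d).mulVec ![h a, h (a + 1)] =
        stepDen a d • ![h (a + intVec ℂ (step d)), h (a + intVec ℂ (step d) + 1)] := by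
  obtain ⟨i, b⟩ := d
  by_cases hb : b = decide (i.val < 3)
  · rw [hb]
    exact hh.step_plus i
  · rw [Bool.eq_not_of_ne hb]
    exact hh.step_minus i

theorem Contig.path {h : (Fin 5 → ℂ) → ℂ} (hh : Contig h) (l : List (Fin 5 × Bool)) :
    ∀ᶠ a in farGeneric,
      (pathNum a l).mulVec ![h a, h (a + 1)] =
        pathDen a l • ![h (a + intVec ℂ (endpoint l)), h (a + intVec ℂ (endpoint l) + 1)] := by
  induction l with
  | nil =>
    refine Eventually.of_forall fun a => ?_
    have z : a + intVec ℂ 0 = a := by ext j; simp [intVec]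
    simp [pathNum, pathDen, endpoint, z]
  | cons d l ih =>
    filter_upwards [hh.step d, (tendsto_add_intVec (ThreeTerm.step d)).eventually ih] with a h1 h2
    rw [pathNum, ← Matrix.mulVec_mulVec, h1, Matrix.mulVec_smul, h2, pathDen, endpoint_cons,
      intVec_add, ← add_assoc, smul_smul, mul_comm]

/-- The first row of the connection matrix. -/
theorem Contig.top_row {h : (Fin 5 → ℂ) → ℂ} (hh : Contig h) (l : List (Fin 5 × Bool)) :
    ∀ᶠ a in farGeneric, pathDen a l * h (a + intVec ℂ (endpoint l)) =
      pathNum a l 0 0 * h a + pathNum a l 0 1 * h (a + 1) := by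
  filter_upwards [hh.path l] with a ha
  have := congrFun ha 0
  simpa [Matrix.mulVec, dotProduct, Fin.sum_univ_two] using this.symm

/-! ### Products of contiguous matrices over a field -/

section FieldMatrices

variable {K : Type*} [Field K]

/-- No entry, no difference of two entries and no value of `s` is an integer. -/
structure NonInt (a : Fin 5 → K) : Prop where
  entry : ∀ i, ∀ n : ℤ, a i ≠ n
  diff : ∀ i j, i ≠ j → ∀ n : ℤ, a i - a j ≠ n
  saal : ∀ n : ℤ, saal a ≠ n

theorem saal_add_intVec (a : Fin 5 → K) (p : Fin 5 → ℤ) :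
    saal (a + intVec K p) = saal a + (saal p : ℤ) := by
  simp [saal, intVec]
  ring

theorem NonInt.add_intVec {a : Fin 5 → K} (ha : NonInt a) (p : Fin 5 → ℤ) :
    NonInt (a + intVec K p) := by
  refine ⟨fun i n h => ha.entry i (n - p i) ?_,
    fun i j hij n h => ha.diff i j hij (n - p i + p j) ?_, fun n h => ha.saal (n - ThreeTerm.saal p) ?_⟩
  · simp only [Pi.add_apply, intVec] at h
    push_cast
    linear_combination h
  · simp only [Pi.add_apply, intVec] at h
    push_cast
    linear_combination h
  · rw [saal_add_intVec] at h
    push_cast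
    linear_combination h

theorem NonInt.stepDen_ne_zero {a : Fin 5 → K} (ha : NonInt a) (d : Fin 5 × Bool) :
    stepDen a d ≠ 0 := by
  have h1 : ∀ i, a i - 1 ≠ 0 := fun i h => ha.entry i 1 (by push_cast; linear_combination h)
  have h2 : ∀ i j, i ≠ j → a i - a j ≠ 0 := fun i j hij h =>
    ha.diff i j hij 0 (by push_cast; linear_combination h)
  have h3 : ThreeTerm.saal a - 2 ≠ 0 := fun h => ha.saal 2 (by push_cast; linear_combination h)
  obtain ⟨i, b⟩ := d
  fin_cases i <;> cases b
  all_goals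
    first
    | exact h3
    | dsimp [stepDen]
      refine mul_ne_zero (mul_ne_zero ?_ ?_) ?_ <;>
        first
        | exact h1 _
        | exact h2 _ _ (by decide)

theorem NonInt.pathDen_ne_zero {a : Fin 5 → K} (ha : NonInt a) (l : List (Fin 5 × Bool)) :
    pathDen a l ≠ 0 := by
  induction l generalizing a with
  | nil => simp [pathDen]
  | cons d l ih => exact mul_ne_zero (ih (ha.add_intVec _)) (ha.stepDen_ne_zero d)

theorem NonInt.contigMatrix_eq {a : Fin 5 → K} (ha : NonInt a) (d : Fin 5 × Bool) :
    stepDen a d • contigMatrix a d.1 d.2 = stepNum a d := by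
  have h1 : ∀ i, a i - 1 ≠ 0 := fun i h => ha.entry i 1 (by push_cast; linear_combination h)
  have h2 : ∀ i j, i ≠ j → a i - a j ≠ 0 := fun i j hij h =>
    ha.diff i j hij 0 (by push_cast; linear_combination h)
  have h3 : ThreeTerm.saal a - 2 ≠ 0 := fun h => ha.saal 2 (by push_cast; linear_combination h)
  have h03 := h2 0 3 (by decide)
  have h04 := h2 0 4 (by decide)
  have h13 := h2 1 3 (by decide)
  have h14 := h2 1 4 (by decide)
  have h23 := h2 2 3 (by decide)
  have h24 := h2 2 4 (by decide)
  have h30 := h2 3 0 (by decide)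
  have h31 := h2 3 1 (by decide)
  have h32 := h2 3 2 (by decide)
  have h40 := h2 4 0 (by decide)
  have h41 := h2 4 1 (by decide)
  have h42 := h2 4 2 (by decide)
  have h5 := h1 0
  have h6 := h1 1
  have h7 := h1 2
  obtain ⟨i, b⟩ := d
  ext r c
  fin_cases i <;> cases b <;> fin_cases r <;> fin_cases c <;>
    simp [contigMatrix, stepDen, stepNum, upperPlus, upperPlusNum, upperMinus, upperMinusNum,
      lowerPlus, lowerPlusNum, lowerMinus, lowerMinusNum, phi1, phi2, phi3] <;> field_simp
  all_goals ring

theorem NonInt.pathMatrix_eq {a : Fin 5 → K} (ha : NonInt a) (l : List (Fin 5 × Bool)) :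
    pathDen a l • pathMatrix a l = pathNum a l := by
  induction l generalizing a with
  | nil => simp [pathDen, pathNum, pathMatrix]
  | cons d l ih =>
    rw [pathDen, pathNum, pathMatrix, ← ih (ha.add_intVec _), ← ha.contigMatrix_eq d,
      Matrix.smul_mul, Matrix.mul_smul, smul_smul]

theorem pathMatrix_append (a : Fin 5 → K) (l l' : List (Fin 5 × Bool)) :
    pathMatrix a (l ++ l') = pathMatrix (a + intVec K (endpoint l)) l' * pathMatrix a l := by
  induction l generalizing a with
  | nil =>
    have : a + intVec K 0 = a := by ext j; simp [intVec]
    simp [pathMatrix, endpoint, this]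
  | cons d l ih =>
    have : a + intVec K (step d) + intVec K (endpoint l) = a + intVec K (endpoint (d :: l)) := by
      ext j; simp [intVec, endpoint_cons, add_assoc]
    rw [List.cons_append, pathMatrix, ih, this, pathMatrix, Matrix.mul_assoc]

theorem poch_add_one {x : K} (hx : ∀ n : ℤ, x ≠ n) (n : ℤ) :
    poch x (n + 1) = poch x n * (x + n) := by
  obtain ⟨n, rfl | rfl⟩ := n.eq_nat_or_neg
  · change poch x (Int.ofNat (n + 1)) = poch x (Int.ofNat n) * _
    rw [poch, poch, Finset.prod_range_succ]
    simp
  · cases n with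
    | zero =>
      change poch x (Int.ofNat 1) = poch x (Int.ofNat 0) * _
      simp [poch]
    | succ m =>
      have hne : x - (m + 1) ≠ 0 := fun h => hx (m + 1) (by push_cast; linear_combination h)
      change poch x (Int.negSucc m + 1) = poch x (Int.negSucc m) * _
      have hr : poch x (Int.negSucc m) * (x + ((-((m + 1 : ℕ) : ℤ) : ℤ) : K)) =
          (∏ k ∈ Finset.range m, (x - (k + 1)))⁻¹ := by
        rw [poch, Finset.prod_range_succ, mul_inv]
        push_cast
        rw [← sub_eq_add_neg, mul_assoc, inv_mul_cancel₀ hne, mul_one]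
      rw [hr]
      cases m with
      | zero =>
        change poch x (Int.ofNat 0) = _
        simp [poch]
      | succ m => rfl

theorem poch_add {x : K} (hx : ∀ n : ℤ, x ≠ n) (m n : ℤ) :
    poch x (m + n) = poch x m * poch (x + m) n := by
  have hxm : ∀ n : ℤ, x + m ≠ n := fun n h => hx (n - m) (by push_cast; linear_combination h)
  induction n using Int.induction_on with
  | zero =>
    change _ = _ * poch (x + m) (Int.ofNat 0)
    simp [poch]
  | succ n ih =>
    rw [← add_assoc, poch_add_one hx, ih, poch_add_one hxm]
    push_cast
    ring
  | pred n ih =>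
    have h1 := poch_add_one hx (m + (-n - 1))
    have h2 := poch_add_one hxm (-n - 1)
    rw [show m + (-n - 1 : ℤ) + 1 = m + -n by ring, ih] at h1
    rw [show (-n - 1 : ℤ) + 1 = -n by ring] at h2
    rw [h2] at h1
    have hne : x + m + ((-n - 1 : ℤ) : K) ≠ 0 := fun h => hxm (n + 1) (by
      push_cast at h ⊢
      linear_combination h)
    refine mul_right_cancel₀ hne ?_
    push_cast at h1 ⊢
    linear_combination -h1

theorem poch_zero (x : K) : poch x 0 = 1 := by
  change poch x (Int.ofNat 0) = 1
  simp [poch]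

theorem poch_one (x : K) : poch x 1 = x := by
  change poch x (Int.ofNat 1) = x
  simp [poch]

theorem poch_neg_one (x : K) : poch x (-1) = (x - 1)⁻¹ := by
  change poch x (Int.negSucc 0) = _
  simp [poch]

/-- The cocycle property, factor by factor from `poch_add`; it reduces the determinant of a path
product to single steps. -/
theorem NonInt.connDet_add {a : Fin 5 → K} (ha : NonInt a) (p q : Fin 5 → ℤ) :
    connDet a (p + q) = connDet a p * connDet (a + intVec K p) q := by
  have hs : ∀ n : ℤ, ThreeTerm.saal a - 1 ≠ n := fun n h =>
    ha.saal (n + 1) (by push_cast; linear_combination h)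
  have h1 : ∀ i, poch (a i) ((p + q) i) = poch (a i) (p i) * poch ((a + intVec K p) i) (q i) :=
    fun i => poch_add (ha.entry i) _ _
  have h2 : ∀ i j, i ≠ j → poch (a i - a j) ((p + q) i - (p + q) j) =
      poch (a i - a j) (p i - p j) *
        poch ((a + intVec K p) i - (a + intVec K p) j) (q i - q j) := fun i j hij => by
    rw [show (p + q) i - (p + q) j = (p i - p j) + (q i - q j) by simp; ring,
      poch_add (ha.diff i j hij)]
    congr 2
    simp [intVec]
    ring
  have h3 : poch (ThreeTerm.saal a - 1) (ThreeTerm.saal (p + q)) =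
      poch (ThreeTerm.saal a - 1) (ThreeTerm.saal p) *
        poch (ThreeTerm.saal (a + intVec K p) - 1) (ThreeTerm.saal q) := by
    rw [show ThreeTerm.saal (p + q) = ThreeTerm.saal p + ThreeTerm.saal q by simp [ThreeTerm.saal]; ring,
      poch_add hs, saal_add_intVec]
    congr 2
    ring
  have h4 : (-1 : K) ^ ((p + q) 0 + (p + q) 1 + (p + q) 2) =
      (-1) ^ (p 0 + p 1 + p 2) * (-1) ^ (q 0 + q 1 + q 2) := by
    rw [← zpow_add₀ (by norm_num)]
    congr 1
    simp
    ring
  rw [connDet, connDet, connDet, div_mul_div_comm, h1, h1, h1, h2 3 0 (by decide),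
    h2 4 0 (by decide), h2 3 1 (by decide), h2 4 1 (by decide), h2 3 2 (by decide),
    h2 4 2 (by decide), h3, h4]
  congr 1 <;> ring

theorem NonInt.det_contigMatrix {a : Fin 5 → K} (ha : NonInt a) (d : Fin 5 × Bool) :
    (contigMatrix a d.1 d.2).det = connDet a (step d) := by
  have h1 : ∀ i, a i - 1 ≠ 0 := fun i h => ha.entry i 1 (by push_cast; linear_combination h)
  have h2 : ∀ i j, i ≠ j → a i - a j ≠ 0 := fun i j hij h =>
    ha.diff i j hij 0 (by push_cast; linear_combination h)
  have h4 : ∀ i j, i ≠ j → a i - a j - 1 ≠ 0 := fun i j hij h =>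
    ha.diff i j hij 1 (by push_cast; linear_combination h)
  have hs : ThreeTerm.saal a - 2 ≠ 0 := fun h => ha.saal 2 (by push_cast; linear_combination h)
  have hs' : ThreeTerm.saal a - 1 - 1 ≠ 0 := fun h =>
    ha.saal 2 (by push_cast; linear_combination h)
  have h03 := h2 0 3 (by decide)
  have h04 := h2 0 4 (by decide)
  have h13 := h2 1 3 (by decide)
  have h14 := h2 1 4 (by decide)
  have h23 := h2 2 3 (by decide)
  have h24 := h2 2 4 (by decide)
  have h30 := h2 3 0 (by decide)
  have h31 := h2 3 1 (by decide)
  have h32 := h2 3 2 (by decide)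
  have h40 := h2 4 0 (by decide)
  have h41 := h2 4 1 (by decide)
  have h42 := h2 4 2 (by decide)
  have g30 := h4 3 0 (by decide)
  have g31 := h4 3 1 (by decide)
  have g32 := h4 3 2 (by decide)
  have g40 := h4 4 0 (by decide)
  have g41 := h4 4 1 (by decide)
  have g42 := h4 4 2 (by decide)
  have h5 := h1 0
  have h6 := h1 1
  have h7 := h1 2
  rw [ThreeTerm.saal] at hs hs'
  obtain ⟨i, b⟩ := d
  rw [Matrix.det_fin_two]
  fin_cases i <;> cases b <;>
    simp [contigMatrix, upperPlus, upperMinus, lowerPlus, lowerMinus, phi1, phi2, phi3, connDet,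
      step, ThreeTerm.saal, poch_zero, poch_one, poch_neg_one] <;> field_simp <;> ring

theorem NonInt.det_pathMatrix {a : Fin 5 → K} (ha : NonInt a) (l : List (Fin 5 × Bool)) :
    (pathMatrix a l).det = connDet a (endpoint l) := by
  induction l generalizing a with
  | nil => simp [pathMatrix, endpoint, connDet, ThreeTerm.saal, poch_zero]
  | cons d l ih =>
    rw [pathMatrix, Matrix.det_mul, ih (ha.add_intVec _), ha.det_contigMatrix, endpoint_cons,
      ha.connDet_add, mul_comm]

end FieldMatrices

/-- A rational point whose coordinates and value of `s` avoid the integers. -/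
def rationalPoint : Fin 5 → ℚ := ![1 / 2, 1 / 3, 1 / 5, 1 / 7, 1 / 11]

theorem nonInt_rationalPoint : NonInt rationalPoint := by
  have key : ∀ (x : ℚ), x.den ≠ 1 → ∀ n : ℤ, x ≠ n := fun x hx n h => hx (by rw [h]; simp)
  refine ⟨fun i => key _ ?_, fun i j hij => key _ ?_, key _ ?_⟩
  · fin_cases i <;> norm_num [rationalPoint]
  · fin_cases i <;> fin_cases j <;> first | exact absurd rfl hij | norm_num [rationalPoint]
  · change (1 / 7 + 1 / 11 - 1 / 2 - 1 / 3 - 1 / 5 : ℚ).den ≠ 1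
    norm_num

/-- If a polynomial were an integer constant, its value at `rationalPoint` would be that integer. -/
theorem nonInt_vars : NonInt vars := by
  have key : ∀ P : MvPolynomial (Fin 5) ℚ, (∀ n : ℤ, MvPolynomial.eval rationalPoint P ≠ n) →
      ∀ n : ℤ, algebraMap (MvPolynomial (Fin 5) ℚ) (RatFun ℚ) P ≠ n := fun P hP n h => by
    have h1 : P = (n : MvPolynomial (Fin 5) ℚ) :=
      IsFractionRing.injective (MvPolynomial (Fin 5) ℚ) (RatFun ℚ) (by rw [h, map_intCast])
    exact hP n (by rw [h1, map_intCast])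
  refine ⟨fun i => key _ ?_, fun i j hij => ?_, ?_⟩
  · simpa using nonInt_rationalPoint.entry i
  · have := key (MvPolynomial.X i - MvPolynomial.X j)
      (by simpa using nonInt_rationalPoint.diff i j hij)
    simpa [vars] using this
  · have := key (saal MvPolynomial.X)
      (by simpa [saal] using nonInt_rationalPoint.saal)
    simpa [vars, saal] using this

/-! ### The action of `S₂ ⋉ (S₃ × S₃)` on parameters -/

section Action

variable {R : Type*}

/-- The parameters as a pair of triples, with lower triple `(c, a₃, a₄)`. -/
def toTriples (c : R) (a : Fin 5 → R) : Fin 2 → Fin 3 → R := ![![a 0, a 1, a 2], ![c, a 3, a 4]]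

/-- The position of each parameter in the pair of triples. -/
def tripleIndex : Fin 5 → Fin 2 × Fin 3 := ![(0, 0), (0, 1), (0, 2), (1, 1), (1, 2)]

theorem toTriples_tripleIndex (c : R) (a : Fin 5 → R) (k : Fin 5) :
    toTriples c a (tripleIndex k).1 (tripleIndex k).2 = a k := by
  fin_cases k <;> rfl

theorem toTriples_one_zero (c : R) (a : Fin 5 → R) : toTriples c a 1 0 = c := rfl

variable [CommRing R]

/-- Normalize the leading lower entry to `c` by a translation and drop it. -/
def ofTriples (c : R) (w : Fin 2 → Fin 3 → R) : Fin 5 → R :=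
  fun k => w (tripleIndex k).1 (tripleIndex k).2 + (c - w 1 0)

/-- The signed permutation action on pairs of triples. -/
def rho (x : S2S3S3) (w : Fin 2 → Fin 3 → R) : Fin 2 → Fin 3 → R := fun i j =>
  (((Equiv.Perm.sign x.right : ℤˣ) : ℤ) : R) * w (x.right⁻¹ i) ((x.left i)⁻¹ j)

/-- The action on parameters (`c = 1`) and its linear part (`c = 0`). -/
def act (c : R) (x : S2S3S3) (a : Fin 5 → R) : Fin 5 → R := ofTriples c (rho x (toTriples c a))

theorem eq_or_eq_tripleIndex (y : Fin 2 × Fin 3) : y = (1, 0) ∨ ∃ k, y = tripleIndex k := by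
  revert y; decide

theorem tripleIndex_ne (k : Fin 5) : tripleIndex k ≠ (1, 0) := by
  revert k; decide

theorem tripleIndex_injective : Function.Injective tripleIndex := by
  decide

theorem toTriples_ofTriples (c : R) (w : Fin 2 → Fin 3 → R) (i : Fin 2) (j : Fin 3) :
    toTriples c (ofTriples c w) i j = w i j + (c - w 1 0) := by
  rcases eq_or_eq_tripleIndex (i, j) with h | ⟨k, h⟩
  · obtain ⟨rfl, rfl⟩ := Prod.mk.inj h
    rw [toTriples_one_zero]
    ring
  · have h1 : i = (tripleIndex k).1 := congrArg Prod.fst h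
    have h2 : j = (tripleIndex k).2 := congrArg Prod.snd h
    rw [h1, h2, toTriples_tripleIndex]
    rfl

theorem ofTriples_congr (c : R) {w w' : Fin 2 → Fin 3 → R} (d : R)
    (h : ∀ i j, w i j = w' i j + d) : ofTriples c w = ofTriples c w' := by
  ext k
  rw [ofTriples, ofTriples, h, h 1 0]
  ring

theorem rho_one (w : Fin 2 → Fin 3 → R) : rho 1 w = w := by
  ext i j
  simp [rho]

theorem rho_mul (x y : S2S3S3) (w : Fin 2 → Fin 3 → R) : rho (x * y) w = rho x (rho y w) := by
  ext i j
  simp only [rho, SemidirectProduct.mul_right, SemidirectProduct.mul_left, Equiv.Perm.sign_mul,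
    Pi.mul_apply, mul_inv_rev, Equiv.Perm.mul_apply, Units.val_mul, Int.cast_mul, mul_assoc]
  rfl

theorem act_one (c : R) (a : Fin 5 → R) : act c 1 a = a := by
  ext k
  rw [act, rho_one, ofTriples, toTriples_tripleIndex, toTriples_one_zero]
  ring

/-- The intermediate normalization adds one constant to all six entries. `rho x` turns it into plus
or minus that constant, and the final normalization removes it. -/
theorem act_mul (c : R) (x y : S2S3S3) (a : Fin 5 → R) :
    act c (x * y) a = act c x (act c y a) := by
  rw [act, rho_mul, act]
  refine ofTriples_congr c (-((((Equiv.Perm.sign x.right : ℤˣ) : ℤ) : R) *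
    (c - rho y (toTriples c a) 1 0))) fun i j => ?_
  simp only [rho, act, toTriples_ofTriples]
  ring

theorem act_add (x : S2S3S3) (a b : Fin 5 → R) : act 1 x (a + b) = act 1 x a + act 0 x b := by
  have h : ∀ i j, toTriples 1 (a + b) i j = toTriples 1 a i j + toTriples 0 b i j := fun i j => by
    fin_cases i <;> fin_cases j <;> simp [toTriples]
  ext k
  simp only [act, ofTriples, rho, h, Pi.add_apply]
  ring

theorem saal_eq_sum (c : R) (a : Fin 5 → R) :
    saal a = ∑ j, toTriples c a 1 j - ∑ j, toTriples c a 0 j - c := by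
  simp [Fin.sum_univ_three, toTriples, saal]
  ring

/-- Permutations within the triples preserve both sums; the swap of the triples exchanges them, and
its sign restores the difference. This makes `s` invariant. -/
theorem sum_rho (x : S2S3S3) (w : Fin 2 → Fin 3 → R) :
    ∑ j, rho x w 1 j - ∑ j, rho x w 0 j = ∑ j, w 1 j - ∑ j, w 0 j := by
  simp only [rho, ← Finset.mul_sum]
  rw [Equiv.sum_comp (x.left 1)⁻¹ fun j => w (x.right⁻¹ 1) j,
    Equiv.sum_comp (x.left 0)⁻¹ fun j => w (x.right⁻¹ 0) j]
  have hg : ∀ g : Equiv.Perm (Fin 2), g = 1 ∨ g = Equiv.swap 0 1 := by decide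
  rcases hg x.right with h | h <;> rw [h]
  · simp
  · simp
    ring

theorem saal_act (c : R) (x : S2S3S3) (a : Fin 5 → R) : saal (act c x a) = saal a := by
  rw [saal_eq_sum c, saal_eq_sum c a, ← sum_rho x (toTriples c a)]
  simp only [act, toTriples_ofTriples, Finset.sum_add_distrib]
  simp

theorem act_zero_intVec (x : S2S3S3) (p : Fin 5 → ℤ) :
    act 0 x (intVec R p) = intVec R (act 0 x p) := by
  have h : ∀ i j, toTriples 0 (intVec R p) i j = ((toTriples 0 p i j : ℤ) : R) := fun i j => by
    fin_cases i <;> fin_cases j <;> simp [toTriples, intVec]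
  ext k
  simp only [act, ofTriples, rho, intVec, h]
  push_cast
  ring

end Action

/-- Genericness says that the six entries of the two triples, the entry `1` included, are pairwise
incongruent modulo the integers. Permutation, sign and common translation preserve this. -/
theorem Generic.act {a : Fin 5 → ℂ} (ha : Generic a) (x : S2S3S3) : Generic (act 1 x a) := by
  have h1 : ∀ y z : Fin 2 × Fin 3, y ≠ z → ∀ n : ℤ,
      toTriples 1 a y.1 y.2 - toTriples 1 a z.1 z.2 ≠ n := fun y z hyz n h => by
    rcases eq_or_eq_tripleIndex y with hy | ⟨k, hy⟩ <;>
      rcases eq_or_eq_tripleIndex z with hz | ⟨l, hz⟩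
    · exact hyz (hy.trans hz.symm)
    · rw [hy, hz, toTriples_one_zero, toTriples_tripleIndex] at h
      exact ha.1 l (1 - n) (by push_cast; linear_combination -h)
    · rw [hy, hz, toTriples_one_zero, toTriples_tripleIndex] at h
      exact ha.1 k (1 + n) (by push_cast; linear_combination h)
    · rw [hy, hz, toTriples_tripleIndex, toTriples_tripleIndex] at h
      exact ha.2 k l (fun hkl => hyz (by rw [hy, hz, hkl])) n h
  have h2 : ∀ y z : Fin 2 × Fin 3, y ≠ z → ∀ n : ℤ,
      rho x (toTriples 1 a) y.1 y.2 - rho x (toTriples 1 a) z.1 z.2 ≠ n := fun y z hyz n h => by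
    have hne : ((x.right⁻¹ y.1, (x.left y.1)⁻¹ y.2) : Fin 2 × Fin 3) ≠
        (x.right⁻¹ z.1, (x.left z.1)⁻¹ z.2) := fun h => by
      obtain ⟨e1, e2⟩ := Prod.mk.inj h
      have e1' := x.right⁻¹.injective e1
      rw [e1'] at e2
      exact hyz (Prod.ext e1' ((x.left z.1)⁻¹.injective e2))
    simp only [rho] at h
    rcases Int.units_eq_one_or (Equiv.Perm.sign x.right) with hs | hs <;> rw [hs] at h
    · exact h1 _ _ hne n (by simpa using h)
    · refine h1 _ _ hne (-n) ?_
      push_cast at h ⊢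
      linear_combination -h
  refine ⟨fun k n h => ?_, fun k l hkl n h => ?_⟩
  · refine h2 _ _ (tripleIndex_ne k) (n - 1) ?_
    rw [ThreeTerm.act, ofTriples] at h
    push_cast
    linear_combination h
  · refine h2 _ _ (fun h => hkl (tripleIndex_injective h)) n ?_
    rw [ThreeTerm.act, ofTriples, ofTriples] at h
    linear_combination h

/-- The permutation representation of `S₂ ⋉ (S₃ × S₃)` on the parameter space. -/
def actPerm : S2S3S3 →* Equiv.Perm (Fin 5 → ℂ) :=
  MonoidHom.toHomPerm
    { toFun := fun x => act 1 x
      map_one' := funext fun a => act_one 1 a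
      map_mul' := fun x y => funext fun a => act_mul 1 x y a }

theorem actPerm_apply (x : S2S3S3) (a : Fin 5 → ℂ) : actPerm x a = act 1 x a := rfl

/-- If `x` acts trivially, then `rho x` changes each pair of triples coming from parameters by a
common translation only; two test points exclude this for `x ≠ 1`. -/
theorem actPerm_injective : Function.Injective actPerm := by
  rw [injective_iff_map_eq_one]
  intro x hx
  have h : ∀ a i j, rho x (toTriples (1 : ℂ) a) i j =
      toTriples 1 a i j + (rho x (toTriples 1 a) 1 0 - 1) := fun a i j => by
    have h1 : act 1 x a = a := by rw [← actPerm_apply, hx]; rfl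
    have h2 := toTriples_ofTriples 1 (rho x (toTriples (1 : ℂ) a)) i j
    rw [← act, h1] at h2
    linear_combination -h2
  have hg : ∀ g : Equiv.Perm (Fin 2), g = 1 ∨ g = Equiv.swap 0 1 := by decide
  obtain ⟨f, g⟩ := x
  rcases hg g with rfl | rfl
  · have hf : ∀ i j, f i j = j := fun i j => by
      have h1 : ∀ k l, toTriples (1 : ℂ) ![2, 3, 5, 7, 11] i k =
          toTriples 1 ![2, 3, 5, 7, 11] i l → k = l := by
        intro k l hkl
        fin_cases i <;> fin_cases k <;> fin_cases l <;> simp [toTriples] at hkl ⊢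
      have h2 := h ![2, 3, 5, 7, 11]
      simp only [rho, Equiv.Perm.sign_one, inv_one, Equiv.Perm.one_apply, Units.val_one,
        Int.cast_one, one_mul] at h2
      -- A permutation preserves the sum of a triple, so the translation is zero; the entries of
      -- each triple are distinct, so the permutation is trivial.
      have h3 : ∑ j, toTriples (1 : ℂ) ![2, 3, 5, 7, 11] i ((f i)⁻¹ j) =
          ∑ j, toTriples (1 : ℂ) ![2, 3, 5, 7, 11] i j :=
        Equiv.sum_comp (f i)⁻¹ fun j => toTriples (1 : ℂ) ![2, 3, 5, 7, 11] i j
      have h4 := h2 i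
      simp only [h4, Finset.sum_add_distrib, Finset.sum_const, Finset.card_univ, Fintype.card_fin,
        nsmul_eq_mul] at h3
      have h5 : toTriples (1 : ℂ) ![2, 3, 5, 7, 11] 1 ((f 1)⁻¹ 0) - 1 = 0 := by
        have : ((3 : ℕ) : ℂ) ≠ 0 := by norm_num
        refine (mul_eq_zero.1 ?_).resolve_left this
        linear_combination h3
      have h6 := h4 j
      rw [h5, add_zero] at h6
      have h7 := h1 _ _ h6
      rw [Equiv.Perm.inv_eq_iff_eq] at h7
      exact h7.symm
    have : f = 1 := by ext i j; rw [hf]; rfl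
    rw [this]
    rfl
  · exfalso
    -- The upper triple is constant here, so its image would be constant too; but under the swap
    -- that image consists of `-1, -3, -7`.
    have h1 := h ![0, 0, 0, 3, 7] 0
    have h2 : ∀ j, rho (⟨f, Equiv.swap 0 1⟩ : S2S3S3) (toTriples (1 : ℂ) ![0, 0, 0, 3, 7]) 0 (f 0 j) =
        -toTriples (1 : ℂ) ![0, 0, 0, 3, 7] 1 j := fun j => by
      simp [rho]
    have h3 : ∀ j, toTriples (1 : ℂ) ![0, 0, 0, 3, 7] 0 j = 0 := fun j => by
      fin_cases j <;> simp [toTriples]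
    have h4 := h1 (f 0 0)
    have h5 := h1 (f 0 1)
    rw [h2, h3] at h4 h5
    have h6 : toTriples (1 : ℂ) ![0, 0, 0, 3, 7] 1 0 = 1 := rfl
    have h7 : toTriples (1 : ℂ) ![0, 0, 0, 3, 7] 1 1 = 3 := rfl
    rw [h6] at h4
    rw [h7] at h5
    have : (2 : ℂ) = 0 := by linear_combination h4 - h5
    norm_num at this

/-- The elements of `S₂ ⋉ (S₃ × S₃)` which act as the parameter involutions. -/
def genElt : SingPt → Fin 3 → S2S3S3
  | .zero, i => SemidirectProduct.inl (Pi.mulSingle (1 : Fin 2) (Equiv.swap (0 : Fin 3) i))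
  | .infty, i => ⟨fun _ => Equiv.swap 0 i, Equiv.swap 0 1⟩

theorem act_genElt (ν : SingPt) (i : Fin 3) (a : Fin 5 → ℂ) :
    act 1 (genElt ν i) a = paramMap ν i a := by
  ext k
  cases ν <;> fin_cases i <;> fin_cases k <;>
    simp [genElt, act, ofTriples, tripleIndex, rho, toTriples, paramMap, Equiv.swap_apply_def] <;>
    ring

theorem genElt_infty_zero : genElt .infty 0 = SemidirectProduct.inr (Equiv.swap 0 1) := by
  refine SemidirectProduct.ext ?_ rfl
  funext i
  simp [genElt]
  rfl

/-- Two transpositions generate the second factor `S₃`, and conjugation with the swap carries it to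
the first. -/
theorem closure_gen_eq_top :
    Subgroup.closure {genElt .infty 0, genElt .zero 1, genElt .zero 2} = ⊤ := by
  set H := Subgroup.closure {genElt .infty 0, genElt .zero 1, genElt .zero 2} with hH
  have hs : genElt .infty 0 ∈ H := Subgroup.subset_closure (by simp)
  have h1 : genElt .zero 1 ∈ H := Subgroup.subset_closure (by simp)
  have h2 : genElt .zero 2 ∈ H := Subgroup.subset_closure (by simp)
  rw [genElt_infty_zero] at hs
  have hS3 : ∀ π : Equiv.Perm (Fin 3),
      (SemidirectProduct.inl (Pi.mulSingle (1 : Fin 2) π) : S2S3S3) ∈ H := by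
    let F : Equiv.Perm (Fin 3) →* S2S3S3 := (SemidirectProduct.inl).comp
      (MonoidHom.mulSingle (fun _ : Fin 2 => Equiv.Perm (Fin 3)) 1)
    have key : ∀ π : Equiv.Perm (Fin 3), π = 1 ∨ π = Equiv.swap 0 1 ∨ π = Equiv.swap 0 2 ∨
        π = Equiv.swap 0 1 * Equiv.swap 0 2 ∨ π = Equiv.swap 0 2 * Equiv.swap 0 1 ∨
        π = Equiv.swap 0 1 * Equiv.swap 0 2 * Equiv.swap 0 1 := by decide
    have e1 : F (Equiv.swap 0 1) ∈ H := h1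
    have e2 : F (Equiv.swap 0 2) ∈ H := h2
    intro π
    change F π ∈ H
    rcases key π with rfl | rfl | rfl | rfl | rfl | rfl
    · rw [map_one]; exact H.one_mem
    · exact e1
    · exact e2
    · rw [map_mul]; exact H.mul_mem e1 e2
    · rw [map_mul]; exact H.mul_mem e2 e1
    · rw [map_mul, map_mul]; exact H.mul_mem (H.mul_mem e1 e2) e1
  have hS3' : ∀ π : Equiv.Perm (Fin 3),
      (SemidirectProduct.inl (Pi.mulSingle (0 : Fin 2) π) : S2S3S3) ∈ H := fun π => by
    have h := H.mul_mem (H.mul_mem hs (hS3 π)) (H.inv_mem hs)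
    rw [← map_inv, ← SemidirectProduct.inl_aut] at h
    convert h using 2
    funext i
    change _ = (Pi.mulSingle (1 : Fin 2) π : Fin 2 → Equiv.Perm (Fin 3)) ((Equiv.swap 0 1)⁻¹ i)
    fin_cases i <;> simp
  rw [eq_top_iff]
  rintro ⟨f, g⟩ -
  rw [SemidirectProduct.mk_eq_inl_mul_inr]
  refine H.mul_mem ?_ ?_
  · have : f = Pi.mulSingle 0 (f 0) * Pi.mulSingle 1 (f 1) := by
      funext i
      fin_cases i <;> simp
    rw [this, map_mul]
    exact H.mul_mem (hS3' _) (hS3 _)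
  · have hg : ∀ g : Equiv.Perm (Fin 2), g = 1 ∨ g = Equiv.swap 0 1 := by decide
    rcases hg g with rfl | rfl
    · rw [map_one]; exact H.one_mem
    · exact hs

/-- Affine transformations as permutations. -/
def symPerm : symGroup →* Equiv.Perm (Fin 5 → ℂ) where
  toFun σ := σ.1.toEquiv
  map_one' := rfl
  map_mul' _ _ := rfl

theorem symPerm_injective : Function.Injective symPerm := fun _ _ h =>
  Subtype.ext (AffineEquiv.toEquiv_injective h)

theorem symPerm_gen (ν : SingPt) (i : Fin 3) : symPerm (gen ν i) = actPerm (genElt ν i) := by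
  ext1 a
  exact (act_genElt ν i a).symm

/-- Both faithful actions have the same image in the permutations of `ℂ⁵`: all six involutions come
from `S2S3S3`, and three of them already generate that group. The isomorphism `symEquiv` is read off
from this. -/
theorem range_symPerm : symPerm.range = actPerm.range := by
  apply le_antisymm
  · rintro _ ⟨⟨σ, hσ⟩, rfl⟩
    induction hσ using Subgroup.closure_induction with
    | mem σ h =>
      obtain ⟨ν, i, rfl⟩ := h
      exact ⟨genElt ν i, (symPerm_gen ν i).symm⟩
    | one => exact one_mem _
    | mul x y hx hy h1 h2 => exact mul_mem h1 h2
    | inv x hx h1 => exact inv_mem h1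
  · rw [MonoidHom.range_eq_map, ← closure_gen_eq_top, Subgroup.map_le_iff_le_comap,
      Subgroup.closure_le]
    rintro x (rfl | rfl | rfl)
    · exact ⟨_, symPerm_gen _ _⟩
    · exact ⟨_, symPerm_gen _ _⟩
    · exact ⟨_, symPerm_gen _ _⟩

/-- The isomorphism of the symmetry group with `S₂ ⋉ (S₃ × S₃)`. -/
def symEquiv : symGroup ≃* S2S3S3 :=
  (MonoidHom.ofInjective symPerm_injective).trans
    ((MulEquiv.subgroupCongr range_symPerm).trans (MonoidHom.ofInjective actPerm_injective).symm)

theorem actPerm_symEquiv (σ : symGroup) : actPerm (symEquiv σ) = symPerm σ := by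
  have := MonoidHom.apply_ofInjective_symm actPerm_injective
    (MulEquiv.subgroupCongr range_symPerm (MonoidHom.ofInjective symPerm_injective σ))
  exact this

theorem symEquiv_gen (ν : SingPt) (i : Fin 3) : symEquiv (gen ν i) = genElt ν i :=
  actPerm_injective (by rw [actPerm_symEquiv, symPerm_gen])

theorem symGroup_apply (σ : symGroup) (a : Fin 5 → ℂ) : σ.1 a = act 1 (symEquiv σ) a := by
  rw [← actPerm_apply, actPerm_symEquiv]
  rfl

theorem symGroup_linear_intVec (σ : symGroup) (p : Fin 5 → ℤ) :
    σ.1.linear (intVec ℂ p) = intVec ℂ (act 0 (symEquiv σ) p) := by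
  have h1 := σ.1.map_vadd 0 (intVec ℂ p)
  rw [symGroup_apply, symGroup_apply, vadd_eq_add, vadd_eq_add, add_comm, act_add,
    act_zero_intVec, add_comm] at h1
  exact (add_right_cancel h1).symm

theorem card_symGroup : Nat.card symGroup = 72 := by
  rw [Nat.card_congr symEquiv.toEquiv, Nat.card_congr SemidirectProduct.equivProd, Nat.card_prod,
    Nat.card_fun, Nat.card_perm, Nat.card_perm]
  simp [Nat.factorial]

/-! ### Symmetries of the contiguity relations -/

/-- The factor `1` or `e^{iπ s(a)}`, according to the sign. -/
def tw (χ : ℤˣ) (a : Fin 5 → ℂ) : ℂ :=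
  if χ = 1 then 1 else Complex.exp (Complex.I * Real.pi * saal a)

theorem tw_one (a : Fin 5 → ℂ) : tw 1 a = 1 := if_pos rfl

theorem tw_neg_one (a : Fin 5 → ℂ) : tw (-1) a = Complex.exp (Complex.I * Real.pi * saal a) :=
  if_neg (by decide)

theorem tw_ne_zero (χ : ℤˣ) (a : Fin 5 → ℂ) : tw χ a ≠ 0 := by
  unfold tw
  split_ifs
  · exact one_ne_zero
  · exact Complex.exp_ne_zero _

theorem tw_add_intVec (χ : ℤˣ) (a : Fin 5 → ℂ) (p : Fin 5 → ℤ) :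
    tw χ (a + intVec ℂ p) = tw χ a * (((χ ^ saal p : ℤˣ) : ℤ) : ℂ) := by
  rcases Int.units_eq_one_or χ with rfl | rfl
  · simp [tw_one]
  · rw [tw_neg_one, tw_neg_one, saal_add, saal_intVec, mul_add, Complex.exp_add,
      show Complex.I * Real.pi * (saal p : ℤ) = (saal p : ℤ) * (Real.pi * Complex.I) by ring,
      Complex.exp_int_mul, Complex.exp_pi_mul_I]
    congr 1
    rcases Int.even_or_odd (saal p) with h | h
    · rw [h.neg_one_zpow, h.neg_one_zpow]; simp
    · rw [h.neg_one_zpow, h.neg_one_zpow]; simp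

theorem tw_act (χ : ℤˣ) (x : S2S3S3) (a : Fin 5 → ℂ) : tw χ (act 1 x a) = tw χ a := by
  unfold tw
  rw [saal_act]

theorem act_add_intVec (x : S2S3S3) (a : Fin 5 → ℂ) (p : Fin 5 → ℤ) :
    act 1 x (a + intVec ℂ p) = act 1 x a + intVec ℂ (act 0 x p) := by
  rw [act_add, act_zero_intVec]

theorem tendsto_act (x : S2S3S3) : Tendsto (act 1 x) farGeneric farGeneric :=
  tendsto_farGeneric_of 0 (fun _ ha => ha.act x) fun a => by rw [saal_act, add_zero]

theorem Contig.mul_periodic {h c : (Fin 5 → ℂ) → ℂ} (hh : Contig h)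
    (hc : ∀ a p, c (a + intVec ℂ p) = c a) : Contig fun a => c a * h a := by
  filter_upwards [hh] with a ha i
  rw [hc, ← intVec_one, hc, intVec_one, ha i]
  ring

/-- Two nontrivial twists multiply to `e^{2πi s}`, which is invariant under integer shifts and can
be divided out. -/
theorem Contig.tw_mul {h : (Fin 5 → ℂ) → ℂ} {χ χ' : ℤˣ}
    (hh : Contig fun a => tw χ a * (tw χ' a * h a)) : Contig fun a => tw (χ' * χ) a * h a := by
  rcases Int.units_eq_one_or χ with rfl | rfl
  · simpa [tw_one] using hh
  · rcases Int.units_eq_one_or χ' with rfl | rfl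
    · simpa [tw_one] using hh
    · have := hh.mul_periodic (c := fun a => (tw (-1) a * tw (-1) a)⁻¹) fun a p => by
        have h1 : (((-1 : ℤˣ) ^ saal p : ℤˣ) : ℤ) * (((-1 : ℤˣ) ^ saal p : ℤˣ) : ℤ) = 1 := by
          rw [← Units.val_mul, Int.units_mul_self, Units.val_one]
        have h2 : ((((-1 : ℤˣ) ^ saal p : ℤˣ) : ℤ) : ℂ) * (((-1 : ℤˣ) ^ saal p : ℤˣ) : ℤ) = 1 := by
          exact_mod_cast h1
        rw [tw_add_intVec]
        congr 1
        linear_combination (tw (-1) a * tw (-1) a) * h2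
      convert this using 2 with a
      have := tw_ne_zero (-1) a
      rw [show (-1 : ℤˣ) * -1 = 1 by decide, tw_one]
      field_simp

/-- The linear part exchanges the neighbours `1` and `nb 3` and fixes the other four. Subtracting
relation `3` at the image point from the others makes `nb 3` the new reference neighbour, and the
weight differences come out as the old weights. -/
theorem Contig.comp_zero_one {h : (Fin 5 → ℂ) → ℂ} (hh : Contig h) :
    Contig fun a => h (act 1 (genElt .zero 1) a) := by
  filter_upwards [(tendsto_act (genElt .zero 1)).eventually hh] with a H i
  rw [← intVec_one] at H ⊢
  simp only [act_add_intVec]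
  obtain ⟨B, hB⟩ : ∃ B, B = act 1 (genElt .zero 1) a := ⟨_, rfl⟩
  have hB' := hB.trans (act_genElt .zero 1 a)
  rw [← hB] at H ⊢
  have H3 := H 3
  have Hi := H i
  rw [show act 0 (genElt .zero 1) 1 = nb 3 by decide]
  have b0 : B 0 = a 0 + 1 - a 3 := by rw [hB']; rfl
  have b1 : B 1 = a 1 + 1 - a 3 := by rw [hB']; rfl
  have b2 : B 2 = a 2 + 1 - a 3 := by rw [hB']; rfl
  have b3 : B 3 = 2 - a 3 := by rw [hB']; rfl
  have b4 : B 4 = a 4 + 1 - a 3 := by rw [hB']; rfl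
  have w : ∀ c : Fin 5 → ℂ, wt c 0 = c 0 ∧ wt c 1 = c 1 ∧ wt c 2 = c 2 ∧ wt c 3 = c 3 - 1 ∧
    wt c 4 = c 4 - 1 := fun c => ⟨rfl, rfl, rfl, rfl, rfl⟩
  obtain ⟨w0, w1, w2, w3, w4⟩ := w a
  obtain ⟨v0, v1, v2, v3, v4⟩ := w B
  rw [v3, b3] at H3
  fin_cases i
  · change h (B + intVec ℂ (act 0 (genElt .zero 1) (nb 0))) = wt a 0 * h B + _
    change h (B + intVec ℂ (nb 0)) = wt B 0 * h B + _ at Hi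
    rw [v0, b0] at Hi
    rw [w0, show act 0 (genElt .zero 1) (nb 0) = nb 0 by decide]
    linear_combination Hi - H3
  · change h (B + intVec ℂ (act 0 (genElt .zero 1) (nb 1))) = wt a 1 * h B + _
    change h (B + intVec ℂ (nb 1)) = wt B 1 * h B + _ at Hi
    rw [v1, b1] at Hi
    rw [w1, show act 0 (genElt .zero 1) (nb 1) = nb 1 by decide]
    linear_combination Hi - H3
  · change h (B + intVec ℂ (act 0 (genElt .zero 1) (nb 2))) = wt a 2 * h B + _
    change h (B + intVec ℂ (nb 2)) = wt B 2 * h B + _ at Hi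
    rw [v2, b2] at Hi
    rw [w2, show act 0 (genElt .zero 1) (nb 2) = nb 2 by decide]
    linear_combination Hi - H3
  · change h (B + intVec ℂ (act 0 (genElt .zero 1) (nb 3))) = wt a 3 * h B + _
    rw [w3, show act 0 (genElt .zero 1) (nb 3) = 1 by decide]
    linear_combination -H3
  · change h (B + intVec ℂ (act 0 (genElt .zero 1) (nb 4))) = wt a 4 * h B + _
    change h (B + intVec ℂ (nb 4)) = wt B 4 * h B + _ at Hi
    rw [v4, b4] at Hi
    rw [w4, show act 0 (genElt .zero 1) (nb 4) = nb 4 by decide]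
    linear_combination Hi - H3

theorem Contig.comp_zero_two {h : (Fin 5 → ℂ) → ℂ} (hh : Contig h) :
    Contig fun a => h (act 1 (genElt .zero 2) a) := by
  filter_upwards [(tendsto_act (genElt .zero 2)).eventually hh] with a H i
  rw [← intVec_one] at H ⊢
  simp only [act_add_intVec]
  obtain ⟨B, hB⟩ : ∃ B, B = act 1 (genElt .zero 2) a := ⟨_, rfl⟩
  have hB' := hB.trans (act_genElt .zero 2 a)
  rw [← hB] at H ⊢
  have H4 := H 4
  have Hi := H i
  rw [show act 0 (genElt .zero 2) 1 = nb 4 by decide]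
  have b0 : B 0 = a 0 + 1 - a 4 := by rw [hB']; rfl
  have b1 : B 1 = a 1 + 1 - a 4 := by rw [hB']; rfl
  have b2 : B 2 = a 2 + 1 - a 4 := by rw [hB']; rfl
  have b3 : B 3 = a 3 + 1 - a 4 := by rw [hB']; rfl
  have b4 : B 4 = 2 - a 4 := by rw [hB']; rfl
  have w : ∀ c : Fin 5 → ℂ, wt c 0 = c 0 ∧ wt c 1 = c 1 ∧ wt c 2 = c 2 ∧ wt c 3 = c 3 - 1 ∧
    wt c 4 = c 4 - 1 := fun c => ⟨rfl, rfl, rfl, rfl, rfl⟩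
  obtain ⟨w0, w1, w2, w3, w4⟩ := w a
  obtain ⟨v0, v1, v2, v3, v4⟩ := w B
  rw [v4, b4] at H4
  fin_cases i
  · change h (B + intVec ℂ (act 0 (genElt .zero 2) (nb 0))) = wt a 0 * h B + _
    change h (B + intVec ℂ (nb 0)) = wt B 0 * h B + _ at Hi
    rw [v0, b0] at Hi
    rw [w0, show act 0 (genElt .zero 2) (nb 0) = nb 0 by decide]
    linear_combination Hi - H4
  · change h (B + intVec ℂ (act 0 (genElt .zero 2) (nb 1))) = wt a 1 * h B + _
    change h (B + intVec ℂ (nb 1)) = wt B 1 * h B + _ at Hi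
    rw [v1, b1] at Hi
    rw [w1, show act 0 (genElt .zero 2) (nb 1) = nb 1 by decide]
    linear_combination Hi - H4
  · change h (B + intVec ℂ (act 0 (genElt .zero 2) (nb 2))) = wt a 2 * h B + _
    change h (B + intVec ℂ (nb 2)) = wt B 2 * h B + _ at Hi
    rw [v2, b2] at Hi
    rw [w2, show act 0 (genElt .zero 2) (nb 2) = nb 2 by decide]
    linear_combination Hi - H4
  · change h (B + intVec ℂ (act 0 (genElt .zero 2) (nb 3))) = wt a 3 * h B + _
    change h (B + intVec ℂ (nb 3)) = wt B 3 * h B + _ at Hi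
    rw [v3, b3] at Hi
    rw [w3, show act 0 (genElt .zero 2) (nb 3) = nb 3 by decide]
    linear_combination Hi - H4
  · change h (B + intVec ℂ (act 0 (genElt .zero 2) (nb 4))) = wt a 4 * h B + _
    rw [w4, show act 0 (genElt .zero 2) (nb 4) = 1 by decide]
    linear_combination -H4

/-- The linear part exchanges `1` with `nb 0`, `nb 1` with `nb 3` and `nb 2` with `nb 4`, while
weight differences change sign. The factor `e^{iπ s}` changes sign at every neighbour and
compensates. -/
theorem Contig.comp_infty_zero {h : (Fin 5 → ℂ) → ℂ} (hh : Contig h) :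
    Contig fun a => tw (-1) a * h (act 1 (genElt .infty 0) a) := by
  filter_upwards [(tendsto_act (genElt .infty 0)).eventually hh] with a H i
  rw [← intVec_one] at H ⊢
  have hs : ∀ i, ((((-1 : ℤˣ) ^ saal (nb i) : ℤˣ) : ℤ) : ℂ) = -1 := fun i => by
    have : ∀ i, saal (nb i) = -1 := by decide
    rw [this]
    simp
  have hs1 : ((((-1 : ℤˣ) ^ saal (1 : Fin 5 → ℤ) : ℤˣ) : ℤ) : ℂ) = -1 := by
    rw [show saal (1 : Fin 5 → ℤ) = -1 by decide]
    simp
  simp only [act_add_intVec, tw_add_intVec, hs, hs1]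
  obtain ⟨B, hB⟩ : ∃ B, B = act 1 (genElt .infty 0) a := ⟨_, rfl⟩
  have hB' := hB.trans (act_genElt .infty 0 a)
  rw [← hB] at H ⊢
  rw [show act 0 (genElt .infty 0) 1 = nb 0 by decide]
  have b0 : B 0 = a 0 := by rw [hB']; rfl
  have b1 : B 1 = a 0 + 1 - a 3 := by rw [hB']; rfl
  have b2 : B 2 = a 0 + 1 - a 4 := by rw [hB']; rfl
  have b3 : B 3 = a 0 + 1 - a 1 := by rw [hB']; rfl
  have b4 : B 4 = a 0 + 1 - a 2 := by rw [hB']; rfl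
  have w : ∀ c : Fin 5 → ℂ, wt c 0 = c 0 ∧ wt c 1 = c 1 ∧ wt c 2 = c 2 ∧ wt c 3 = c 3 - 1 ∧
    wt c 4 = c 4 - 1 := fun c => ⟨rfl, rfl, rfl, rfl, rfl⟩
  obtain ⟨w0, w1, w2, w3, w4⟩ := w a
  obtain ⟨v0, v1, v2, v3, v4⟩ := w B
  have H0 := H 0
  have H1 := H 1
  have H2 := H 2
  have H3 := H 3
  have H4 := H 4
  rw [v0, b0] at H0
  rw [v1, b1] at H1
  rw [v2, b2] at H2
  rw [v3, b3] at H3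
  rw [v4, b4] at H4
  generalize tw (-1) a = t
  fin_cases i
  · change _ * h (B + intVec ℂ (act 0 (genElt .infty 0) (nb 0))) = wt a 0 * _ + _
    rw [w0, show act 0 (genElt .infty 0) (nb 0) = 1 by decide]
    linear_combination t * H0
  · change _ * h (B + intVec ℂ (act 0 (genElt .infty 0) (nb 1))) = wt a 1 * _ + _
    rw [w1, show act 0 (genElt .infty 0) (nb 1) = nb 3 by decide]
    linear_combination t * (H0 - H3)
  · change _ * h (B + intVec ℂ (act 0 (genElt .infty 0) (nb 2))) = wt a 2 * _ + _
    rw [w2, show act 0 (genElt .infty 0) (nb 2) = nb 4 by decide]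
    linear_combination t * (H0 - H4)
  · change _ * h (B + intVec ℂ (act 0 (genElt .infty 0) (nb 3))) = wt a 3 * _ + _
    rw [w3, show act 0 (genElt .infty 0) (nb 3) = nb 1 by decide]
    linear_combination t * (H0 - H1)
  · change _ * h (B + intVec ℂ (act 0 (genElt .infty 0) (nb 4))) = wt a 4 * _ + _
    rw [w4, show act 0 (genElt .infty 0) (nb 4) = nb 2 by decide]
    linear_combination t * (H0 - H2)

theorem Contig.comp_act (x : S2S3S3) : ∀ {h : (Fin 5 → ℂ) → ℂ}, Contig h →
    Contig fun a => tw (Equiv.Perm.sign x.right) a * h (act 1 x a) := by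
  have hone : ∀ {h : (Fin 5 → ℂ) → ℂ}, Contig h →
      Contig fun a => tw (Equiv.Perm.sign (1 : S2S3S3).right) a * h (act 1 1 a) := by
    intro h hh
    simpa [tw_one, act_one] using hh
  have hmul : ∀ x y : S2S3S3, (∀ {h : (Fin 5 → ℂ) → ℂ}, Contig h →
      Contig fun a => tw (Equiv.Perm.sign x.right) a * h (act 1 x a)) →
      (∀ {h : (Fin 5 → ℂ) → ℂ}, Contig h →
      Contig fun a => tw (Equiv.Perm.sign y.right) a * h (act 1 y a)) →
      ∀ {h : (Fin 5 → ℂ) → ℂ}, Contig h →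
      Contig fun a => tw (Equiv.Perm.sign (x * y).right) a * h (act 1 (x * y) a) := by
    intro x y hx hy h hh
    have := hy (hx hh)
    simp only [tw_act, ← act_mul] at this
    rw [SemidirectProduct.mul_right, Equiv.Perm.sign_mul]
    exact this.tw_mul
  have hx : x ∈ Subgroup.closure {genElt .infty 0, genElt .zero 1, genElt .zero 2} := by
    rw [closure_gen_eq_top]
    trivial
  induction hx using Subgroup.closure_induction with
  | mem x hx =>
    rcases hx with rfl | rfl | rfl
    · intro h hh
      have : Equiv.Perm.sign (genElt .infty 0).right = -1 := by decide
      rw [this]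
      exact hh.comp_infty_zero
    · intro h hh
      have : Equiv.Perm.sign (genElt .zero 1).right = 1 := by decide
      simpa [this, tw_one] using hh.comp_zero_one
    · intro h hh
      have : Equiv.Perm.sign (genElt .zero 2).right = 1 := by decide
      simpa [this, tw_one] using hh.comp_zero_two
  | one => exact hone
  | mul x y _ _ hx hy => exact hmul x y hx hy
  | inv x _ hx =>
    have hpow : ∀ n : ℕ, ∀ {h : (Fin 5 → ℂ) → ℂ}, Contig h →
        Contig fun a => tw (Equiv.Perm.sign (x ^ n).right) a * h (act 1 (x ^ n) a) := by
      intro n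
      induction n with
      | zero => exact hone
      | succ n ih => rw [pow_succ]; exact hmul _ _ ih hx
    have : Finite S2S3S3 := Finite.of_equiv _ SemidirectProduct.equivProd.symm
    -- In a finite group an inverse is a power, so the product case suffices.
    obtain ⟨n, hn⟩ : x⁻¹ ∈ Submonoid.powers x :=
      mem_powers_iff_mem_zpowers.2 (Subgroup.inv_mem _ (Subgroup.mem_zpowers x))
    have hn' : x ^ n = x⁻¹ := hn
    rw [← hn']
    intro h hh
    exact hpow n hh

/-! ### Linear independence -/

/-- All terms are nonnegative: at an integer `b 3` the factor `1/Γ(b₃+k)` vanishes while `b₃ + k ≤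
0` and is positive afterwards. -/
theorem regSum_ne_zero {b : Fin 5 → ℝ} {m : ℤ} (h0 : 0 < b 0) (h1 : 0 < b 1) (h2 : 0 < b 2)
    (h3 : b 3 = m) (h4 : 0 < b 4) (hs : 0 < (saal fun j => (b j : ℂ)).re) :
    regSum (fun j => (b j : ℂ)) ≠ 0 := by
  obtain ⟨r, hr⟩ : ∃ r : ℕ → ℝ, r = fun k =>
      ((∏ j ∈ Finset.range k, (b 0 + j)) * (∏ j ∈ Finset.range k, (b 1 + j)) *
      (∏ j ∈ Finset.range k, (b 2 + j))) *
      ((Real.Gamma (1 + k))⁻¹ * (Real.Gamma (b 3 + k))⁻¹ * (Real.Gamma (b 4 + k))⁻¹) := ⟨_, rfl⟩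
  have hreg : regTerm (fun j => (b j : ℂ)) = fun k => (r k : ℂ) := by
    funext k
    simp only [regTerm, hr]
    push_cast
    simp only [← Complex.Gamma_ofReal]
    push_cast
    rfl
  have hprod : ∀ x : ℝ, 0 < x → ∀ k : ℕ, 0 < ∏ j ∈ Finset.range k, (x + j) := fun x hx k =>
    Finset.prod_pos fun j _ => by positivity
  have hG : ∀ k : ℕ, 0 ≤ (Real.Gamma (b 3 + k))⁻¹ := fun k => by
    rw [inv_nonneg, h3]
    rcases le_or_gt (m + k) 0 with h | h
    · obtain ⟨n, hn⟩ := Int.exists_eq_neg_ofNat h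
      rw [show (m : ℝ) + k = -(n : ℝ) by exact_mod_cast hn, Real.Gamma_neg_nat_eq_zero]
    · have h' : (0 : ℝ) < m + k := by exact_mod_cast h
      exact (Real.Gamma_pos_of_pos h').le
  have hnn : ∀ k, 0 ≤ r k := fun k => by
    have e1 := hprod _ h0 k
    have e2 := hprod _ h1 k
    have e3 := hprod _ h2 k
    have e4 : 0 < Real.Gamma (1 + k) := Real.Gamma_pos_of_pos (by positivity)
    have e5 : 0 < Real.Gamma (b 4 + k) := Real.Gamma_pos_of_pos (by positivity)
    have e6 := hG k
    simp only [hr]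
    positivity
  -- An index large enough that `m + k` is positive.
  have hpos : 0 < r (m.natAbs + 1) := by
    have e1 := hprod _ h0 (m.natAbs + 1)
    have e2 := hprod _ h1 (m.natAbs + 1)
    have e3 := hprod _ h2 (m.natAbs + 1)
    have e4 : 0 < Real.Gamma (1 + (m.natAbs + 1 : ℕ)) := Real.Gamma_pos_of_pos (by positivity)
    have e5 : 0 < Real.Gamma (b 4 + (m.natAbs + 1 : ℕ)) := Real.Gamma_pos_of_pos (by positivity)
    have e6 : 0 < Real.Gamma (b 3 + (m.natAbs + 1 : ℕ)) := by
      rw [h3]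
      have h1 : 0 < m + ((m.natAbs + 1 : ℕ) : ℤ) := by omega
      have h2 : (0 : ℝ) < ((m + ((m.natAbs + 1 : ℕ) : ℤ) : ℤ) : ℝ) := Int.cast_pos.2 h1
      rw [Int.cast_add, Int.cast_natCast] at h2
      exact Real.Gamma_pos_of_pos h2
    simp only [hr]
    positivity
  have hsum : Summable r := by
    have := summable_norm_regTerm hs
    rw [hreg] at this
    simp only [Complex.norm_real] at this
    exact this.of_norm
  rw [regSum, hreg, ← Complex.ofReal_tsum]
  exact Complex.ofReal_ne_zero.2 (hsum.tsum_pos hnn _ hpos).ne'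

theorem regSum_of_zero {a : Fin 5 → ℂ} (h : a 0 = 0) :
    regSum a = (Complex.Gamma (a 3))⁻¹ * (Complex.Gamma (a 4))⁻¹ := by
  rw [regSum, tsum_eq_single 0]
  · simp [regTerm]
  · intro k hk
    have : ∏ j ∈ Finset.range k, (a 0 + j) = 0 :=
      Finset.prod_eq_zero (Finset.mem_range.2 (Nat.pos_of_ne_zero hk)) (by simp [h])
    simp [regTerm, this]

theorem intVec_re (p : Fin 5 → ℤ) : (saal (intVec ℂ p)).re = (saal p : ℤ) := by
  rw [saal_intVec]
  simp

/-! ### Descent on the power of `a₀` -/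

/-- The relation underlying the independence argument. -/
def RegRel (M : ℝ) (p : Fin 5 → ℤ) (A B : MvPolynomial (Fin 5) ℂ) : Prop :=
  ∀ a : Fin 5 → ℂ, M < (saal a).re → MvPolynomial.eval a A * regSum a +
    a 0 * MvPolynomial.eval a B * regSum (a + intVec ℂ p) = 0

theorem continuousAt_eval (P : MvPolynomial (Fin 5) ℂ) (a : Fin 5 → ℂ) :
    ContinuousAt (fun x => MvPolynomial.eval x P) a :=
  (MvPolynomial.continuous_eval P).continuousAt

theorem continuousAt_regSum_add {a : Fin 5 → ℂ} {p : Fin 5 → ℤ}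
    (h : 0 < (saal (a + intVec ℂ p)).re) :
    ContinuousAt (fun x => regSum (x + intVec ℂ p)) a :=
  ContinuousAt.comp (g := regSum) (f := fun x => x + intVec ℂ p) (continuousAt_regSum h)
    (by fun_prop)

/-- On `a₀ = 0` the second summand vanishes through its factor `a₀`, and the first series equals
`1/(Γ(a₃)Γ(a₄))`, which is nonzero at generic `a₃, a₄`. -/
theorem RegRel.X_dvd_left {M : ℝ} {p : Fin 5 → ℤ} {A B : MvPolynomial (Fin 5) ℂ}
    (h : RegRel M p A B) : MvPolynomial.X 0 ∣ A := by
  let Q : Fin 5 → MvPolynomial (Fin 5) ℂ := fun j => if j = 0 then 0 else MvPolynomial.X j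
  have hQ : ∀ x : Fin 5 → ℂ, (fun j => MvPolynomial.eval x (Q j)) = fun j =>
      if j = 0 then 0 else x j := fun x => by
    funext j
    by_cases hj : j = 0 <;> simp [Q, hj]
  have h0 : MvPolynomial.bind₁ Q A = 0 := by
    refine eq_zero_of_generic_eq_zero
      (U := {x | M < (saal (fun j => if j = 0 then 0 else x j : Fin 5 → ℂ)).re}) ?_ ?_ ?_
    · refine isOpen_lt continuous_const (continuous_saal_re.comp (continuous_pi fun j => ?_))
      by_cases hj : j = 0 <;> simp only [hj, if_true, if_false] <;> fun_prop
    · exact ⟨fun j => if j = 3 then ((M + 1 : ℝ) : ℂ) else 0, by simp [saal]⟩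
    · intro x hx hg
      rw [eval_bind₁, hQ]
      have h1 := h _ hx
      rw [regSum_of_zero (by simp)] at h1
      have h3 : Complex.Gamma (x 3) ≠ 0 := Complex.Gamma_ne_zero fun m hm =>
        hg.1 3 (-m) (by push_cast; exact hm)
      have h4 : Complex.Gamma (x 4) ≠ 0 := Complex.Gamma_ne_zero fun m hm =>
        hg.1 4 (-m) (by push_cast; exact hm)
      simpa [h3, h4] using h1
  refine X_dvd_of_eval_eq_zero fun a ha => ?_
  have h1 := congrArg (MvPolynomial.eval a) h0
  rw [eval_bind₁, hQ, map_zero] at h1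
  convert h1 using 3
  funext j
  by_cases hj : j = 0 <;> simp [hj, ha]

/-- The factor `a₀` cancels at generic points; continuity of both series extends the result to `a₀ =
0`. -/
theorem RegRel.div_X {M : ℝ} {p : Fin 5 → ℤ} (hM : 0 ≤ M) (hMp : 0 ≤ M + (saal p : ℤ))
    {A B : MvPolynomial (Fin 5) ℂ} (h : RegRel M p (MvPolynomial.X 0 * A) B) {a : Fin 5 → ℂ}
    (ha : M < (saal a).re) :
    MvPolynomial.eval a A * regSum a + MvPolynomial.eval a B * regSum (a + intVec ℂ p) = 0 := by
  have hp : 0 < (saal (a + intVec ℂ p)).re := by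
    rw [saal_add, Complex.add_re, intVec_re]
    linarith
  refine eq_zero_of_continuousAt (g := fun a => MvPolynomial.eval a A * regSum a +
    MvPolynomial.eval a B * regSum (a + intVec ℂ p)) (a := a) (P := 1) ?_ one_ne_zero ?_
  · exact ((continuousAt_eval A a).mul (continuousAt_regSum (by linarith))).add
      ((continuousAt_eval B a).mul (continuousAt_regSum_add hp))
  · filter_upwards [(isOpen_lt_saal M).mem_nhds ha] with x hx hg _
    have h1 := h x hx
    have h2 : x 0 ≠ 0 := by simpa using hg.1 0 0
    rw [map_mul, MvPolynomial.eval_X] at h1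
    refine (mul_eq_zero.1 ?_).resolve_left h2
    linear_combination h1

/-- After division by `a₀`, restrict to `a₀ = 0`, `a₃ = -n`. The first series vanishes there, while
the second has leading parameter `p₀ > 0` and is positive at suitable real points. So `B` vanishes
on infinitely many slices of `a₀ = 0`, hence on all of it. -/
theorem RegRel.X_dvd_right {M : ℝ} {p : Fin 5 → ℤ} (hp0 : 1 ≤ p 0) (hM : 0 ≤ M)
    (hMp : 0 ≤ M + (saal p : ℤ)) {A B : MvPolynomial (Fin 5) ℂ}
    (h : RegRel M p (MvPolynomial.X 0 * A) B) : MvPolynomial.X 0 ∣ B := by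
  have key : ∀ n : ℕ, ∀ x : Fin 5 → ℂ, x 0 = 0 → x 3 = -n → MvPolynomial.eval x B = 0 := by
    intro n
    let Q : Fin 5 → MvPolynomial (Fin 5) ℂ := fun j =>
      if j = 0 then 0 else if j = 3 then MvPolynomial.C (-n) else MvPolynomial.X j
    have hQ : ∀ x : Fin 5 → ℂ, (fun j => MvPolynomial.eval x (Q j)) = fun j =>
        if j = 0 then 0 else if j = 3 then -(n : ℂ) else x j := fun x => by
      funext j
      by_cases hj : j = 0
      · simp [Q, hj]
      · by_cases hj' : j = 3 <;> simp [Q, hj, hj']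
    -- Values of `x₁, x₂, x₄` above `c` stay positive after the shift by `p`. The larger lower bound
    -- imposed on `x₄` below also forces `Re s > M`.
    obtain ⟨c, hc⟩ : ∃ c : ℝ, c = |(p 1 : ℝ)| + |(p 2 : ℝ)| + |(p 4 : ℝ)| + 1 := ⟨_, rfl⟩
    have hc1 : -(p 1 : ℝ) < c := by
      linarith [neg_abs_le (p 1 : ℝ), abs_nonneg (p 2 : ℝ), abs_nonneg (p 4 : ℝ)]
    have hc2 : -(p 2 : ℝ) < c := by
      linarith [neg_abs_le (p 2 : ℝ), abs_nonneg (p 1 : ℝ), abs_nonneg (p 4 : ℝ)]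
    have hc4 : -(p 4 : ℝ) < c := by
      linarith [neg_abs_le (p 4 : ℝ), abs_nonneg (p 1 : ℝ), abs_nonneg (p 2 : ℝ)]
    have hc0 : 0 < c := by rw [hc]; positivity
    have h0 : MvPolynomial.bind₁ Q B = 0 := by
      refine MvPolynomial.funext_set (fun j => if j = 4 then
        ((↑) : ℝ → ℂ) '' Set.Ioi (c + M + n + 2 * (c + 1)) else
        ((↑) : ℝ → ℂ) '' Set.Ioo c (c + 1)) (fun j => ?_) fun x hx => ?_
      · split_ifs
        · exact (Set.Ioi_infinite _).image Complex.ofReal_injective.injOn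
        · exact (Set.Ioo_infinite (by linarith)).image Complex.ofReal_injective.injOn
      · rw [eval_bind₁, hQ, map_zero]
        obtain ⟨x1, hx1, e1⟩ := hx 1 trivial
        obtain ⟨x2, hx2, e2⟩ := hx 2 trivial
        obtain ⟨x4, hx4, e4⟩ := hx 4 trivial
        simp only [Set.mem_Ioo, Set.mem_Ioi] at hx1 hx2 hx4
        set y : Fin 5 → ℂ := fun j => if j = 0 then 0 else if j = 3 then -n else x j with hy
        have hy' : y = fun j => ((![0, x1, x2, -n, x4] j : ℝ) : ℂ) := by
          funext j
          fin_cases j <;> simp [hy, e1, e2, e4]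
        have hyp : y + intVec ℂ p =
            fun j => ((![(p 0 : ℝ), x1 + p 1, x2 + p 2, -n + p 3, x4 + p 4] j : ℝ) : ℂ) := by
          rw [hy']
          funext j
          fin_cases j <;> simp [intVec]
        have hsy : (saal y).re = -n + x4 - x1 - x2 := by
          rw [hy']
          simp [saal]
        have hMy : M < (saal y).re := by
          rw [hsy]
          linarith
        have h1 := h.div_X hM hMp hMy
        have h2 : regSum y = 0 := by
          rw [regSum_of_zero (by simp [hy])]
          have : y 3 = -n := by simp [hy]
          rw [this, Complex.Gamma_neg_nat_eq_zero]
          simp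
        rw [h2, mul_zero, zero_add] at h1
        refine (mul_eq_zero.1 h1).resolve_right ?_
        have hpos : 0 < (saal (y + intVec ℂ p)).re := by
          rw [saal_add, Complex.add_re, intVec_re]
          linarith
        rw [hyp] at hpos ⊢
        refine regSum_ne_zero (m := -n + p 3) ?_ ?_ ?_ ?_ ?_ hpos
        · simp
          omega
        · simp
          linarith [hx1.1]
        · simp
          linarith [hx2.1]
        · simp
        · have hn0 : (0 : ℝ) ≤ n := Nat.cast_nonneg n
          simp
          linarith
    intro x hx0 hx3
    have h1 := congrArg (MvPolynomial.eval x) h0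
    rw [eval_bind₁, hQ, map_zero] at h1
    convert h1 using 3
    funext j
    by_cases hj : j = 0
    · simp [hj, hx0]
    · by_cases hj' : j = 3 <;> simp [hj', hx3, hj]
  let Q : Fin 5 → MvPolynomial (Fin 5) ℂ := fun j => if j = 0 then 0 else MvPolynomial.X j
  have hQ : ∀ x : Fin 5 → ℂ, (fun j => MvPolynomial.eval x (Q j)) = fun j =>
      if j = 0 then 0 else x j := fun x => by
    funext j
    by_cases hj : j = 0 <;> simp [Q, hj]
  have h0 : MvPolynomial.bind₁ Q B = 0 := by
    refine MvPolynomial.funext_set (fun j => if j = 3 then Set.range fun n : ℕ => -(n : ℂ) else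
      Set.univ) (fun j => ?_) fun x hx => ?_
    · split_ifs
      · exact Set.infinite_range_of_injective fun m n hmn => by simpa using hmn
      · exact Set.infinite_univ
    · rw [eval_bind₁, hQ, map_zero]
      obtain ⟨n, hn⟩ := hx 3 trivial
      exact key n _ (by simp) (by simp [← hn])
  refine X_dvd_of_eval_eq_zero fun a ha => ?_
  have h1 := congrArg (MvPolynomial.eval a) h0
  rw [eval_bind₁, hQ, map_zero] at h1
  convert h1 using 3
  funext j
  by_cases hj : j = 0 <;> simp [hj, ha]

theorem eq_zero_of_X_pow_dvd {P : MvPolynomial (Fin 5) ℂ}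
    (h : ∀ n : ℕ, (MvPolynomial.X 0) ^ n ∣ P) : P = 0 := by
  by_contra hP
  have hu : ¬IsUnit (MvPolynomial.X 0 : MvPolynomial (Fin 5) ℂ) := fun hu => by
    have := hu.map (MvPolynomial.eval (0 : Fin 5 → ℂ))
    simp at this
  obtain ⟨n, hn⟩ := FiniteMultiplicity.of_not_isUnit hu hP
  exact hn (h _)

/-- Dividing `A` and `B` by `a₀` gives a relation of the same kind, so the division can be repeated
indefinitely. -/
theorem RegRel.eq_zero {M : ℝ} {p : Fin 5 → ℤ} (hp0 : 1 ≤ p 0) (hM : 0 ≤ M)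
    (hMp : 0 ≤ M + (saal p : ℤ)) {A B : MvPolynomial (Fin 5) ℂ} (h : RegRel M p A B) :
    A = 0 ∧ B = 0 := by
  have key : ∀ n : ℕ, ∀ A B, RegRel M p A B →
      (MvPolynomial.X 0) ^ n ∣ A ∧ (MvPolynomial.X 0) ^ n ∣ B := by
    intro n
    induction n with
    | zero => simp
    | succ n ih =>
      intro A B h
      obtain ⟨A', rfl⟩ := h.X_dvd_left
      obtain ⟨B', rfl⟩ := h.X_dvd_right hp0 hM hMp
      have h' : RegRel M p A' B' := fun a ha => by
        have := h.div_X hM hMp ha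
        rw [map_mul, MvPolynomial.eval_X] at this
        exact this
      obtain ⟨h1, h2⟩ := ih _ _ h'
      rw [pow_succ']
      exact ⟨mul_dvd_mul_left _ h1, mul_dvd_mul_left _ h2⟩
  exact ⟨eq_zero_of_X_pow_dvd fun n => (key n A B h).1,
    eq_zero_of_X_pow_dvd fun n => (key n A B h).2⟩

/-! ### Independence of `f(a)` and `f(a + p)` -/

theorem exists_Gamma_ratio (i : Fin 5) (n : ℤ) : ∃ c d : MvPolynomial (Fin 5) ℂ, c ≠ 0 ∧ d ≠ 0 ∧
    ∀ a : Fin 5 → ℂ, (∀ m : ℤ, a i ≠ m) → MvPolynomial.eval a d * Complex.Gamma (a i + n) =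
      MvPolynomial.eval a c * Complex.Gamma (a i) := by
  have hne : ∀ z : ℂ, (MvPolynomial.X i + MvPolynomial.C z : MvPolynomial (Fin 5) ℂ) ≠ 0 :=
    fun z h => by
      have := congrArg (MvPolynomial.eval fun _ => 1 - z) h
      simp at this
  obtain ⟨k, rfl | rfl⟩ := n.eq_nat_or_neg
  · refine ⟨∏ j ∈ Finset.range k, (MvPolynomial.X i + MvPolynomial.C (j : ℂ)), 1,
      Finset.prod_ne_zero_iff.2 fun j _ => hne _, one_ne_zero, fun a ha => ?_⟩
    have := Gamma_add_natCast (a i) ha k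
    simpa [map_prod] using this
  · refine ⟨1, ∏ j ∈ Finset.range k, (MvPolynomial.X i + MvPolynomial.C (-k + j : ℂ)),
      one_ne_zero, Finset.prod_ne_zero_iff.2 fun j _ => hne _, fun a ha => ?_⟩
    have := Gamma_add_natCast (a i - k) (fun m h => ha (m + k) (by
      push_cast; linear_combination h)) k
    rw [sub_add_cancel] at this
    rw [this]
    simp [map_prod, sub_eq_add_neg, add_assoc]

/-- The factor `a i`, present because `n ≥ 1`, is split off: for `i = 0` it is the factor `a 0` in
`RegRel`. -/
theorem exists_Gamma_add_pos (i : Fin 5) {n : ℤ} (hn : 1 ≤ n) : ∃ c : MvPolynomial (Fin 5) ℂ,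
    c ≠ 0 ∧ ∀ a : Fin 5 → ℂ, (∀ m : ℤ, a i ≠ m) → Complex.Gamma (a i + n) =
      a i * MvPolynomial.eval a c * Complex.Gamma (a i) := by
  have hne : ∀ z : ℂ, (MvPolynomial.X i + MvPolynomial.C z : MvPolynomial (Fin 5) ℂ) ≠ 0 :=
    fun z h => by
      have := congrArg (MvPolynomial.eval fun _ => 1 - z) h
      simp at this
  obtain ⟨k, rfl⟩ : ∃ k : ℕ, n = k + 1 := ⟨(n - 1).toNat, by omega⟩
  refine ⟨∏ j ∈ Finset.range k, (MvPolynomial.X i + MvPolynomial.C ((j + 1 : ℕ) : ℂ)),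
    Finset.prod_ne_zero_iff.2 fun j _ => hne _, fun a ha => ?_⟩
  have := Gamma_add_natCast (a i) ha (k + 1)
  rw [Finset.prod_range_succ'] at this
  push_cast at this ⊢
  rw [this]
  simp [map_prod, mul_comm]

/-- The functions `f(a)` and `f(a + p)` are linearly independent over `ℂ(a)`. -/
def Indep (p : Fin 5 → ℤ) : Prop :=
  ∀ A B : MvPolynomial (Fin 5) ℂ, (∀ᶠ a in farGeneric, MvPolynomial.eval a A * hgf a 1 +
    MvPolynomial.eval a B * hgf (a + intVec ℂ p) 1 = 0) → A = 0 ∧ B = 0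

theorem indep_of_one_le {p : Fin 5 → ℤ} (hp : 1 ≤ p 0) : Indep p := by
  intro A B h
  obtain ⟨c0, hc0, e0⟩ := exists_Gamma_add_pos 0 hp
  obtain ⟨c1, d1, hc1, hd1, e1⟩ := exists_Gamma_ratio 1 (p 1)
  obtain ⟨c2, d2, hc2, hd2, e2⟩ := exists_Gamma_ratio 2 (p 2)
  obtain ⟨M, hM⟩ := eventually_farGeneric.1 h
  set M' := max (max M 0) (-(saal p : ℤ)) with hM'
  have hM0 : 0 ≤ M' := (le_max_right _ _).trans (le_max_left _ _)
  have hMM : M ≤ M' := (le_max_left _ _).trans (le_max_left _ _)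
  have hMp : 0 ≤ M' + (saal p : ℤ) := by
    have : -((saal p : ℤ) : ℝ) ≤ M' := le_max_right _ _
    linarith
  have hrel : RegRel M' p (A * (d1 * d2)) (B * (c0 * c1 * c2)) := by
    intro a ha
    have hp : 0 < (saal (a + intVec ℂ p)).re := by
      rw [saal_add, Complex.add_re, intVec_re]
      linarith
    refine eq_zero_of_continuousAt (g := fun a => MvPolynomial.eval a (A * (d1 * d2)) * regSum a +
      a 0 * MvPolynomial.eval a (B * (c0 * c1 * c2)) * regSum (a + intVec ℂ p)) (a := a) (P := 1)
      ?_ one_ne_zero ?_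
    · exact ((continuousAt_eval _ a).mul (continuousAt_regSum (by linarith))).add
        (((continuous_apply 0).continuousAt.mul (continuousAt_eval _ a)).mul
          (continuousAt_regSum_add hp))
    · filter_upwards [(isOpen_lt_saal M').mem_nhds ha] with x hx hg _
      have h1 := hM x hg (lt_of_le_of_lt hMM hx)
      have hgp := hg.add_intVec p
      rw [hgf_one_eq (hg.1 0) (hg.1 1) (hg.1 2), hgf_one_eq (hgp.1 0) (hgp.1 1) (hgp.1 2)] at h1
      simp only [Pi.add_apply, intVec] at h1
      have f0 := e0 x (hg.1 0)
      have f1 := e1 x (hg.1 1)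
      have f2 := e2 x (hg.1 2)
      have hG : ∀ i, Complex.Gamma (x i) ≠ 0 := fun i => Complex.Gamma_ne_zero fun m hm =>
        hg.1 i (-m) (by push_cast; exact hm)
      refine (mul_eq_zero.1 ?_).resolve_left (mul_ne_zero (mul_ne_zero (hG 0) (hG 1)) (hG 2))
      simp only [map_mul]
      change _ * (_ + _ * _ * regSum fun j => x j + (p j : ℂ)) = 0
      change _ + _ * (_ * regSum fun j => x j + (p j : ℂ)) = 0 at h1
      generalize regSum (fun j => x j + (p j : ℂ)) = S at h1 ⊢
      rw [f0] at h1
      linear_combination (MvPolynomial.eval x d1 * MvPolynomial.eval x d2) * h1 -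
        MvPolynomial.eval x B * (x 0 * MvPolynomial.eval x c0 * Complex.Gamma (x 0)) * S *
        (MvPolynomial.eval x d2 * Complex.Gamma (x 2 + p 2) * f1 +
          MvPolynomial.eval x c1 * Complex.Gamma (x 1) * f2)
  obtain ⟨hA, hB⟩ := hrel.eq_zero hp hM0 hMp
  exact ⟨(mul_eq_zero.1 hA).resolve_right (mul_ne_zero hd1 hd2),
    (mul_eq_zero.1 hB).resolve_right (mul_ne_zero (mul_ne_zero hc0 hc1) hc2)⟩

theorem indep_of_ne_zero {p : Fin 5 → ℤ} (hp : p 0 ≠ 0) : Indep p := by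
  rcases lt_or_gt_of_ne hp with h | h
  -- Shifting the relation by `-p` exchanges the roles of the two functions.
  · intro A B hAB
    obtain ⟨A', hA', hA0⟩ := exists_comp_add (-p) A
    obtain ⟨B', hB', hB0⟩ := exists_comp_add (-p) B
    have hn : Indep (-p) := indep_of_one_le (by simp; omega)
    obtain ⟨h1, h2⟩ := hn B' A' (by
      filter_upwards [(tendsto_add_intVec (-p)).eventually hAB] with a ha
      have : a + intVec ℂ (-p) + intVec ℂ p = a := by ext j; simp [intVec]
      rw [this] at ha
      rw [hA', hB']
      linear_combination ha)
    exact ⟨hA0 h2, hB0 h1⟩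
  · exact indep_of_one_le (by omega)

theorem exists_path (r : Fin 5 → ℤ) :
    ∃ l : List (Fin 5 × Bool), endpoint l = r ∧ l.length = ∑ j, (r j).natAbs := by
  have hend : ∀ l l' : List (Fin 5 × Bool), endpoint (l ++ l') = endpoint l + endpoint l' :=
    fun l l' => by simp [endpoint]
  have hrep : ∀ (i : Fin 5) (n : ℤ),
      endpoint (List.replicate n.natAbs (i, decide (0 ≤ n))) = Pi.single i n := fun i n => by
    rw [endpoint, List.map_replicate, List.sum_replicate, step, ← Pi.single_smul]
    congr 1
    rcases le_or_gt 0 n with h | h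
    · simp [h]
    · simp [not_le.2 h, abs_of_neg h]
  refine ⟨List.replicate (r 0).natAbs (0, decide (0 ≤ r 0)) ++
    (List.replicate (r 1).natAbs (1, decide (0 ≤ r 1)) ++
    (List.replicate (r 2).natAbs (2, decide (0 ≤ r 2)) ++
    (List.replicate (r 3).natAbs (3, decide (0 ≤ r 3)) ++
    List.replicate (r 4).natAbs (4, decide (0 ≤ r 4))))), ?_, ?_⟩
  · simp only [hend, hrep]
    ext j
    fin_cases j <;> simp
  · simp [Fin.sum_univ_five, add_assoc]

theorem eval_pathNum (a : Fin 5 → ℂ) (l : List (Fin 5 × Bool)) (i j : Fin 2) :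
    MvPolynomial.eval a (pathNum MvPolynomial.X l i j) = pathNum a l i j := by
  rw [map_pathNum]
  simp

theorem eval_pathDen (a : Fin 5 → ℂ) (l : List (Fin 5 × Bool)) :
    MvPolynomial.eval a (pathDen MvPolynomial.X l) = pathDen a l := by
  rw [map_pathDen]
  simp

theorem pathDen_X_ne_zero (l : List (Fin 5 × Bool)) :
    (pathDen MvPolynomial.X l : MvPolynomial (Fin 5) ℂ) ≠ 0 := fun h => by
  have h1 := eval_pathDen (fun j => algebraMap ℚ ℂ (rationalPoint j)) l
  rw [h, map_zero, ← map_pathDen] at h1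
  exact nonInt_rationalPoint.pathDen_ne_zero l ((map_eq_zero _).1 h1.symm)

/-- Polynomial substitution of a symmetry. -/
theorem exists_comp_act (x : S2S3S3) (P : MvPolynomial (Fin 5) ℂ) :
    ∃ P' : MvPolynomial (Fin 5) ℂ,
      (∀ a, MvPolynomial.eval a P' = MvPolynomial.eval (act 1 x a) P) ∧ (P' = 0 → P = 0) := by
  obtain ⟨P', h, h0⟩ := exists_comp_affineEquiv (symEquiv.symm x).1 P
  refine ⟨P', fun a => ?_, h0⟩
  rw [h, symGroup_apply, MulEquiv.apply_symm_apply]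

theorem contig_act (x : S2S3S3) :
    Contig fun a => tw (Equiv.Perm.sign x.right) a * hgf (act 1 x a) 1 :=
  contig_hgf.comp_act x

/-- Writing `f(a+p)` through `f(a)` and `f(a+1)`, which are independent, a dependence with `B ≠ 0`
forces the upper right entry of the path product to vanish. That entry depends only on contiguity,
so the twisted transform of `f` by `x` satisfies the same two-term relation, which contradicts
independence for the transformed shift. -/
theorem indep_of_act {x : S2S3S3} {p : Fin 5 → ℤ} (hx : Indep (act 0 x p)) : Indep p := by
  intro A B h
  obtain ⟨l, hl, -⟩ := exists_path p
  have hone : Indep 1 := indep_of_one_le le_rfl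
  obtain ⟨h1, h2⟩ := hone (A * pathDen MvPolynomial.X l + B * pathNum MvPolynomial.X l 0 0)
    (B * pathNum MvPolynomial.X l 0 1) (by
    filter_upwards [h, contig_hgf.top_row l] with a h1 h2
    rw [hl] at h2
    simp only [map_mul, map_add, eval_pathNum, eval_pathDen, intVec_one]
    linear_combination pathDen a l * h1 - MvPolynomial.eval a B * h2)
  rcases mul_eq_zero.1 h2 with hB | hN
  · rw [hB, zero_mul, add_zero] at h1
    exact ⟨(mul_eq_zero.1 h1).resolve_right (pathDen_X_ne_zero l), hB⟩
  · exfalso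
    obtain ⟨D', hD', hD0⟩ := exists_comp_act x⁻¹ (pathDen MvPolynomial.X l)
    obtain ⟨N', hN', -⟩ := exists_comp_act x⁻¹ (pathNum MvPolynomial.X l 0 0)
    obtain ⟨-, h3⟩ := hx (-N') (MvPolynomial.C
      ((((Equiv.Perm.sign x.right) ^ saal p : ℤˣ) : ℤ) : ℂ) * D') (by
      filter_upwards [(tendsto_act x⁻¹).eventually ((contig_act x).top_row l)] with b hb
      have hN1 := eval_pathNum (act 1 x⁻¹ b) l 0 1
      rw [hN, map_zero] at hN1
      rw [← hN1, zero_mul, add_zero, hl, act_add_intVec, ← act_mul, mul_inv_cancel, act_one,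
        tw_add_intVec] at hb
      have := tw_ne_zero (Equiv.Perm.sign x.right) (act 1 x⁻¹ b)
      rw [map_neg, map_mul, MvPolynomial.eval_C, hN', hD', eval_pathDen, eval_pathNum]
      refine (mul_eq_zero.1 ?_).resolve_left this
      linear_combination hb)
    rcases mul_eq_zero.1 h3 with h4 | h4
    · rw [MvPolynomial.C_eq_zero, Int.cast_eq_zero] at h4
      exact Units.ne_zero _ h4
    · exact pathDen_X_ne_zero l (hD0 h4)

/-- Some group element makes the leading entry of `p` nonzero: it can become `p₀ - p₃` or `p₀ - p₄`,
and after the swap also `p₁` or `p₂`. -/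
theorem indep_of_ne {p : Fin 5 → ℤ} (hp : p ≠ 0) : Indep p := by
  have h1 : ∀ p : Fin 5 → ℤ, act 0 (genElt .zero 1) p 0 = p 0 - p 3 := fun p => by
    simp [genElt, act, ofTriples, tripleIndex, rho, toTriples]
    ring
  have h2 : ∀ p : Fin 5 → ℤ, act 0 (genElt .zero 2) p 0 = p 0 - p 4 := fun p => by
    simp [genElt, act, ofTriples, tripleIndex, rho, toTriples]
    ring
  have h3 : ∀ p : Fin 5 → ℤ, act 0 (genElt .infty 0) p 0 = p 0 ∧
      act 0 (genElt .infty 0) p 3 = p 0 - p 1 ∧ act 0 (genElt .infty 0) p 4 = p 0 - p 2 :=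
    fun p => by
      simp [genElt, act, ofTriples, tripleIndex, rho, toTriples]
      constructor <;> ring
  by_cases c0 : p 0 = 0
  · by_cases c3 : p 3 = 0
    · by_cases c4 : p 4 = 0
      · by_cases c1 : p 1 = 0
        · have c2 : p 2 ≠ 0 := fun c2 => hp (by ext j; fin_cases j <;> assumption)
          refine indep_of_act (x := genElt .infty 0) (indep_of_act (x := genElt .zero 2)
            (indep_of_ne_zero ?_))
          rw [h2, (h3 p).1, (h3 p).2.2]
          simpa using c2
        · refine indep_of_act (x := genElt .infty 0) (indep_of_act (x := genElt .zero 1)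
            (indep_of_ne_zero ?_))
          rw [h1, (h3 p).1, (h3 p).2.1]
          simpa using c1
      · refine indep_of_act (x := genElt .zero 2) (indep_of_ne_zero ?_)
        rw [h2, c0, zero_sub, neg_ne_zero]
        exact c4
    · refine indep_of_act (x := genElt .zero 1) (indep_of_ne_zero ?_)
      rw [h1, c0, zero_sub, neg_ne_zero]
      exact c3
  · exact indep_of_ne_zero c0

theorem indep_pair {p q : Fin 5 → ℤ} (hpq : p ≠ q) {A B : MvPolynomial (Fin 5) ℂ}
    (h : ∀ᶠ a in farGeneric, MvPolynomial.eval a A * hgf (a + intVec ℂ p) 1 +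
      MvPolynomial.eval a B * hgf (a + intVec ℂ q) 1 = 0) : A = 0 ∧ B = 0 := by
  obtain ⟨A', hA', hA0⟩ := exists_comp_add (-p) A
  obtain ⟨B', hB', hB0⟩ := exists_comp_add (-p) B
  have hn : Indep (q - p) := indep_of_ne (sub_ne_zero.2 hpq.symm)
  obtain ⟨h1, h2⟩ := hn A' B' (by
    filter_upwards [(tendsto_add_intVec (-p)).eventually h] with a ha
    have e1 : a + intVec ℂ (-p) + intVec ℂ p = a := by ext j; simp [intVec]
    have e2 : a + intVec ℂ (-p) + intVec ℂ q = a + intVec ℂ (q - p) := by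
      ext j; simp [intVec]; ring
    rwa [e1, e2, ← hA', ← hB'] at ha)
  exact ⟨hA0 h1, hB0 h2⟩

theorem act_injective (x : S2S3S3) : Function.Injective (act (0 : ℤ) x) := fun p q h => by
  have := congrArg (act 0 x⁻¹) h
  rwa [← act_mul, ← act_mul, inv_mul_cancel, act_one, act_one] at this

/-- Linear independence for the functions `e^{iπ s(a)} f(σ(a))` or `f(σ(a))`. -/
theorem indep_pair_act (x : S2S3S3) {p q : Fin 5 → ℤ} (hpq : p ≠ q)
    {A B : MvPolynomial (Fin 5) ℂ}
    (h : ∀ᶠ a in farGeneric,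
      MvPolynomial.eval a A * (tw (Equiv.Perm.sign x.right) (a + intVec ℂ p) *
        hgf (act 1 x (a + intVec ℂ p)) 1) +
      MvPolynomial.eval a B * (tw (Equiv.Perm.sign x.right) (a + intVec ℂ q) *
        hgf (act 1 x (a + intVec ℂ q)) 1) = 0) : A = 0 ∧ B = 0 := by
  obtain ⟨A', hA', hA0⟩ := exists_comp_act x⁻¹ A
  obtain ⟨B', hB', hB0⟩ := exists_comp_act x⁻¹ B
  have hne : ∀ n : ℤ, (MvPolynomial.C ((((Equiv.Perm.sign x.right) ^ n : ℤˣ) : ℤ) : ℂ) :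
      MvPolynomial (Fin 5) ℂ) ≠ 0 := fun n h => by
    rw [MvPolynomial.C_eq_zero, Int.cast_eq_zero] at h
    exact Units.ne_zero _ h
  obtain ⟨h1, h2⟩ := indep_pair (p := act 0 x p) (q := act 0 x q)
    (fun h => hpq (act_injective x h))
    (A := MvPolynomial.C ((((Equiv.Perm.sign x.right) ^ saal p : ℤˣ) : ℤ) : ℂ) * A')
    (B := MvPolynomial.C ((((Equiv.Perm.sign x.right) ^ saal q : ℤˣ) : ℤ) : ℂ) * B') (by
    filter_upwards [(tendsto_act x⁻¹).eventually h] with b hb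
    simp only [act_add_intVec, ← act_mul, mul_inv_cancel, act_one, tw_add_intVec] at hb
    rw [map_mul, map_mul, MvPolynomial.eval_C, MvPolynomial.eval_C, hA', hB']
    refine (mul_eq_zero.1 ?_).resolve_left (tw_ne_zero (Equiv.Perm.sign x.right) (act 1 x⁻¹ b))
    linear_combination hb)
  exact ⟨hA0 ((mul_eq_zero.1 h1).resolve_left (hne _)),
    hB0 ((mul_eq_zero.1 h2).resolve_left (hne _))⟩

/-! ### Analytic continuation to all points of convergence -/

/-- Only the entry `a₃` moves, so each integrality condition involving it excludes a single `t`. -/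
theorem countable_not_generic_shiftThree {b : Fin 5 → ℂ} (hb : Generic b) :
    {t : ℂ | ¬Generic (shiftThree b t)}.Countable := by
  have hc : (Set.range (fun n : ℤ => (n : ℂ) - b 3) ∪
      ⋃ j, Set.range fun n : ℤ => (n : ℂ) - b 3 + b j).Countable :=
    (Set.countable_range _).union (Set.countable_iUnion fun j => Set.countable_range _)
  refine hc.mono fun t ht => ?_
  by_contra hcon
  simp only [Set.mem_union, Set.mem_range, Set.mem_iUnion, not_or, not_exists] at hcon
  obtain ⟨h1, h2⟩ := hcon
  refine ht ⟨fun i n h => ?_, fun i j hij n h => ?_⟩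
  · by_cases hi : i = 3
    · simp only [shiftThree, hi, if_true] at h
      exact h1 n (by linear_combination -h)
    · simp only [shiftThree, hi, if_false, add_zero] at h
      exact hb.1 i n h
  · by_cases hi : i = 3
    · have hj : j ≠ 3 := fun hj => hij (hi.trans hj.symm)
      simp only [shiftThree, hi, hj, if_true, if_false, add_zero] at h
      exact h2 j n (by linear_combination -h)
    · by_cases hj : j = 3
      · simp only [shiftThree, hi, hj, if_true, if_false, add_zero] at h
        refine h2 i (-n) ?_
        push_cast
        linear_combination h
      · simp only [shiftThree, hi, hj, if_false, add_zero] at h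
        exact hb.2 i j hij n h

theorem differentiable_eval_shiftThree (P : MvPolynomial (Fin 5) ℂ) (b : Fin 5 → ℂ) :
    Differentiable ℂ fun t => MvPolynomial.eval (shiftThree b t) P := by
  induction P using MvPolynomial.induction_on with
  | C c => simp
  | add P Q hP hQ =>
    simp only [map_add]
    exact hP.add hQ
  | mul_X P j hP =>
    simp only [map_mul, MvPolynomial.eval_X]
    refine hP.mul ?_
    unfold shiftThree
    by_cases hj : j = 3 <;> simp only [hj, if_true, if_false] <;> fun_prop

theorem differentiableOn_hgf_shiftThree {b : Fin 5 → ℂ} (hb : Generic b) :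
    DifferentiableOn ℂ (fun t => hgf (shiftThree b t) 1) {t | 0 < (saal b).re + t.re} := by
  have h : (fun t => hgf (shiftThree b t) 1) = fun t =>
      Complex.Gamma (b 0) * Complex.Gamma (b 1) * Complex.Gamma (b 2) *
        regSum (shiftThree b t) := by
    funext t
    have h0 : shiftThree b t 0 = b 0 := by simp [shiftThree]
    have h1 : shiftThree b t 1 = b 1 := by simp [shiftThree]
    have h2 : shiftThree b t 2 = b 2 := by simp [shiftThree]
    rw [hgf_one_eq (by rw [h0]; exact hb.1 0) (by rw [h1]; exact hb.1 1)
      (by rw [h2]; exact hb.1 2), h0, h1, h2]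
  rw [h]
  exact (differentiableOn_regSum_shiftThree b).const_mul _

theorem shiftThree_add (b c : Fin 5 → ℂ) (t : ℂ) :
    shiftThree b t + c = shiftThree (b + c) t := by
  ext j
  simp [shiftThree]
  ring

theorem shiftThree_zero (b : Fin 5 → ℂ) : shiftThree b 0 = b := by
  ext j
  simp [shiftThree]

/-- A polynomial relation that holds far away holds wherever the three series converge. -/
theorem relation_of_eventually {P Q R : MvPolynomial (Fin 5) ℂ} {p q : Fin 5 → ℤ}
    (h : ∀ᶠ b in farGeneric, MvPolynomial.eval b P * hgf b 1 +
      MvPolynomial.eval b Q * hgf (b + intVec ℂ p) 1 +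
      MvPolynomial.eval b R * hgf (b + intVec ℂ q) 1 = 0)
    {b : Fin 5 → ℂ} (hb : Generic b) (h0 : 0 < (saal b).re)
    (hp : 0 < (saal (b + intVec ℂ p)).re) (hq : 0 < (saal (b + intVec ℂ q)).re) :
    MvPolynomial.eval b P * hgf b 1 + MvPolynomial.eval b Q * hgf (b + intVec ℂ p) 1 +
      MvPolynomial.eval b R * hgf (b + intVec ℂ q) 1 = 0 := by
  obtain ⟨M, hM⟩ := eventually_farGeneric.1 h
  set δ := min (saal b).re (min (saal (b + intVec ℂ p)).re (saal (b + intVec ℂ q)).re) with hδ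
  have hδ0 : 0 < δ := lt_min h0 (lt_min hp hq)
  have hδ1 : δ ≤ (saal b).re := min_le_left _ _
  have hδ2 : δ ≤ (saal (b + intVec ℂ p)).re := (min_le_right _ _).trans (min_le_left _ _)
  have hδ3 : δ ≤ (saal (b + intVec ℂ q)).re := (min_le_right _ _).trans (min_le_right _ _)
  set U := {t : ℂ | -δ < t.re} with hU
  have hUo : IsOpen U := isOpen_lt continuous_const Complex.continuous_re
  set F : ℂ → ℂ := fun t => MvPolynomial.eval (shiftThree b t) P * hgf (shiftThree b t) 1 +
    MvPolynomial.eval (shiftThree b t) Q * hgf (shiftThree b t + intVec ℂ p) 1 +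
    MvPolynomial.eval (shiftThree b t) R * hgf (shiftThree b t + intVec ℂ q) 1 with hF
  have hd : DifferentiableOn ℂ F U := by
    simp only [hF, shiftThree_add]
    refine DifferentiableOn.add (DifferentiableOn.add ?_ ?_) ?_
    · refine (differentiable_eval_shiftThree P b).differentiableOn.mul
        ((differentiableOn_hgf_shiftThree hb).mono fun t ht => ?_)
      change -δ < t.re at ht
      change 0 < (saal b).re + t.re
      linarith
    · refine (differentiable_eval_shiftThree Q b).differentiableOn.mul
        ((differentiableOn_hgf_shiftThree (hb.add_intVec p)).mono fun t ht => ?_)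
      change -δ < t.re at ht
      change 0 < (saal (b + intVec ℂ p)).re + t.re
      linarith
    · refine (differentiable_eval_shiftThree R b).differentiableOn.mul
        ((differentiableOn_hgf_shiftThree (hb.add_intVec q)).mono fun t ht => ?_)
      change -δ < t.re at ht
      change 0 < (saal (b + intVec ℂ q)).re + t.re
      linarith
  -- A base point in the half-plane where the relation is already known at generic parameters. As
  -- the nongeneric `t` are countable, zeros of `F` accumulate at `t₀`, and the identity theorem
  -- reaches `t = 0`.
  set t₀ : ℂ := ((max (M + 1) 0 : ℝ) : ℂ) with ht₀
  have ht₀U : t₀ ∈ U := by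
    change -δ < t₀.re
    rw [ht₀, Complex.ofReal_re]
    linarith [le_max_right (M + 1) 0]
  have hfreq : ∃ᶠ t in 𝓝[≠] t₀, F t = 0 := by
    have hc : ({t : ℂ | ¬Generic (shiftThree b t)} ∪ {t₀}).Countable :=
      (countable_not_generic_shiftThree hb).union (Set.countable_singleton _)
    have hdense := mem_closure_iff_frequently.1 (hc.dense_compl ℂ t₀)
    have hev : ∀ᶠ t : ℂ in 𝓝 t₀, M < t.re := by
      refine (isOpen_lt continuous_const Complex.continuous_re).mem_nhds ?_
      change M < t₀.re
      rw [ht₀, Complex.ofReal_re]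
      linarith [le_max_left (M + 1) 0]
    rw [frequently_nhdsWithin_iff]
    refine (hdense.and_eventually hev).mono fun t ht => ?_
    obtain ⟨ht1, ht2⟩ := ht
    simp only [Set.mem_compl_iff, Set.mem_union, Set.mem_singleton_iff, not_or] at ht1
    refine ⟨hM _ (not_not.1 ht1.1) ?_, ht1.2⟩
    rw [saal_shiftThree, Complex.add_re]
    linarith
  have h0U : (0 : ℂ) ∈ U := by
    change -δ < (0 : ℂ).re
    simpa using hδ0
  have hconv : IsPreconnected U := (convex_halfSpace_re_gt (-δ)).isPreconnected
  have := (hd.analyticOnNhd hUo).eqOn_zero_of_preconnected_of_frequently_eq_zero hconv ht₀U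
    hfreq h0U
  simpa [hF, shiftThree_zero] using this

/-! ### Values of rational functions -/

theorem mul_den_eq_num {K : Type*} [Field K] (u : RatFun K) :
    u * algebraMap _ _ (IsFractionRing.den (MvPolynomial (Fin 5) K) u : MvPolynomial (Fin 5) K) =
      algebraMap _ _ (IsFractionRing.num (MvPolynomial (Fin 5) K) u) :=
  IsFractionRing.num_mul_den_eq_num_iff_eq'.2 rfl

section Values

variable {K : Type*} [Field K] [Algebra K ℂ]

theorem aeval_eq_eval_map (a : Fin 5 → ℂ) (P : MvPolynomial (Fin 5) K) :
    MvPolynomial.aeval a P = MvPolynomial.eval a (MvPolynomial.map (algebraMap K ℂ) P) := by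
  rw [MvPolynomial.aeval_def, MvPolynomial.eval_map]

theorem map_ne_zero_of_ne_zero {P : MvPolynomial (Fin 5) K} (hP : P ≠ 0) :
    MvPolynomial.map (algebraMap K ℂ) P ≠ 0 := fun h =>
  hP (MvPolynomial.map_injective _ (algebraMap K ℂ).injective (by rw [h, map_zero]))

theorem continuous_aeval (P : MvPolynomial (Fin 5) K) :
    Continuous fun a : Fin 5 → ℂ => MvPolynomial.aeval a P := by
  simp only [aeval_eq_eval_map]
  exact MvPolynomial.continuous_eval _

/-- Cross-multiplication with the reduced fraction; `D` may vanish at `a`. -/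
theorem evalAt_mul {u : RatFun K} {D E : MvPolynomial (Fin 5) K}
    (h : u * algebraMap _ _ D = algebraMap _ _ E) {a : Fin 5 → ℂ} (ha : RegularAt u a) :
    evalAt u a * MvPolynomial.aeval a D = MvPolynomial.aeval a E := by
  have h1 : IsFractionRing.num (MvPolynomial (Fin 5) K) u * D =
      E * (IsFractionRing.den (MvPolynomial (Fin 5) K) u : MvPolynomial (Fin 5) K) := by
    apply IsFractionRing.injective (MvPolynomial (Fin 5) K) (RatFun K)
    rw [map_mul, map_mul, ← mul_den_eq_num u, ← h]
    ring
  have h2 := congrArg (MvPolynomial.aeval a) h1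
  rw [map_mul, map_mul] at h2
  unfold RegularAt at ha
  rw [evalAt, div_mul_eq_mul_div, div_eq_iff ha, h2]

theorem continuousAt_evalAt {u : RatFun K} {a : Fin 5 → ℂ} (ha : RegularAt u a) :
    ContinuousAt (evalAt u) a :=
  (continuous_aeval _).continuousAt.div (continuous_aeval _).continuousAt ha

theorem eventually_regularAt {u : RatFun K} {a : Fin 5 → ℂ} (ha : RegularAt u a) :
    ∀ᶠ x in 𝓝 a, RegularAt u x :=
  (continuous_aeval _).continuousAt.eventually_ne ha

end Values

/-! ### Top rows of the matrix products -/

/-- Both paths express the same value of `f` through `f(a)` and `f(a+1)`, whose independence makes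
the coefficients unique. -/
theorem pathDen_mul_pathNum {l l' : List (Fin 5 × Bool)} (h : endpoint l = endpoint l')
    (j : Fin 2) : (pathDen MvPolynomial.X l' * pathNum MvPolynomial.X l 0 j :
      MvPolynomial (Fin 5) ℂ) = pathDen MvPolynomial.X l * pathNum MvPolynomial.X l' 0 j := by
  have hone : Indep 1 := indep_of_one_le le_rfl
  obtain ⟨h0, h1⟩ := hone
    (pathDen MvPolynomial.X l' * pathNum MvPolynomial.X l 0 0 -
      pathDen MvPolynomial.X l * pathNum MvPolynomial.X l' 0 0)
    (pathDen MvPolynomial.X l' * pathNum MvPolynomial.X l 0 1 -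
      pathDen MvPolynomial.X l * pathNum MvPolynomial.X l' 0 1) (by
    filter_upwards [contig_hgf.top_row l, contig_hgf.top_row l'] with a e e'
    rw [← h] at e'
    simp only [map_mul, map_sub, eval_pathNum, eval_pathDen, intVec_one]
    linear_combination pathDen a l * e' - pathDen a l' * e)
  fin_cases j
  · exact sub_eq_zero.1 h0
  · exact sub_eq_zero.1 h1

theorem map_X_eq_X : (fun j => MvPolynomial.map (algebraMap ℚ ℂ) (MvPolynomial.X j)) =
    (MvPolynomial.X : Fin 5 → MvPolynomial (Fin 5) ℂ) :=
  funext fun _ => MvPolynomial.map_X _ _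

theorem algebraMap_pathDen (l : List (Fin 5 × Bool)) :
    algebraMap (MvPolynomial (Fin 5) ℚ) (RatFun ℚ) (pathDen MvPolynomial.X l) = pathDen vars l :=
  map_pathDen _ _ _

theorem algebraMap_pathNum (l : List (Fin 5 × Bool)) (i j : Fin 2) :
    algebraMap (MvPolynomial (Fin 5) ℚ) (RatFun ℚ) (pathNum MvPolynomial.X l i j) =
      pathNum vars l i j :=
  map_pathNum _ _ _ _ _

theorem pathDen_mul_pathMatrix (l : List (Fin 5 × Bool)) (i j : Fin 2) :
    pathDen vars l * pathMatrix vars l i j = pathNum vars l i j := by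
  rw [← nonInt_vars.pathMatrix_eq l]
  rfl

/-- The top row of a product of contiguous matrices depends only on the end point. -/
theorem pathMatrix_top_row {l l' : List (Fin 5 × Bool)} (h : endpoint l = endpoint l')
    (j : Fin 2) : pathMatrix vars l 0 j = pathMatrix vars l' 0 j := by
  have h1 : (pathDen MvPolynomial.X l' * pathNum MvPolynomial.X l 0 j :
      MvPolynomial (Fin 5) ℚ) = pathDen MvPolynomial.X l * pathNum MvPolynomial.X l' 0 j := by
    refine MvPolynomial.map_injective _ (algebraMap ℚ ℂ).injective ?_
    simp only [map_mul, map_pathDen, map_pathNum, map_X_eq_X]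
    exact pathDen_mul_pathNum h j
  have h2 := congrArg (algebraMap (MvPolynomial (Fin 5) ℚ) (RatFun ℚ)) h1
  rw [map_mul, map_mul, algebraMap_pathDen, algebraMap_pathDen, algebraMap_pathNum,
    algebraMap_pathNum, ← pathDen_mul_pathMatrix, ← pathDen_mul_pathMatrix] at h2
  refine mul_left_cancel₀ (mul_ne_zero (nonInt_vars.pathDen_ne_zero l)
    (nonInt_vars.pathDen_ne_zero l')) ?_
  linear_combination h2

/-- The determinant of the two top rows, cleared of denominators. -/
def relDet {R : Type*} [CommRing R] (a : Fin 5 → R) (l l' : List (Fin 5 × Bool)) : R :=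
  pathNum a l 0 0 * pathNum a l' 0 1 - pathNum a l 0 1 * pathNum a l' 0 0

theorem map_relDet {R S : Type*} [CommRing R] [CommRing S] (g : R →+* S) (a : Fin 5 → R)
    (l l' : List (Fin 5 × Bool)) : g (relDet a l l') = relDet (fun j => g (a j)) l l' := by
  simp only [relDet, map_sub, map_mul, map_pathNum]

theorem eval_relDet (a : Fin 5 → ℂ) (l l' : List (Fin 5 × Bool)) :
    MvPolynomial.eval a (relDet MvPolynomial.X l l') = relDet a l l' := by
  simp only [relDet, map_sub, map_mul, eval_pathNum]

/-- Otherwise `f(a+p)` would be a rational multiple of `f(a)`. -/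
theorem pathNum_X_ne_zero {l : List (Fin 5 × Bool)} (h : endpoint l ≠ 0) :
    (pathNum MvPolynomial.X l 0 1 : MvPolynomial (Fin 5) ℂ) ≠ 0 := fun h0 => by
  refine pathDen_X_ne_zero l (indep_of_ne h (-pathNum MvPolynomial.X l 0 0) _ ?_).2
  filter_upwards [contig_hgf.top_row l] with a ha
  have h1 := eval_pathNum a l 0 1
  rw [h0, map_zero] at h1
  rw [map_neg, eval_pathNum, eval_pathDen]
  linear_combination ha - hgf (a + 1) 1 * h1

/-- If the determinant vanished, eliminating `f(a+1)` would relate `f(a+p)` and `f(a+q)` alone. By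
independence both upper right entries would be zero, so both end points would be the origin. -/
theorem relDet_X_ne_zero {l l' : List (Fin 5 × Bool)} (h : endpoint l ≠ endpoint l') :
    (relDet MvPolynomial.X l l' : MvPolynomial (Fin 5) ℂ) ≠ 0 := fun h0 => by
  obtain ⟨h1, h2⟩ := indep_pair h
    (A := pathNum MvPolynomial.X l' 0 1 * pathDen MvPolynomial.X l)
    (B := -(pathNum MvPolynomial.X l 0 1 * pathDen MvPolynomial.X l')) (by
    filter_upwards [contig_hgf.top_row l, contig_hgf.top_row l'] with a e e'
    have h3 := eval_relDet a l l'
    rw [h0, map_zero, relDet] at h3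
    simp only [map_neg, map_mul, eval_pathNum, eval_pathDen]
    linear_combination pathNum a l' 0 1 * e - pathNum a l 0 1 * e' - hgf a 1 * h3)
  have h1' := (mul_eq_zero.1 h1).resolve_right (pathDen_X_ne_zero l)
  have h2' := (mul_eq_zero.1 (neg_eq_zero.1 h2)).resolve_right (pathDen_X_ne_zero l')
  have e1 : endpoint l' = 0 := by_contra fun hne => pathNum_X_ne_zero hne h1'
  have e2 : endpoint l = 0 := by_contra fun hne => pathNum_X_ne_zero hne h2'
  exact h (e2.trans e1.symm)

/-! ### The three-term relation for `f` and its symmetric forms -/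

theorem aeval_pathNum (a : Fin 5 → ℂ) (l : List (Fin 5 × Bool)) (i j : Fin 2) :
    MvPolynomial.aeval a (pathNum MvPolynomial.X l i j : MvPolynomial (Fin 5) ℚ) =
      pathNum a l i j := by
  rw [aeval_eq_eval_map, map_pathNum, map_X_eq_X, eval_pathNum]

theorem aeval_pathDen (a : Fin 5 → ℂ) (l : List (Fin 5 × Bool)) :
    MvPolynomial.aeval a (pathDen MvPolynomial.X l : MvPolynomial (Fin 5) ℚ) = pathDen a l := by
  rw [aeval_eq_eval_map, map_pathDen, map_X_eq_X, eval_pathDen]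

theorem aeval_relDet (a : Fin 5 → ℂ) (l l' : List (Fin 5 × Bool)) :
    MvPolynomial.aeval a (relDet MvPolynomial.X l l' : MvPolynomial (Fin 5) ℚ) = relDet a l l' := by
  rw [aeval_eq_eval_map, map_relDet, map_X_eq_X, eval_relDet]

/-- Take the twisted transform of `f` by `x`, eliminate its value at `a + 1` between the two top
rows, and substitute `a = x⁻¹ b`. The twist leaves only the signs. -/
theorem eventually_relDet_mul_hgf (x : S2S3S3) (l l' : List (Fin 5 × Bool)) :
    ∀ᶠ b in farGeneric, relDet (act 1 x⁻¹ b) l l' * hgf b 1 =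
      (((Equiv.Perm.sign x.right ^ saal (endpoint l) : ℤˣ) : ℤ) : ℂ) *
        (pathNum (act 1 x⁻¹ b) l' 0 1 * pathDen (act 1 x⁻¹ b) l) *
        hgf (b + intVec ℂ (act 0 x (endpoint l))) 1 -
      (((Equiv.Perm.sign x.right ^ saal (endpoint l') : ℤˣ) : ℤ) : ℂ) *
        (pathNum (act 1 x⁻¹ b) l 0 1 * pathDen (act 1 x⁻¹ b) l') *
        hgf (b + intVec ℂ (act 0 x (endpoint l'))) 1 := by
  filter_upwards [(tendsto_act x⁻¹).eventually ((contig_act x).top_row l),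
    (tendsto_act x⁻¹).eventually ((contig_act x).top_row l')] with b e e'
  simp only [act_add_intVec, ← act_mul, mul_inv_cancel, act_one, tw_add_intVec] at e e'
  refine mul_left_cancel₀ (tw_ne_zero (Equiv.Perm.sign x.right) (act 1 x⁻¹ b)) ?_
  rw [relDet]
  linear_combination pathNum (act 1 x⁻¹ b) l 0 1 * e' - pathNum (act 1 x⁻¹ b) l' 0 1 * e

theorem relDet_mul_hgf (x : S2S3S3) (l l' : List (Fin 5 × Bool)) {b : Fin 5 → ℂ} (hb : Generic b)
    (h0 : 0 < (saal b).re) (hp : 0 < (saal (b + intVec ℂ (act 0 x (endpoint l)))).re)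
    (hq : 0 < (saal (b + intVec ℂ (act 0 x (endpoint l')))).re) :
    relDet (act 1 x⁻¹ b) l l' * hgf b 1 =
      (((Equiv.Perm.sign x.right ^ saal (endpoint l) : ℤˣ) : ℤ) : ℂ) *
        (pathNum (act 1 x⁻¹ b) l' 0 1 * pathDen (act 1 x⁻¹ b) l) *
        hgf (b + intVec ℂ (act 0 x (endpoint l))) 1 -
      (((Equiv.Perm.sign x.right ^ saal (endpoint l') : ℤˣ) : ℤ) : ℂ) *
        (pathNum (act 1 x⁻¹ b) l 0 1 * pathDen (act 1 x⁻¹ b) l') *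
        hgf (b + intVec ℂ (act 0 x (endpoint l'))) 1 := by
  obtain ⟨P, hP, -⟩ := exists_comp_act x⁻¹ (relDet MvPolynomial.X l l')
  obtain ⟨Q, hQ, -⟩ := exists_comp_act x⁻¹
    (pathNum MvPolynomial.X l' 0 1 * pathDen MvPolynomial.X l)
  obtain ⟨R, hR, -⟩ := exists_comp_act x⁻¹
    (pathNum MvPolynomial.X l 0 1 * pathDen MvPolynomial.X l')
  simp only [map_mul, eval_relDet, eval_pathNum, eval_pathDen] at hP hQ hR
  have key := relation_of_eventually (P := P)
    (Q := MvPolynomial.C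
      (-(((Equiv.Perm.sign x.right ^ saal (endpoint l) : ℤˣ) : ℤ) : ℂ)) * Q)
    (R := MvPolynomial.C
      ((((Equiv.Perm.sign x.right ^ saal (endpoint l') : ℤˣ) : ℤ) : ℂ)) * R)
    (p := act 0 x (endpoint l)) (q := act 0 x (endpoint l')) (by
      filter_upwards [eventually_relDet_mul_hgf x l l'] with b e
      rw [map_mul, map_mul, MvPolynomial.eval_C, MvPolynomial.eval_C, hP, hQ, hR]
      linear_combination e) hb h0 hp hq
  rw [map_mul, map_mul, MvPolynomial.eval_C, MvPolynomial.eval_C, hP, hQ, hR] at key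
  linear_combination key

theorem continuous_act (x : S2S3S3) : Continuous (act (1 : ℂ) x) := by
  have h : act (1 : ℂ) x = (symEquiv.symm x).1 := by
    funext a
    rw [symGroup_apply, MulEquiv.apply_symm_apply]
  rw [h]
  exact AffineMap.continuous_of_finiteDimensional (symEquiv.symm x).1.toAffineMap

theorem continuousAt_hgf_add {a : Fin 5 → ℂ} {p : Fin 5 → ℤ} (ha : Generic a)
    (h : 0 < (saal (a + intVec ℂ p)).re) :
    ContinuousAt (fun x => hgf (x + intVec ℂ p) 1) a :=
  ContinuousAt.comp (g := fun x => hgf x 1) (f := fun x => x + intVec ℂ p)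
    (continuousAt_hgf_one (ha.add_intVec p) h) (by fun_prop)

theorem eventually_saal_add_pos {a : Fin 5 → ℂ} {p : Fin 5 → ℤ}
    (h : 0 < (saal (a + intVec ℂ p)).re) :
    ∀ᶠ x in 𝓝 a, 0 < (saal (x + intVec ℂ p)).re := by
  have hc : Continuous fun x : Fin 5 → ℂ => (saal (x + intVec ℂ p)).re :=
    continuous_saal_re.comp (by fun_prop)
  exact hc.continuousAt.eventually_const_lt h

/-- The coefficients `u`, `v` of the three-term relation read off from two lattice paths. -/
structure IsCoeff (l l' : List (Fin 5 × Bool)) (u v : RatFun ℚ) : Prop where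
  left : u * algebraMap _ _ (relDet MvPolynomial.X l l' : MvPolynomial (Fin 5) ℚ) =
    algebraMap _ _ (pathNum MvPolynomial.X l' 0 1 * pathDen MvPolynomial.X l :
      MvPolynomial (Fin 5) ℚ)
  right : v * algebraMap _ _ (relDet MvPolynomial.X l l' : MvPolynomial (Fin 5) ℚ) =
    algebraMap _ _ (-(pathNum MvPolynomial.X l 0 1 * pathDen MvPolynomial.X l') :
      MvPolynomial (Fin 5) ℚ)

/-- Where the determinant is nonzero one may divide by it. Elsewhere both sides are continuous as
long as `u` and `v` are regular, and the exceptional hypersurface has dense generic complement. -/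
theorem IsCoeff.hgf_eq {l l' : List (Fin 5 × Bool)} {u v : RatFun ℚ} (h : IsCoeff l l' u v)
    (hne : endpoint l ≠ endpoint l') (x : S2S3S3) {b : Fin 5 → ℂ} (hb : Generic b)
    (h0 : 0 < (saal b).re) (hp : 0 < (saal (b + intVec ℂ (act 0 x (endpoint l)))).re)
    (hq : 0 < (saal (b + intVec ℂ (act 0 x (endpoint l')))).re)
    (hu : RegularAt u (act 1 x⁻¹ b)) (hv : RegularAt v (act 1 x⁻¹ b)) :
    hgf b 1 =
      (((Equiv.Perm.sign x.right ^ saal (endpoint l) : ℤˣ) : ℤ) : ℂ) * evalAt u (act 1 x⁻¹ b) *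
        hgf (b + intVec ℂ (act 0 x (endpoint l))) 1 +
      (((Equiv.Perm.sign x.right ^ saal (endpoint l') : ℤˣ) : ℤ) : ℂ) * evalAt v (act 1 x⁻¹ b) *
        hgf (b + intVec ℂ (act 0 x (endpoint l'))) 1 := by
  obtain ⟨P, hP, hP0⟩ := exists_comp_act x⁻¹ (relDet MvPolynomial.X l l')
  have hcont := (continuous_act x⁻¹).continuousAt (x := b)
  rw [← sub_eq_zero]
  refine eq_zero_of_continuousAt (g := fun b => hgf b 1 -
      ((((Equiv.Perm.sign x.right ^ saal (endpoint l) : ℤˣ) : ℤ) : ℂ) * evalAt u (act 1 x⁻¹ b) *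
        hgf (b + intVec ℂ (act 0 x (endpoint l))) 1 +
      (((Equiv.Perm.sign x.right ^ saal (endpoint l') : ℤˣ) : ℤ) : ℂ) * evalAt v (act 1 x⁻¹ b) *
        hgf (b + intVec ℂ (act 0 x (endpoint l'))) 1)) (a := b) (P := P) ?_
    (fun hz => relDet_X_ne_zero hne (hP0 hz)) ?_
  · have cu : ContinuousAt (fun b => evalAt u (act 1 x⁻¹ b)) b :=
      ContinuousAt.comp (g := evalAt u) (continuousAt_evalAt hu) hcont
    have cv : ContinuousAt (fun b => evalAt v (act 1 x⁻¹ b)) b :=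
      ContinuousAt.comp (g := evalAt v) (continuousAt_evalAt hv) hcont
    exact (continuousAt_hgf_one hb h0).sub
      (((continuousAt_const.mul cu).mul (continuousAt_hgf_add hb hp)).add
        ((continuousAt_const.mul cv).mul (continuousAt_hgf_add hb hq)))
  · filter_upwards [(isOpen_lt_saal 0).mem_nhds h0, eventually_saal_add_pos hp,
      eventually_saal_add_pos hq, hcont.eventually (eventually_regularAt hu),
      hcont.eventually (eventually_regularAt hv)] with c c0 cp cq cu cv hc hPc
    rw [hP, eval_relDet] at hPc
    have e := relDet_mul_hgf x l l' hc c0 cp cq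
    have eu := evalAt_mul h.left cu
    have ev := evalAt_mul h.right cv
    rw [map_neg] at ev
    rw [map_mul, aeval_relDet, aeval_pathNum, aeval_pathDen] at eu ev
    refine (mul_eq_zero.1 ?_).resolve_left hPc
    linear_combination e -
      (((Equiv.Perm.sign x.right ^ saal (endpoint l) : ℤˣ) : ℤ) : ℂ) *
        hgf (c + intVec ℂ (act 0 x (endpoint l))) 1 * eu -
      (((Equiv.Perm.sign x.right ^ saal (endpoint l') : ℤˣ) : ℤ) : ℂ) *
        hgf (c + intVec ℂ (act 0 x (endpoint l'))) 1 * ev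

/-! ### The companion functions -/

theorem companion_eq (ν : SingPt) (i : Fin 3) (a : Fin 5 → ℂ) :
    companion ν i a = tw (Equiv.Perm.sign (genElt ν i).right) a *
      hgf (act 1 (genElt ν i) a) 1 := by
  rw [act_genElt]
  cases ν
  · have h : Equiv.Perm.sign (genElt .zero i).right = 1 := by simp [genElt]
    rw [h, tw_one]
    simp [companion, solution]
  · have h : Equiv.Perm.sign (genElt .infty i).right = -1 := by simp [genElt]
    rw [h, tw_neg_one]
    simp [companion, solution]

theorem mem_domain_zero {a : Fin 5 → ℂ} : a ∈ domain 0 ↔ Generic a ∧ 0 < (saal a).re := by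
  have : a + intVec ℂ 0 = a := by ext j; simp [intVec]
  rw [domain, Set.mem_ofPred_eq, this]

/-- If the companion function belongs to `y` and `σ` to `x`, this is the relation for `f`
transformed by `y * x`, taken at the point `y a`. The sign of `y` is absorbed by the twist, leaving
that of `x`. -/
theorem IsCoeff.symRelation {l l' : List (Fin 5 × Bool)} {u v : RatFun ℚ}
    (h : IsCoeff l l' u v) (hne : endpoint l ≠ endpoint l') (ν : SingPt) (i : Fin 3)
    (σ : symGroup) :
    SymRelation (companion ν i) σ.1 (Equiv.Perm.sign (symEquiv σ).right)
      (endpoint l) (endpoint l') u v := by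
  refine ⟨_, _, symGroup_linear_intVec σ _, symGroup_linear_intVec σ _, ?_⟩
  rintro a ⟨⟨ha0, hap⟩, haq⟩ hu hv
  obtain ⟨hg, h0⟩ := mem_domain_zero.1 ha0
  set x := symEquiv σ with hx
  set y := genElt ν i with hy
  have hsymm : σ.1.symm a = act 1 x⁻¹ a := by
    rw [hx, ← map_inv, ← symGroup_apply]
    rfl
  have hyx : act 1 (y * x)⁻¹ (act 1 y a) = act 1 x⁻¹ a := by
    rw [← act_mul, mul_inv_rev, inv_mul_cancel_right]
  have hadd : ∀ r : Fin 5 → ℤ, act 1 y a + intVec ℂ (act 0 (y * x) r) =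
      act 1 y (a + intVec ℂ (act 0 x r)) := fun r => by
    rw [act_add_intVec, act_mul]
  rw [hsymm] at hu hv ⊢
  have key := h.hgf_eq hne (y * x) (hg.act y) (by rwa [saal_act])
    (by rw [hadd, saal_act]; exact hap.2) (by rw [hadd, saal_act]; exact haq.2)
    (by rwa [hyx]) (by rwa [hyx])
  rw [hyx, hadd, hadd, SemidirectProduct.mul_right, Equiv.Perm.sign_mul, mul_zpow, mul_zpow]
    at key
  rw [companion_eq, companion_eq, companion_eq, tw_add_intVec, tw_add_intVec, saal_act, saal_act,
    key]
  push_cast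
  ring

theorem IsCoeff.relation {l l' : List (Fin 5 × Bool)} {u v : RatFun ℚ}
    (h : IsCoeff l l' u v) (hne : endpoint l ≠ endpoint l') (ν : SingPt) (i : Fin 3) :
    Relation (companion ν i) (endpoint l) (endpoint l') u v := by
  obtain ⟨p', q', hp, hq, key⟩ := h.symRelation hne ν i 1
  obtain rfl : endpoint l = p' := intVec_injective hp
  obtain rfl : endpoint l' = q' := intVec_injective hq
  intro a ha hu hv
  have hsymm : (1 : symGroup).1.symm a = a := rfl
  have := key a ha (by rwa [hsymm]) (by rwa [hsymm])
  rw [hsymm] at this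
  simpa using this

/-! ### Independence over the field of rational functions -/

theorem eventually_mem_domain (p : Fin 5 → ℤ) : ∀ᶠ a in farGeneric, a ∈ domain p :=
  eventually_generic.and ((tendsto_add_intVec p).eventually (eventually_lt_saal 0))

/-- Multiplying by the common denominator `W` once more makes the relation hold on the zeros of `W`
as well, so it becomes polynomial and independence applies. A general `K` serves both `ℂ(a)` and
`ℚ(a)`. -/
theorem eq_zero_of_companion {K : Type*} [Field K] [Algebra K ℂ] (ν : SingPt) (i : Fin 3)
    {p q : Fin 5 → ℤ} (hpq : p ≠ q) {U V : RatFun K} {A B W : MvPolynomial (Fin 5) K}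
    (hU : U * algebraMap _ _ W = algebraMap _ _ A)
    (hV : V * algebraMap _ _ W = algebraMap _ _ B) (hW : W ≠ 0)
    (h : ∀ᶠ a in farGeneric, MvPolynomial.aeval a W ≠ 0 →
      MvPolynomial.aeval a A * companion ν i (a + intVec ℂ p) +
        MvPolynomial.aeval a B * companion ν i (a + intVec ℂ q) = 0) : U = 0 ∧ V = 0 := by
  obtain ⟨h1, h2⟩ := indep_pair_act (genElt ν i) hpq
    (A := MvPolynomial.map (algebraMap K ℂ) (W * A))
    (B := MvPolynomial.map (algebraMap K ℂ) (W * B)) (by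
      filter_upwards [h] with a ha
      rw [← aeval_eq_eval_map, ← aeval_eq_eval_map, ← companion_eq, ← companion_eq, map_mul,
        map_mul]
      by_cases hWa : MvPolynomial.aeval a W = 0
      · rw [hWa]
        ring
      · linear_combination MvPolynomial.aeval a W * ha hWa)
  have key : ∀ {C : MvPolynomial (Fin 5) K} {Y : RatFun K},
      MvPolynomial.map (algebraMap K ℂ) (W * C) = 0 →
      Y * algebraMap _ _ W = algebraMap _ _ C → Y = 0 := fun {C Y} hC hY => by
    have h3 : W * C = 0 := by_contra fun hne => map_ne_zero_of_ne_zero hne hC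
    rw [(mul_eq_zero.1 h3).resolve_left hW, map_zero] at hY
    refine (mul_eq_zero.1 hY).resolve_right fun h4 => hW ?_
    exact IsFractionRing.injective (MvPolynomial (Fin 5) K) (RatFun K) (by rw [h4, map_zero])
  exact ⟨key h1 hU, key h2 hV⟩

theorem den_ne_zero {K : Type*} [Field K] (u : RatFun K) :
    (IsFractionRing.den (MvPolynomial (Fin 5) K) u : MvPolynomial (Fin 5) K) ≠ 0 :=
  nonZeroDivisors.ne_zero (IsFractionRing.den (MvPolynomial (Fin 5) K) u).2

theorem evalAt_mul_den {K : Type*} [Field K] [Algebra K ℂ] {u : RatFun K} {a : Fin 5 → ℂ}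
    (ha : RegularAt u a) : evalAt u a * MvPolynomial.aeval a
      (IsFractionRing.den (MvPolynomial (Fin 5) K) u : MvPolynomial (Fin 5) K) =
      MvPolynomial.aeval a (IsFractionRing.num (MvPolynomial (Fin 5) K) u) :=
  div_mul_cancel₀ _ ha

theorem linIndepOverRat_companion (ν : SingPt) (i : Fin 3) {p q : Fin 5 → ℤ} (hpq : p ≠ q) :
    LinIndepOverRat (domain p ∩ domain q) (fun a => companion ν i (a + intVec ℂ p))
      (fun a => companion ν i (a + intVec ℂ q)) := by
  intro U V h
  refine eq_zero_of_companion ν i hpq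
    (W := IsFractionRing.den (MvPolynomial (Fin 5) ℂ) U *
      IsFractionRing.den (MvPolynomial (Fin 5) ℂ) V)
    (A := IsFractionRing.num (MvPolynomial (Fin 5) ℂ) U *
      IsFractionRing.den (MvPolynomial (Fin 5) ℂ) V)
    (B := IsFractionRing.num (MvPolynomial (Fin 5) ℂ) V *
      IsFractionRing.den (MvPolynomial (Fin 5) ℂ) U) ?_ ?_
    (mul_ne_zero (den_ne_zero U) (den_ne_zero V)) ?_
  · rw [map_mul, map_mul, ← mul_den_eq_num U]
    ring
  · rw [map_mul, map_mul, ← mul_den_eq_num V]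
    ring
  · filter_upwards [eventually_mem_domain p, eventually_mem_domain q] with a hp hq hW
    rw [map_mul] at hW
    have hU : RegularAt U a := left_ne_zero_of_mul hW
    have hV : RegularAt V a := right_ne_zero_of_mul hW
    have e := h a ⟨hp, hq⟩ hU hV
    rw [map_mul, map_mul, ← evalAt_mul_den hU, ← evalAt_mul_den hV]
    linear_combination MvPolynomial.aeval a
      (IsFractionRing.den (MvPolynomial (Fin 5) ℂ) U : MvPolynomial (Fin 5) ℂ) *
      MvPolynomial.aeval a
      (IsFractionRing.den (MvPolynomial (Fin 5) ℂ) V : MvPolynomial (Fin 5) ℂ) * e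

theorem relation_unique (ν : SingPt) (i : Fin 3) {p q : Fin 5 → ℤ} (hpq : p ≠ q)
    {u v u' v' : RatFun ℚ} (h : Relation (companion ν i) p q u v)
    (h' : Relation (companion ν i) p q u' v') : u' = u ∧ v' = v := by
  rw [← sub_eq_zero, ← sub_eq_zero (a := v')]
  obtain ⟨nu, hnu⟩ : ∃ n, n = IsFractionRing.num (MvPolynomial (Fin 5) ℚ) u := ⟨_, rfl⟩
  obtain ⟨nv, hnv⟩ : ∃ n, n = IsFractionRing.num (MvPolynomial (Fin 5) ℚ) v := ⟨_, rfl⟩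
  obtain ⟨nu', hnu'⟩ : ∃ n, n = IsFractionRing.num (MvPolynomial (Fin 5) ℚ) u' := ⟨_, rfl⟩
  obtain ⟨nv', hnv'⟩ : ∃ n, n = IsFractionRing.num (MvPolynomial (Fin 5) ℚ) v' := ⟨_, rfl⟩
  obtain ⟨du, hdu⟩ : ∃ d : MvPolynomial (Fin 5) ℚ,
    d = IsFractionRing.den (MvPolynomial (Fin 5) ℚ) u := ⟨_, rfl⟩
  obtain ⟨dv, hdv⟩ : ∃ d : MvPolynomial (Fin 5) ℚ,
    d = IsFractionRing.den (MvPolynomial (Fin 5) ℚ) v := ⟨_, rfl⟩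
  obtain ⟨du', hdu'⟩ : ∃ d : MvPolynomial (Fin 5) ℚ,
    d = IsFractionRing.den (MvPolynomial (Fin 5) ℚ) u' := ⟨_, rfl⟩
  obtain ⟨dv', hdv'⟩ : ∃ d : MvPolynomial (Fin 5) ℚ,
    d = IsFractionRing.den (MvPolynomial (Fin 5) ℚ) v' := ⟨_, rfl⟩
  have eu := mul_den_eq_num u
  have ev := mul_den_eq_num v
  have eu' := mul_den_eq_num u'
  have ev' := mul_den_eq_num v'
  rw [← hdu, ← hnu] at eu
  rw [← hdv, ← hnv] at ev
  rw [← hdu', ← hnu'] at eu'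
  rw [← hdv', ← hnv'] at ev'
  refine eq_zero_of_companion ν i hpq (W := du * dv * du' * dv')
    (A := (nu' * du - nu * du') * (dv * dv')) (B := (nv' * dv - nv * dv') * (du * du')) ?_ ?_
    (mul_ne_zero (mul_ne_zero (mul_ne_zero ?_ ?_) ?_) ?_) ?_
  · simp only [map_mul, map_sub, ← eu, ← eu']
    ring
  · simp only [map_mul, map_sub, ← ev, ← ev']
    ring
  · exact hdu ▸ den_ne_zero u
  · exact hdv ▸ den_ne_zero v
  · exact hdu' ▸ den_ne_zero u'
  · exact hdv' ▸ den_ne_zero v'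
  · filter_upwards [eventually_mem_domain 0, eventually_mem_domain p, eventually_mem_domain q]
      with a h0 hp hq hW
    rw [map_mul, map_mul, map_mul] at hW
    have hv'a : RegularAt v' a := by
      rw [RegularAt, ← hdv']
      exact right_ne_zero_of_mul hW
    have hW := left_ne_zero_of_mul hW
    have hu'a : RegularAt u' a := by
      rw [RegularAt, ← hdu']
      exact right_ne_zero_of_mul hW
    have hW := left_ne_zero_of_mul hW
    have hva : RegularAt v a := by
      rw [RegularAt, ← hdv]
      exact right_ne_zero_of_mul hW
    have hua : RegularAt u a := by
      rw [RegularAt, ← hdu]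
      exact left_ne_zero_of_mul hW
    have e := h a ⟨⟨h0, hp⟩, hq⟩ hua hva
    have e' := h' a ⟨⟨h0, hp⟩, hq⟩ hu'a hv'a
    have fu := evalAt_mul eu hua
    have fv := evalAt_mul ev hva
    have fu' := evalAt_mul eu' hu'a
    have fv' := evalAt_mul ev' hv'a
    simp only [map_mul, map_sub, ← fu, ← fv, ← fu', ← fv']
    linear_combination MvPolynomial.aeval a du * MvPolynomial.aeval a dv *
      MvPolynomial.aeval a du' * MvPolynomial.aeval a dv' * (e - e')

/-! ### The recipe -/

theorem pathDen_mul_relDet (l l' : List (Fin 5 × Bool)) :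
    algebraMap _ _ (relDet MvPolynomial.X l l' : MvPolynomial (Fin 5) ℚ) =
      pathDen vars l * pathDen vars l' * (pathMatrix vars l 0 0 * pathMatrix vars l' 0 1 -
        pathMatrix vars l 0 1 * pathMatrix vars l' 0 0) := by
  rw [relDet, map_sub, map_mul, map_mul]
  simp only [algebraMap_pathNum, ← pathDen_mul_pathMatrix]
  ring

theorem det_top_rows_ne_zero {l l' : List (Fin 5 × Bool)} (h : endpoint l ≠ endpoint l') :
    pathMatrix vars l 0 0 * pathMatrix vars l' 0 1 -
      pathMatrix vars l 0 1 * pathMatrix vars l' 0 0 ≠ 0 := fun h0 => by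
  have h1 := pathDen_mul_relDet l l'
  rw [h0, mul_zero] at h1
  have h2 : (relDet MvPolynomial.X l l' : MvPolynomial (Fin 5) ℚ) = 0 :=
    IsFractionRing.injective (MvPolynomial (Fin 5) ℚ) (RatFun ℚ) (by rw [h1, map_zero])
  refine relDet_X_ne_zero h ?_
  rw [← map_X_eq_X, ← map_relDet, h2, map_zero]

theorem isCoeff_top_rows {l l' : List (Fin 5 × Bool)} (h : endpoint l ≠ endpoint l') :
    IsCoeff l l'
      (pathMatrix vars l' 0 1 / (pathMatrix vars l 0 0 * pathMatrix vars l' 0 1 -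
        pathMatrix vars l 0 1 * pathMatrix vars l' 0 0))
      (-(pathMatrix vars l 0 1 / (pathMatrix vars l 0 0 * pathMatrix vars l' 0 1 -
        pathMatrix vars l 0 1 * pathMatrix vars l' 0 0))) := by
  have h0 := det_top_rows_ne_zero h
  constructor
  · rw [pathDen_mul_relDet, map_mul, algebraMap_pathNum, algebraMap_pathDen,
      ← pathDen_mul_pathMatrix, div_mul_eq_mul_div, div_eq_iff h0]
    ring
  · rw [pathDen_mul_relDet, map_neg, map_mul, algebraMap_pathNum, algebraMap_pathDen,
      ← pathDen_mul_pathMatrix, ← neg_div, div_mul_eq_mul_div, div_eq_iff h0]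
    ring

/-- Path independence allows the path to `q` to run through `p`. Its top row is then the top row of
`L` times `M`, so its determinant against the top row of `M` is `L 0 1 * det M`, and `det M` is
`δ(a;p)`. -/
theorem givenByRecipe_top_rows {l₀ l₀' : List (Fin 5 × Bool)} (h : endpoint l₀ ≠ endpoint l₀') :
    GivenByRecipe (endpoint l₀) (endpoint l₀')
      (pathMatrix vars l₀' 0 1 / (pathMatrix vars l₀ 0 0 * pathMatrix vars l₀' 0 1 -
        pathMatrix vars l₀ 0 1 * pathMatrix vars l₀' 0 0))
      (-(pathMatrix vars l₀ 0 1 / (pathMatrix vars l₀ 0 0 * pathMatrix vars l₀' 0 1 -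
        pathMatrix vars l₀ 0 1 * pathMatrix vars l₀' 0 0))) := by
  intro lp lq hp hq
  have hne : endpoint lp ≠ endpoint lq := by rwa [hp, hq]
  have h0 := det_top_rows_ne_zero hne
  rw [pathMatrix_top_row hp.symm, pathMatrix_top_row hp.symm, pathMatrix_top_row hq.symm,
    pathMatrix_top_row hq.symm]
  refine ⟨⟨h0, rfl, rfl⟩, fun l hl => ?_⟩
  have hend : endpoint lq = endpoint (lp ++ l) := by
    rw [show endpoint (lp ++ l) = endpoint lp + endpoint l by simp [endpoint], hl, hp, hq]
    abel
  have hdet := nonInt_vars.det_pathMatrix lp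
  have hrow : ∀ j, pathMatrix vars lq 0 j =
      (pathMatrix (vars + intVec (RatFun ℚ) (endpoint l₀)) l * pathMatrix vars lp) 0 j := fun j => by
    rw [pathMatrix_top_row hend, pathMatrix_append, hp]
  have hΔ : connDet vars (endpoint l₀) *
      pathMatrix (vars + intVec (RatFun ℚ) (endpoint l₀)) l 0 1 =
      pathMatrix vars lp 0 0 * pathMatrix vars lq 0 1 -
        pathMatrix vars lp 0 1 * pathMatrix vars lq 0 0 := by
    rw [hp, Matrix.det_fin_two] at hdet
    rw [hrow, hrow, Matrix.mul_apply, Matrix.mul_apply, Fin.sum_univ_two, Fin.sum_univ_two, ← hdet]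
    ring
  dsimp only
  rw [hΔ]
  exact ⟨h0, rfl, rfl⟩

end ThreeTerm

end

theorem theorem1p1 :
    -- lattice paths to every integer vector `r`, of length `|r₀| + ⋯ + |r₄|`
    (∀ r : Fin 5 → ℤ, ∃ l : List (Fin 5 × Bool),
      ThreeTerm.endpoint l = r ∧ l.length = ∑ j, (r j).natAbs) ∧
    -- the symmetry group has order 72 and is `S₂ ⋉ (S₃ × S₃)`
    Nat.card ThreeTerm.symGroup = 72 ∧
    ∃ Φ : ThreeTerm.symGroup ≃* ThreeTerm.S2S3S3,
      Φ (ThreeTerm.gen .infty 0) = SemidirectProduct.inr (Equiv.swap 0 1) ∧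
      Φ (ThreeTerm.gen .zero 1) = SemidirectProduct.inl
        (Pi.mulSingle (1 : Fin 2) (Equiv.swap (0 : Fin 3) 1) : Fin 2 → Equiv.Perm (Fin 3)) ∧
      Φ (ThreeTerm.gen .zero 2) = SemidirectProduct.inl
        (Pi.mulSingle (1 : Fin 2) (Equiv.swap (0 : Fin 3) 2) : Fin 2 → Equiv.Perm (Fin 3)) ∧
      ∀ p q : Fin 5 → ℤ, p ≠ q →
        -- linear independence over `ℂ(a)`
        (∀ ν i, ThreeTerm.LinIndepOverRat (ThreeTerm.domain p ∩ ThreeTerm.domain q)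
          (fun a => ThreeTerm.companion ν i (a + ThreeTerm.intVec ℂ p))
          (fun a => ThreeTerm.companion ν i (a + ThreeTerm.intVec ℂ q))) ∧
        ∃ u v : ThreeTerm.RatFun ℚ,
          -- one and the same relation for all six functions
          (∀ ν i, ThreeTerm.Relation (ThreeTerm.companion ν i) p q u v) ∧
          -- uniqueness, for each of the six functions separately
          (∀ ν i, ∀ u' v' : ThreeTerm.RatFun ℚ,
            ThreeTerm.Relation (ThreeTerm.companion ν i) p q u' v' → u' = u ∧ v' = v) ∧
          -- the recipe
          ThreeTerm.GivenByRecipe p q u v ∧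
          -- the symmetry
          (∀ ν i, ∀ σ : ThreeTerm.symGroup,
            ThreeTerm.SymRelation (ThreeTerm.companion ν i) σ.1
              (Equiv.Perm.sign (Φ σ).right) p q u v) := by
  refine ⟨ThreeTerm.exists_path, ThreeTerm.card_symGroup, ThreeTerm.symEquiv,
    (ThreeTerm.symEquiv_gen _ _).trans ThreeTerm.genElt_infty_zero,
    ThreeTerm.symEquiv_gen _ _, ThreeTerm.symEquiv_gen _ _, fun p q hpq => ?_⟩
  refine ⟨fun ν i => ThreeTerm.linIndepOverRat_companion ν i hpq, ?_⟩
  obtain ⟨l, rfl, -⟩ := ThreeTerm.exists_path p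
  obtain ⟨l', rfl, -⟩ := ThreeTerm.exists_path q
  have h := ThreeTerm.isCoeff_top_rows hpq
  exact ⟨_, _, h.relation hpq,
    fun ν i u' v' h' => ThreeTerm.relation_unique ν i hpq (h.relation hpq ν i) h',
    ThreeTerm.givenByRecipe_top_rows hpq, h.symRelation hpq⟩
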